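/- **Setting.** Write $\mathcal K=\mathcal B$ and take the sign $-$ for bosons, and $\mathcal K=\mathcal F$ and the sign $+$ for fermions. For admissible $c$ ($c\ge 0$ for bosons, $c\in\mathbb R$ for fermions) put $$\beta_{\mathcal K}(c)=\frac{\int_{\mathbb R^3}\frac{1}{e^{|p|^2+c}\pm1}\,dp}{\Big(\int_{\mathbb R^3}\frac{|p|^2}{e^{|p|^2+c}\pm1}\,dp\Big)^{3/5}} .$$ For $f:[0,1]\times\mathbb R^3\to\mathbb R$ let $N_f(x)=\int f(x,p)\,dp$, $P_f(x)=\int f(x,p)\,p\,dp$, $E_f(x)=\int f(x,p)|p|^2\,dp$. If $N_f(x)>0$ and $E_f(x)-|P_f(x)|^2/N_f(x)>0$, the local equilibrium is $$\mathcal K(f)(x,p)=\Big(e^{a(x)\left|p-\frac{P_f(x)}{N_f(x)}\right|^2+c(x)}\pm1\Big)^{-1},$$ where the admissible $c(x)$ and $a(x)$ are given by $$\frac{N_f(x)}{\big(E_f(x)-\frac{|P_f(x)|^2}{N_f(x)}\big)^{3/5}}=\beta_{\mathcal K}(c(x)),\qquad a(x)=\Big(\int_{\mathbb R^3}\tfrac{1}{e^{|p|^2+c(x)}\pm1}\,dp\Big)^{2/3}N_f(x)^{-2/3}.$$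 Let $f_L$ (on $p_1>0$) and $f_R$ (on $p_1<0$) be inflow data. For $\tau>0$, a *mild solution* of the slab problem $p_1\partial_xf=\frac{N_f}{\tau}(\mathcal K(f)-f)$ on $[0,1]$, $f(0,p)=f_L(p)$ for $p_1>0$, $f(1,p)=f_R(p)$ for $p_1<0$, is a function $f$ with $\int_0^1\!\int_{\mathbb R^3}|f|(1+|p|^2)\,dp\,dx<\infty$ whose local equilibrium exists at (almost) every $x$ and which satisfies $$f(x,p)=e^{-\frac{1}{\tau|p_1|}\int_0^xN_f}f_L(p)+\frac{1}{\tau|p_1|}\int_0^xe^{-\frac{1}{\tau|p_1|}\int_y^xN_f}N_f(y)\,\mathcal K(f)(y,p)\,dy\quad(p_1>0),$$ $$f(x,p)=e^{-\frac{1}{\tau|p_1|}\int_x^1N_f}f_R(p)+\frac{1}{\tau|p_1|}\int_x^1e^{-\frac{1}{\tau|p_1|}\int_x^yN_f}N_f(y)\,\mathcal K(f)(y,p)\,dy\quad(p_1<0).$$ Put $f_{LR}=f_L1_{p_1>0}+f_R1_{p_1<0}$, $a_u=2\int f_{LR}\,dp$, $c_u=2\int f_{LR}|p|^2\,dp$,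 and, for $\tau>0$, $$a_l(\tau)=\int e^{-\frac{a_u}{\tau|p_1|}}f_{LR}\,dp,\qquad c_l(\tau)=\int e^{-\frac{a_u}{\tau|p_1|}}f_{LR}|p|^2\,dp,$$ $$k(\tau)=\Big(\int_{p_1>0}e^{-\frac{a_u}{\tau|p_1|}}f_L|p_1|\,dp\Big)\Big(\int_{p_1<0}e^{-\frac{a_u}{\tau|p_1|}}f_R|p_1|\,dp\Big).$$ **Theorem 2.2.** Assume that 1. $f_{LR}\ge 0$; 2. $\int_{\mathbb R^3} f_{LR}(1+|p|^2)\,dp<\infty$ and $\int_{\mathbb R^3}\frac{1}{|p_1|}f_{LR}(1+|p|^2)\,dp<\infty$; 3. for $i=2,3$, $\int_{\mathbb R^2}f_L\,p_i\,dp_2dp_3=0$ for almost every $p_1>0$ and $\int_{\mathbb R^2}f_R\,p_i\,dp_2dp_3=0$ for almost every $p_1<0$; 4. for some $\tau_1>0$ (equivalently, since $k$ is nondecreasing in $\tau$, for all sufficiently large $\tau$) one has $k(\tau_1)>0$ and $$\frac{a_u^{8/5}}{k(\tau_1)^{3/5}}<\beta_{\mathcal B}(0)\ \text{ (bosons)},\qquad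 \frac{a_u^{8/5}}{k(\tau_1)^{3/5}}<\beta_{\mathcal F}(-\ln 3)\ \text{ (fermions)}.$$ Then there is $\tau_0>0$, depending on the data, such that for every $\tau\ge\tau_0$ there exists a unique nonnegative mild solution $f$ satisfying $$a_l(\tau)\le N_f(x)\le a_u,\qquad c_l(\tau)\le E_f(x)\le c_u,\qquad E_f(x)N_f(x)-|P_f(x)|^2\ge k(\tau).$$ More precisely, $f$ can be chosen so that the mild identities hold for every $x\in[0,1]$ and every $p$ with $p_1\ne0$, $f(x,\cdot)(1+|p|^2)$ is integrable and the bounds hold for every $x\in[0,1]$; and every nonnegative mild solution for which the identities and the bounds hold merely almost everywhere equals $f$ almost everywhere on $[0,1]\times\mathbb R^3$. -/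

import Mathlib

open MeasureTheory Set Filter

namespace QuantumBGK

/-- The momentum space, three-dimensional Euclidean space; `p 0`, `p 1`, `p 2` are the
coordinates written `p₁, p₂, p₃` on paper. -/
abbrev Momentum : Type := EuclideanSpace ℝ (Fin 3)

/-- The two kinds of quantum particles. -/
inductive Particle : Type
  | boson
  | fermion

/-- The sign in the denominator of the equilibrium: `-1` for bosons, `+1` for fermions. -/
def Particle.sign : Particle → ℝ
  | .boson => -1
  | .fermion => 1

/-- The parameters `c` for which `1 / (e^{|p|^2 + c} ± 1)` is a distribution: `c ≥ 0` for bosons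
(no condensation), every real `c` for fermions (non-saturated). -/
def Particle.Admissible : Particle → ℝ → Prop
  | .boson, c => 0 ≤ c
  | .fermion, _ => True

/-- The value of `c` at which the smallness condition is read: `0` for bosons, `-ln 3` for
fermions. -/
noncomputable def Particle.cCrit : Particle → ℝ
  | .boson => 0
  | .fermion => -Real.log 3

/-- `∫ 1 / (e^{|p|^2 + c} ± 1) dp`. -/
noncomputable def massIntegral (s : Particle) (c : ℝ) : ℝ :=
  ∫ p : Momentum, 1 / (Real.exp (‖p‖ ^ 2 + c) + s.sign)

/-- `∫ |p|^2 / (e^{|p|^2 + c} ± 1) dp`. -/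
noncomputable def energyIntegral (s : Particle) (c : ℝ) : ℝ :=
  ∫ p : Momentum, ‖p‖ ^ 2 / (Real.exp (‖p‖ ^ 2 + c) + s.sign)

/-- The function `β`. -/
noncomputable def beta (s : Particle) (c : ℝ) : ℝ :=
  massIntegral s c / energyIntegral s c ^ (3 / 5 : ℝ)

/-- Macroscopic mass of a momentum distribution. -/
noncomputable def mass (g : Momentum → ℝ) : ℝ := ∫ p, g p

/-- Macroscopic momentum of a momentum distribution. -/
noncomputable def momentum (g : Momentum → ℝ) : Momentum := ∫ p, g p • p

/-- Macroscopic energy of a momentum distribution. -/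
noncomputable def energy (g : Momentum → ℝ) : ℝ := ∫ p, g p * ‖p‖ ^ 2

/-- `a` and `c` are the equilibrium parameters of a distribution with mass `N`, momentum `P` and
energy `E`. -/
def IsEquilibriumParam (s : Particle) (N : ℝ) (P : Momentum) (E a c : ℝ) : Prop :=
  0 < N ∧ 0 < E - ‖P‖ ^ 2 / N ∧ s.Admissible c ∧
    N / (E - ‖P‖ ^ 2 / N) ^ (3 / 5 : ℝ) = beta s c ∧
    a = massIntegral s c ^ (2 / 3 : ℝ) * N ^ (-(2 / 3) : ℝ)

/-- The local equilibrium with parameters `N, P, a, c`: the Bose-Einstein distribution without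
condensation, or the non-saturated Fermi-Dirac distribution. -/
noncomputable def equilibrium (s : Particle) (N : ℝ) (P : Momentum) (a c : ℝ) (p : Momentum) : ℝ :=
  (Real.exp (a * ‖p - N⁻¹ • P‖ ^ 2 + c) + s.sign)⁻¹

/-- The right-hand side of the mild formulation at `(x, p)` (used for `p₁ ≠ 0`), where `a` and `c`
are the equilibrium parameters of `f` as functions of the position. -/
noncomputable def mildRHS (s : Particle) (τ : ℝ) (fL fR : Momentum → ℝ) (f : ℝ → Momentum → ℝ)
    (a c : ℝ → ℝ) (x : ℝ) (p : Momentum) : ℝ :=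
  if 0 < p 0 then
    Real.exp (-(1 / (τ * |p 0|)) * ∫ y in (0 : ℝ)..x, mass (f y)) * fL p
      + 1 / (τ * |p 0|) * ∫ y in (0 : ℝ)..x,
          Real.exp (-(1 / (τ * |p 0|)) * ∫ z in y..x, mass (f z)) * mass (f y)
            * equilibrium s (mass (f y)) (momentum (f y)) (a y) (c y) p
  else
    Real.exp (-(1 / (τ * |p 0|)) * ∫ y in x..(1 : ℝ), mass (f y)) * fR p
      + 1 / (τ * |p 0|) * ∫ y in x..(1 : ℝ),
          Real.exp (-(1 / (τ * |p 0|)) * ∫ z in x..y, mass (f z)) * mass (f y)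
            * equilibrium s (mass (f y)) (momentum (f y)) (a y) (c y) p

/-- Lebesgue measure on the slab `[0,1] × ℝ³`. -/
noncomputable def slab : Measure (ℝ × Momentum) :=
  (volume.restrict (Icc (0 : ℝ) 1)).prod volume

/-- `f ∈ L¹₂([0,1] × ℝ³)`. -/
def MemL12 (f : ℝ → Momentum → ℝ) : Prop :=
  Integrable (fun z : ℝ × Momentum => f z.1 z.2 * (1 + ‖z.2‖ ^ 2)) slab

/-- Mild solutions of the stationary quantum BGK slab problem, as classes of functions: the
identities hold almost everywhere. -/
def IsMildSolution (s : Particle) (τ : ℝ) (fL fR : Momentum → ℝ) (f : ℝ → Momentum → ℝ) : Prop :=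
  MemL12 f ∧ ∃ a c : ℝ → ℝ,
    (∀ᵐ x ∂volume.restrict (Icc (0 : ℝ) 1),
      IsEquilibriumParam s (mass (f x)) (momentum (f x)) (energy (f x)) (a x) (c x)) ∧
    ∀ᵐ z ∂slab, f z.1 z.2 = mildRHS s τ fL fR f a c z.1 z.2

/-- Mild solutions for which everything holds at every position `x ∈ [0,1]` and every momentum `p`
with `p₁ ≠ 0`. -/
def IsMildSolutionEverywhere (s : Particle) (τ : ℝ) (fL fR : Momentum → ℝ)
    (f : ℝ → Momentum → ℝ) : Prop :=
  MemL12 f ∧ (∀ x ∈ Icc (0 : ℝ) 1, Integrable (fun p => f x p * (1 + ‖p‖ ^ 2))) ∧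
  ∃ a c : ℝ → ℝ, ∀ x ∈ Icc (0 : ℝ) 1,
    IsEquilibriumParam s (mass (f x)) (momentum (f x)) (energy (f x)) (a x) (c x) ∧
    ∀ p : Momentum, p 0 ≠ 0 → f x p = mildRHS s τ fL fR f a c x p

/-- The inflow datum `f_{LR}` on the whole momentum space. -/
noncomputable def inflow (fL fR : Momentum → ℝ) (p : Momentum) : ℝ :=
  if 0 < p 0 then fL p else if p 0 < 0 then fR p else 0

/-- `a_u`. -/
noncomputable def aUpper (fL fR : Momentum → ℝ) : ℝ := 2 * ∫ p, inflow fL fR p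

/-- `c_u`. -/
noncomputable def cUpper (fL fR : Momentum → ℝ) : ℝ := 2 * ∫ p, inflow fL fR p * ‖p‖ ^ 2

/-- `a_l`. -/
noncomputable def aLower (fL fR : Momentum → ℝ) (τ : ℝ) : ℝ :=
  ∫ p : Momentum, Real.exp (-(aUpper fL fR / (τ * |p 0|))) * inflow fL fR p

/-- `c_l`. -/
noncomputable def cLower (fL fR : Momentum → ℝ) (τ : ℝ) : ℝ :=
  ∫ p : Momentum, Real.exp (-(aUpper fL fR / (τ * |p 0|))) * inflow fL fR p * ‖p‖ ^ 2

/-- `k`. -/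
noncomputable def kConst (fL fR : Momentum → ℝ) (τ : ℝ) : ℝ :=
  (∫ p in {p : Momentum | 0 < p 0}, Real.exp (-(aUpper fL fR / (τ * |p 0|))) * fL p * |p 0|) *
  (∫ p in {p : Momentum | p 0 < 0}, Real.exp (-(aUpper fL fR / (τ * |p 0|))) * fR p * |p 0|)

/-- The bounds on the macroscopic fields of a momentum distribution `g`. -/
def MacroBounds (fL fR : Momentum → ℝ) (τ : ℝ) (g : Momentum → ℝ) : Prop :=
  (aLower fL fR τ ≤ mass g ∧ mass g ≤ aUpper fL fR) ∧
  (cLower fL fR τ ≤ energy g ∧ energy g ≤ cUpper fL fR) ∧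
  kConst fL fR τ ≤ energy g * mass g - ‖momentum g‖ ^ 2

end QuantumBGK

namespace QuantumBGK

/-! The problem reduces to a fixed point problem for the macroscopic fields `(N, P, E)` alone. Once
a profile of fields obeying the bounds is given, the local equilibria are known and the mild formula
is the explicit solution `transport` of a linear problem; its moments form a new profile,
`fieldMap`. Mild solutions within the bounds correspond to fixed points, and for large `τ`
collisions are so weak that the map preserves the bounds and halves uniform distances.

This needs equilibria that are Lipschitz in the fields. With `T = E - |P|²/N`, the equation for `c`
becomes `energyRatio s c = T / N^(5/3)`. The left side is strictly increasing with slope bounded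
below on bounded ranges (`exists_energyRatio_gap`): dilate the equilibrium at `d > c` to the mass of
the one at `c`; the two profiles cross on a single sphere, the dilated one is larger outside it and
hence has more energy. The smallness condition confines `c` to a compact range above the critical
value, for bosons at a positive distance from condensation, where the denominators are comparable to
exponentials. Hence the equilibria are dominated by, and Lipschitz with respect to, one integrable
weight (`exists_dominated_equilibrium`).

In the transport problem, a change of the fields alters the inflow part by a factor `1/(τ|p₁|)`,
which the data can integrate. In the gain part, the attenuation between `y` and `x` compensates the
singular prefactor `1/(τ|p₁|)` and leaves `min (1/(τ|p₁|)) (4/n₀)`, with `n₀` a lower bound for the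
mass. Its integral against the weight tends to zero as `τ → ∞` (`tendsto_collision_integral`).

The bounds survive for the following reasons (`fieldsOf_transport_mem`). The factor 2 in `a_u` and
`c_u` leaves room for a small gain, and attenuation over the slab costs at most `e^(-a_u/(τ|p₁|))`.
If `A` and `B` are the fluxes to the right and to the left, then `E N ≥ (A + B)²` and `P₁ = A - B`,
so `E N - P₁² ≥ 4 A B`. The inflow carries no transverse momentum, so `P₂` and `P₃` come from the
gain only, and `4 k` minus a small error is still at least `k`. -/

/-- The occupation number `1 / (e^X ± 1)`. -/
noncomputable def occupation (s : Particle) (X : ℝ) : ℝ := 1 / (Real.exp X + s.sign)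

/-! ### Occupation numbers: bounds on values and slopes -/

lemma Particle.neg_one_le_sign (s : Particle) : -1 ≤ s.sign := by
  cases s <;> norm_num [Particle.sign]

lemma Particle.sign_le_one (s : Particle) : s.sign ≤ 1 := by
  cases s <;> norm_num [Particle.sign]

lemma Particle.Admissible.mono {s : Particle} {c d : ℝ} (hc : s.Admissible c) (h : c ≤ d) :
    s.Admissible d := by
  cases s
  · exact le_trans (show (0 : ℝ) ≤ c from hc) h
  · trivial

/-- This is `t/2 ≤ sinh (t/2)` multiplied by `2 e^(t/2)`. It records both the linear vanishing of
`e^t - 1` at zero and exponential growth at infinity, which the critical Bose distribution requires.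
-/
lemma mul_exp_half_le {t : ℝ} (ht : 0 ≤ t) : t * Real.exp (t / 2) ≤ Real.exp t - 1 := by
  have h := Real.self_le_sinh_iff.2 (show 0 ≤ t / 2 by linarith)
  rw [Real.sinh_eq] at h
  have h1 : Real.exp t = Real.exp (t / 2) * Real.exp (t / 2) := by
    rw [← Real.exp_add]; congr 1; ring
  have h2 : Real.exp (t / 2) * Real.exp (-(t / 2)) = 1 := by
    rw [← Real.exp_add]; simp
  nlinarith [Real.exp_pos (t / 2)]

/-- Lower bound on the denominator of the occupation number. -/
lemma Particle.Admissible.denom_ge {s : Particle} {c : ℝ} (hc : s.Admissible c) {t : ℝ}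
    (ht : 0 ≤ t) : min 1 (Real.exp c) * (t * Real.exp (t / 2)) ≤ Real.exp (t + c) + s.sign := by
  have h := mul_exp_half_le ht
  have h0 : 0 ≤ t * Real.exp (t / 2) := by positivity
  have h1 := Real.add_one_le_exp t
  rw [Real.exp_add]
  cases s
  · have hc' : 1 ≤ Real.exp c := Real.one_le_exp hc
    rw [min_eq_left hc']
    simp only [Particle.sign]
    nlinarith [Real.exp_pos t]
  · simp only [Particle.sign]
    have := min_le_right 1 (Real.exp c)
    nlinarith [Real.exp_pos t, Real.exp_pos c]

lemma Particle.Admissible.denom_pos {s : Particle} {c : ℝ} (hc : s.Admissible c) {t : ℝ}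
    (ht : 0 < t) : 0 < Real.exp (t + c) + s.sign := by
  refine lt_of_lt_of_le ?_ (hc.denom_ge ht.le)
  have := lt_min one_pos (Real.exp_pos c)
  positivity

lemma occupation_sub {s : Particle} {X Y : ℝ} (hX : 0 < Real.exp X + s.sign)
    (hY : 0 < Real.exp Y + s.sign) :
    occupation s X - occupation s Y =
      (Real.exp Y - Real.exp X) / ((Real.exp X + s.sign) * (Real.exp Y + s.sign)) := by
  unfold occupation
  field_simp
  ring

lemma occupation_pos {s : Particle} {X : ℝ} (hX : 0 < Real.exp X + s.sign) :
    0 < occupation s X := one_div_pos.2 hX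

lemma occupation_antitone {s : Particle} {X Y : ℝ} (hX : 0 < Real.exp X + s.sign) (h : X ≤ Y) :
    occupation s Y ≤ occupation s X :=
  one_div_le_one_div_of_le hX (by linarith [Real.exp_le_exp.2 h])

/-- Lower bound on the slope of the occupation number on a bounded range. -/
lemma occupation_gap {s : Particle} {A B X Y : ℝ} (hX : 0 < Real.exp X + s.sign) (hA : A ≤ X)
    (hXY : X ≤ Y) (hB : Y ≤ B) :
    Real.exp A / (Real.exp B + 1) ^ 2 * (Y - X) ≤ occupation s X - occupation s Y := by
  have e1 := Real.exp_le_exp.2 hA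
  have e2 := Real.exp_le_exp.2 hXY
  have e3 := Real.exp_le_exp.2 hB
  have hs := s.sign_le_one
  rw [occupation_sub hX (by linarith)]
  have h1 : Real.exp A * (Y - X) ≤ Real.exp Y - Real.exp X := by
    have h2 := Real.add_one_le_exp (Y - X)
    have h3 : Real.exp Y = Real.exp X * Real.exp (Y - X) := by
      rw [← Real.exp_add]; congr 1; ring
    have : 0 ≤ Y - X := by linarith
    nlinarith [Real.exp_pos X]
  rw [div_mul_eq_mul_div]
  refine div_le_div₀ (by linarith) h1 (mul_pos hX (by linarith)) ?_
  rw [sq]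
  exact mul_le_mul (by linarith) (by linarith) (by linarith) (by positivity)

/-- The sign of `r` decides which exponent is larger, so the product on the right is nonnegative on
either side of the crossing `r = 0`; the slope bound makes this quadratic. It is applied with `r =
|p|² - t₀`. -/
lemma crossing_gap {s : Particle} {A B X Y δ r : ℝ} (hX : 0 < Real.exp X + s.sign)
    (hY : 0 < Real.exp Y + s.sign) (hAX : A ≤ X) (hAY : A ≤ Y) (hXB : X ≤ B) (hYB : Y ≤ B)
    (hδ : 0 ≤ δ) (hXY : X - Y = δ * r) :
    Real.exp A / (Real.exp B + 1) ^ 2 * δ * r ^ 2 ≤ r * (occupation s Y - occupation s X) := by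
  rcases le_total 0 r with hr | hr
  · have h := occupation_gap hY hAY (by nlinarith) hXB
    rw [hXY] at h
    linarith [mul_le_mul_of_nonneg_left h hr]
  · have h := occupation_gap hX hAX (by nlinarith) hYB
    rw [show Y - X = δ * -r by linarith] at h
    linarith [mul_le_mul_of_nonneg_left h (neg_nonneg.2 hr)]

lemma measurable_occupation (s : Particle) : Measurable (occupation s) := by
  unfold occupation; fun_prop

/-! ### Mass and energy integrals of the equilibria -/

lemma ae_normSq_pos : ∀ᵐ p : Momentum, 0 < ‖p‖ ^ 2 := by
  have h : ∀ᵐ p : Momentum, p ≠ 0 := by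
    rw [ae_iff]; simp
  filter_upwards [h] with p hp
  have := norm_pos_iff.2 hp
  positivity

lemma integrable_gaussian {b : ℝ} (hb : 0 < b) :
    Integrable (fun p : Momentum => Real.exp (-b * ‖p‖ ^ 2)) := by
  refine (integrable_fun_norm_addHaar volume (f := fun r => Real.exp (-b * r ^ 2))).2 ?_
  have := integrableOn_rpow_mul_exp_neg_mul_sq hb (s := 2) (by norm_num)
  simpa using this

/-- In polar coordinates the Jacobian `r²` cancels the singularity; this is where dimension three
makes `c = 0` admissible for bosons. -/
lemma integrable_inv_sq_mul_gaussian :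
    Integrable (fun p : Momentum => (‖p‖ ^ 2)⁻¹ * Real.exp (-(1 / 2) * ‖p‖ ^ 2)) := by
  refine (integrable_fun_norm_addHaar volume
    (f := fun r => (r ^ 2)⁻¹ * Real.exp (-(1 / 2) * r ^ 2))).2 ?_
  have := (integrable_exp_neg_mul_sq (b := 1 / 2) (by norm_num)).integrableOn (s := Ioi 0)
  refine this.congr_fun ?_ measurableSet_Ioi
  intro r hr
  have hr : (0 : ℝ) < r := hr
  simp
  field_simp

/-- The singularity `1/t`, with `t = |p|²`, is the one of the Bose distribution at `c = 0`; one
integrable bound of this shape serves every admissible `c`. -/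
lemma occupation_le_singular {s : Particle} {c : ℝ} (hc : s.Admissible c) {t : ℝ} (ht : 0 < t) :
    occupation s (t + c) ≤ (min 1 (Real.exp c))⁻¹ * (t⁻¹ * Real.exp (-(1 / 2) * t)) := by
  have h := hc.denom_ge ht.le
  have := lt_min one_pos (Real.exp_pos c)
  have h2 : (min 1 (Real.exp c))⁻¹ * (t⁻¹ * Real.exp (-(1 / 2) * t))
      = 1 / (min 1 (Real.exp c) * (t * Real.exp (t / 2))) := by
    rw [show -(1 / 2) * t = -(t / 2) by ring, Real.exp_neg]
    simp [mul_comm]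
  rw [h2]
  exact one_div_le_one_div_of_le (by positivity) h

lemma integrable_occupation {s : Particle} {c : ℝ} (hc : s.Admissible c) :
    Integrable (fun p : Momentum => occupation s (‖p‖ ^ 2 + c)) := by
  refine (integrable_inv_sq_mul_gaussian.const_mul (min 1 (Real.exp c))⁻¹).mono'
    ((measurable_occupation s).comp (by fun_prop)).aestronglyMeasurable ?_
  filter_upwards [ae_normSq_pos] with p hp
  rw [Real.norm_of_nonneg (occupation_pos (hc.denom_pos hp)).le]
  exact occupation_le_singular hc hp

lemma integrable_sq_mul_occupation {s : Particle} {c : ℝ} (hc : s.Admissible c) :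
    Integrable (fun p : Momentum => ‖p‖ ^ 2 * occupation s (‖p‖ ^ 2 + c)) := by
  have h := (integrable_gaussian (b := 1 / 2) (by norm_num)).const_mul (min 1 (Real.exp c))⁻¹
  refine h.mono' ((by fun_prop : Measurable fun p : Momentum => ‖p‖ ^ 2).mul
    ((measurable_occupation s).comp (by fun_prop))).aestronglyMeasurable ?_
  filter_upwards [ae_normSq_pos] with p hp
  have h1 := occupation_le_singular hc hp
  have h2 := (occupation_pos (hc.denom_pos hp)).le
  rw [Real.norm_of_nonneg (by positivity)]
  calc ‖p‖ ^ 2 * occupation s (‖p‖ ^ 2 + c) ≤ ‖p‖ ^ 2 * _ := mul_le_mul_of_nonneg_left h1 hp.le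
    _ = _ := by
        rw [mul_left_comm, ← mul_assoc (‖p‖ ^ 2), mul_inv_cancel₀ hp.ne', one_mul]

lemma massIntegral_eq (s : Particle) (c : ℝ) :
    massIntegral s c = ∫ p : Momentum, occupation s (‖p‖ ^ 2 + c) := rfl

lemma energyIntegral_eq (s : Particle) (c : ℝ) :
    energyIntegral s c = ∫ p : Momentum, ‖p‖ ^ 2 * occupation s (‖p‖ ^ 2 + c) := by
  simp [energyIntegral, occupation, div_eq_mul_inv]

/-- A nonnegative function that is at least `m` on `A` has integral at least `m * |A|`. -/
lemma const_mul_measureReal_le_integral {F : Momentum → ℝ} (hF : Integrable F)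
    (h0 : ∀ᵐ p, 0 ≤ F p) {A : Set Momentum} (hA : MeasurableSet A) (hfin : volume A ≠ ⊤) {m : ℝ}
    (hm : ∀ᵐ p, p ∈ A → m ≤ F p) : m * volume.real A ≤ ∫ p, F p := by
  calc m * volume.real A = ∫ _ in A, m := by
        rw [setIntegral_const]; simp [mul_comm]
    _ ≤ ∫ p in A, F p := by
        refine integral_mono_ae (integrableOn_const hfin) hF.integrableOn ?_
        exact (ae_restrict_iff' hA).2 hm
    _ ≤ ∫ p, F p := setIntegral_le_integral hF h0

/-- A bounded ball, on which `‖p‖² < 1`. -/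
def lowMomenta : Set Momentum := {p | ‖p‖ ^ 2 < 1}

/-- A bounded annulus, on which `3 < ‖p‖² < 4`. -/
def highMomenta : Set Momentum := {p | 3 < ‖p‖ ^ 2 ∧ ‖p‖ ^ 2 < 4}

lemma isOpen_lowMomenta : IsOpen lowMomenta := isOpen_lt (by fun_prop) (by fun_prop)

lemma isOpen_highMomenta : IsOpen highMomenta := by
  have h : Continuous fun p : Momentum => ‖p‖ ^ 2 := by fun_prop
  exact (isOpen_lt continuous_const h).inter (isOpen_lt h continuous_const)

lemma volume_ne_top_of_normSq_lt {A : Set Momentum} (h : ∀ p ∈ A, ‖p‖ ^ 2 < 4) :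
    volume A ≠ ⊤ := by
  refine ne_top_of_le_ne_top (measure_ball_lt_top (x := (0 : Momentum)) (r := 2)).ne
    (measure_mono fun p hp => ?_)
  have := h p hp
  rw [mem_ball_zero_iff]
  nlinarith [norm_nonneg p]

lemma volume_lowMomenta_ne_top : volume lowMomenta ≠ ⊤ :=
  volume_ne_top_of_normSq_lt fun p hp => by
    have : ‖p‖ ^ 2 < 1 := hp
    linarith

lemma volume_highMomenta_ne_top : volume highMomenta ≠ ⊤ :=
  volume_ne_top_of_normSq_lt fun _ hp => hp.2

lemma volume_lowMomenta_pos : 0 < volume.real lowMomenta := by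
  refine ENNReal.toReal_pos (isOpen_lowMomenta.measure_pos volume ⟨0, ?_⟩).ne'
    volume_lowMomenta_ne_top
  simp [lowMomenta]

lemma volume_highMomenta_pos : 0 < volume.real highMomenta := by
  refine ENNReal.toReal_pos (isOpen_highMomenta.measure_pos volume
    ⟨EuclideanSpace.single 0 (9 / 5), ?_⟩).ne' volume_highMomenta_ne_top
  simp [highMomenta]
  norm_num

lemma massIntegral_pos {s : Particle} {c : ℝ} (hc : s.Admissible c) : 0 < massIntegral s c := by
  have h := const_mul_measureReal_le_integral (integrable_occupation hc)
    (ae_normSq_pos.mono fun p hp => (occupation_pos (hc.denom_pos hp)).le)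
    isOpen_highMomenta.measurableSet volume_highMomenta_ne_top (m := occupation s (4 + c))
    (Eventually.of_forall fun p hp => occupation_antitone
      (hc.denom_pos (by linarith [hp.1])) (by linarith [hp.2]))
  have h1 := occupation_pos (hc.denom_pos (show (0 : ℝ) < 4 by norm_num))
  have := volume_highMomenta_pos
  rw [massIntegral_eq]
  exact lt_of_lt_of_le (by positivity) h

lemma energyIntegral_pos {s : Particle} {c : ℝ} (hc : s.Admissible c) :
    0 < energyIntegral s c := by
  have h1 := occupation_pos (hc.denom_pos (show (0 : ℝ) < 4 by norm_num))
  have h := const_mul_measureReal_le_integral (integrable_sq_mul_occupation hc)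
    (ae_normSq_pos.mono fun p hp => mul_nonneg hp.le (occupation_pos (hc.denom_pos hp)).le)
    isOpen_highMomenta.measurableSet volume_highMomenta_ne_top (m := occupation s (4 + c))
    (Eventually.of_forall fun p hp => by
      have h2 := occupation_antitone (s := s) (X := ‖p‖ ^ 2 + c) (Y := 4 + c)
        (hc.denom_pos (by linarith [hp.1])) (by linarith [hp.2])
      nlinarith [hp.1])
  have := volume_highMomenta_pos
  rw [energyIntegral_eq]
  exact lt_of_lt_of_le (by positivity) h

lemma massIntegral_antitone {s : Particle} {c d : ℝ} (hc : s.Admissible c) (h : c ≤ d) :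
    massIntegral s d ≤ massIntegral s c := by
  refine integral_mono_ae (integrable_occupation (hc.mono h)) (integrable_occupation hc) ?_
  filter_upwards [ae_normSq_pos] with p hp
  exact occupation_antitone (hc.denom_pos hp) (by linarith)

lemma massIntegral_gap {s : Particle} {L B c d : ℝ} (hL : s.Admissible L) (hc : L ≤ c)
    (hcd : c ≤ d) (hd : d ≤ B) :
    Real.exp L / (Real.exp (4 + B) + 1) ^ 2 * (d - c) * volume.real highMomenta
      ≤ massIntegral s c - massIntegral s d := by
  have hc' := hL.mono hc
  have hd' := hc'.mono hcd
  have hi := (integrable_occupation hc').sub (integrable_occupation hd')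
  rw [massIntegral_eq, massIntegral_eq, ← integral_sub (integrable_occupation hc')
    (integrable_occupation hd')]
  refine const_mul_measureReal_le_integral hi ?_ isOpen_highMomenta.measurableSet
    volume_highMomenta_ne_top ?_
  · filter_upwards [ae_normSq_pos] with p hp
    exact sub_nonneg.2 (occupation_antitone (hc'.denom_pos hp) (by linarith))
  · refine Eventually.of_forall fun p hp => ?_
    have := occupation_gap (s := s) (A := L) (B := 4 + B) (X := ‖p‖ ^ 2 + c) (Y := ‖p‖ ^ 2 + d)
      (hc'.denom_pos (by linarith [hp.1])) (by linarith [hp.1]) (by linarith) (by linarith [hp.2])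
    simpa using this

/-! ### Quantitative monotonicity of the energy ratio -/

/-- The ratio `E / N^{5/3}` as a function of `c`, a power of `β`. -/
noncomputable def energyRatio (s : Particle) (c : ℝ) : ℝ :=
  energyIntegral s c / massIntegral s c ^ (5 / 3 : ℝ)

lemma integral_comp_inv_smul {σ : ℝ} (hσ : 0 < σ) (f : Momentum → ℝ) :
    ∫ p, f (σ⁻¹ • p) = σ ^ 3 * ∫ p, f p := by
  rw [Measure.integral_comp_smul]
  simp [abs_of_pos hσ]

/-- The equilibrium at `d`, rescaled to the mass of the one at `c < d`, has more energy. -/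
lemma scaled_energy_gap {s : Particle} {L B c d σ : ℝ} (hL : s.Admissible L) (hc : L ≤ c)
    (hcd : c ≤ d) (hd : d ≤ B) (hσ : 1 < σ)
    (hmass : σ ^ 3 * massIntegral s d = massIntegral s c) :
    Real.exp L / (Real.exp (4 + B) + 1) ^ 2 * (1 - (σ ^ 2)⁻¹) *
      min (volume.real lowMomenta) (volume.real highMomenta)
      ≤ σ ^ 5 * energyIntegral s d - energyIntegral s c := by
  have hc' := hL.mono hc
  have hd' := hc'.mono hcd
  have hσ0 : 0 < σ := by linarith
  set m := Real.exp L / (Real.exp (4 + B) + 1) ^ 2 with hm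
  have hm0 : 0 ≤ m := by positivity
  set δ := 1 - (σ ^ 2)⁻¹ with hδ
  have hδ0 : 0 < δ := by
    have : (σ ^ 2)⁻¹ < 1 := inv_lt_one_of_one_lt₀ (by nlinarith)
    linarith
  -- At `|p|² = t` the exponents of the undilated and the dilated profile differ by `δ (t - t₀)`, so
  -- the profiles cross on the sphere `|p|² = t₀`.
  set t₀ := (d - c) / δ with ht₀
  have hδt : δ * t₀ = d - c := by rw [ht₀]; field_simp
  set g : Momentum → ℝ := fun p => occupation s (‖p‖ ^ 2 * (σ ^ 2)⁻¹ + d) with hg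
  set h : Momentum → ℝ := fun p => occupation s (‖p‖ ^ 2 + c) with hh
  have hgs : g = fun p => (fun q : Momentum => occupation s (‖q‖ ^ 2 + d)) (σ⁻¹ • p) := by
    funext p
    simp only [hg, norm_smul, mul_pow, norm_inv, Real.norm_eq_abs, abs_of_pos hσ0, inv_pow]
    rw [mul_comm]
  have hgs2 : (fun p => ‖p‖ ^ 2 * g p) = fun p => σ ^ 2 *
      (fun q : Momentum => ‖q‖ ^ 2 * occupation s (‖q‖ ^ 2 + d)) (σ⁻¹ • p) := by
    funext p
    rw [hgs]
    simp only [norm_smul, mul_pow, norm_inv, Real.norm_eq_abs, abs_of_pos hσ0, inv_pow]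
    field_simp
  have hgi : Integrable g := by
    rw [hgs]; exact (integrable_occupation hd').comp_smul (inv_ne_zero hσ0.ne')
  have hgi2 : Integrable (fun p => ‖p‖ ^ 2 * g p) := by
    rw [hgs2]
    exact ((integrable_sq_mul_occupation hd').comp_smul (inv_ne_zero hσ0.ne')).const_mul _
  have hhi : Integrable h := integrable_occupation hc'
  have hhi2 : Integrable (fun p => ‖p‖ ^ 2 * h p) := integrable_sq_mul_occupation hc'
  have e1 : ∫ p, g p = ∫ p, h p := by
    rw [hgs, integral_comp_inv_smul hσ0, ← massIntegral_eq, hmass]; rfl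
  have e2 : ∫ p, ‖p‖ ^ 2 * g p = σ ^ 5 * energyIntegral s d := by
    rw [hgs2, integral_const_mul, integral_comp_inv_smul hσ0
      (fun q : Momentum => ‖q‖ ^ 2 * occupation s (‖q‖ ^ 2 + d)), ← energyIntegral_eq]
    ring
  have e3 : ∫ p, ‖p‖ ^ 2 * h p = energyIntegral s c := (energyIntegral_eq s c).symm
  -- Both profiles have the same mass, so subtracting `t₀ (g - h)` leaves the energy difference
  -- unchanged; the integrand becomes `(|p|² - t₀)(g - h)`, which is nonnegative.
  have hFi : Integrable (fun p => (‖p‖ ^ 2 * g p - ‖p‖ ^ 2 * h p) - t₀ * (g p - h p)) :=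
    (hgi2.sub hhi2).sub ((hgi.sub hhi).const_mul _)
  have e4 : ∫ p, ((‖p‖ ^ 2 * g p - ‖p‖ ^ 2 * h p) - t₀ * (g p - h p))
      = σ ^ 5 * energyIntegral s d - energyIntegral s c := by
    have f1 := integral_sub hgi2 hhi2
    have f2 := integral_sub hgi hhi
    have f3 : Integrable fun p => ‖p‖ ^ 2 * g p - ‖p‖ ^ 2 * h p := hgi2.sub hhi2
    have f4 : Integrable fun p => t₀ * (g p - h p) := (hgi.sub hhi).const_mul _
    rw [integral_sub f3 f4, f1, integral_const_mul, f2, e1, e2, e3]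
    ring
  have hdiff : ∀ t : ℝ, (t + c) - (t * (σ ^ 2)⁻¹ + d) = δ * (t - t₀) := by
    intro t; rw [mul_sub, hδt, hδ]; ring
  have hnn : ∀ᵐ p, 0 ≤ (‖p‖ ^ 2 * g p - ‖p‖ ^ 2 * h p) - t₀ * (g p - h p) := by
    filter_upwards [ae_normSq_pos] with p hp
    have hX := hc'.denom_pos hp
    have hY := hd'.denom_pos (show 0 < ‖p‖ ^ 2 * (σ ^ 2)⁻¹ by positivity)
    have hD := hdiff (‖p‖ ^ 2)
    rw [show (‖p‖ ^ 2 * g p - ‖p‖ ^ 2 * h p) - t₀ * (g p - h p)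
      = (‖p‖ ^ 2 - t₀) * (g p - h p) by ring]
    rcases le_total (‖p‖ ^ 2) t₀ with hle | hle
    · have : g p ≤ h p := occupation_antitone hX (by nlinarith)
      exact mul_nonneg_of_nonpos_of_nonpos (by linarith) (by linarith)
    · have : h p ≤ g p := occupation_antitone hY (by nlinarith)
      exact mul_nonneg (by linarith) (by linarith)
  have hlow : ∀ p : Momentum, 0 < ‖p‖ ^ 2 → ‖p‖ ^ 2 < 4 → 1 ≤ |‖p‖ ^ 2 - t₀| →
      m * δ ≤ (‖p‖ ^ 2 * g p - ‖p‖ ^ 2 * h p) - t₀ * (g p - h p) := by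
    intro p hp hp4 habs
    have hX := hc'.denom_pos hp
    have hq0 : 0 < ‖p‖ ^ 2 * (σ ^ 2)⁻¹ := by positivity
    have hq1 : ‖p‖ ^ 2 * (σ ^ 2)⁻¹ ≤ ‖p‖ ^ 2 := by nlinarith
    have hY := hd'.denom_pos hq0
    have hD := hdiff (‖p‖ ^ 2)
    have hsq : 1 ≤ (‖p‖ ^ 2 - t₀) ^ 2 := by
      rw [← sq_abs]; exact one_le_pow₀ habs
    rw [show (‖p‖ ^ 2 * g p - ‖p‖ ^ 2 * h p) - t₀ * (g p - h p)
      = (‖p‖ ^ 2 - t₀) * (g p - h p) by ring]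
    refine le_trans (le_mul_of_one_le_right (by positivity) hsq) ?_
    exact crossing_gap hX hY (by linarith) (by linarith) (by linarith) (by linarith) hδ0.le hD
  rw [← e4]
  -- The position of `t₀` is not controlled, but one of the two test sets always keeps `|p|²` at
  -- distance at least 1 from it: the annulus if `t₀ ≤ 2`, the ball otherwise.
  rcases le_total t₀ 2 with h2 | h2
  · refine le_trans (mul_le_mul_of_nonneg_left (min_le_right _ _) (by positivity)) ?_
    refine const_mul_measureReal_le_integral hFi hnn isOpen_highMomenta.measurableSet
      volume_highMomenta_ne_top (Eventually.of_forall fun p hp => ?_)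
    exact hlow p (by linarith [hp.1]) hp.2 (by rw [abs_of_nonneg] <;> linarith [hp.1])
  · refine le_trans (mul_le_mul_of_nonneg_left (min_le_left _ _) (by positivity)) ?_
    refine const_mul_measureReal_le_integral hFi hnn isOpen_lowMomenta.measurableSet
      volume_lowMomenta_ne_top (ae_normSq_pos.mono fun p hp0 hp => ?_)
    have hp : ‖p‖ ^ 2 < 1 := hp
    exact hlow p hp0 (by linarith) (by rw [abs_of_nonpos] <;> linarith)

/-- The energy ratio is strictly increasing, with slope bounded below on bounded ranges. -/
theorem exists_energyRatio_gap {s : Particle} {L : ℝ} (hL : s.Admissible L) (B : ℝ) :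
    ∃ κ : ℝ, 0 < κ ∧ ∀ c d : ℝ, L ≤ c → c ≤ d → d ≤ B →
      κ * (d - c) ≤ energyRatio s d - energyRatio s c := by
  set m := Real.exp L / (Real.exp (4 + B) + 1) ^ 2 with hm
  set v := volume.real highMomenta with hv
  set w := min (volume.real lowMomenta) v with hw
  set Q := massIntegral s L with hQ
  have hm0 : 0 < m := by positivity
  have hv0 : 0 < v := volume_highMomenta_pos
  have hw0 : 0 < w := lt_min volume_lowMomenta_pos hv0
  have hQ0 : 0 < Q := massIntegral_pos hL
  -- The factor `2/3 (m v) / Q` bounds `1 - σ⁻²` from below per unit of `d - c`, the factors `m` and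
  -- `w` come from the energy gap, and `Q^(5/3)` bounds the normalization `M^(5/3)` from above.
  refine ⟨m * (2 / 3 * (m * v) / Q) * w / Q ^ (5 / 3 : ℝ), by positivity, ?_⟩
  intro c d hc hcd hd
  rcases hcd.eq_or_lt with rfl | hlt
  · simp
  have hc' := hL.mono hc
  have hd' := hc'.mono hcd
  set M := massIntegral s c with hM
  set M' := massIntegral s d with hM'
  have hM0 : 0 < M := massIntegral_pos hc'
  have hM'0 : 0 < M' := massIntegral_pos hd'
  have hMQ : M ≤ Q := massIntegral_antitone hL hc
  have hgap : m * (d - c) * v ≤ M - M' := massIntegral_gap hL hc hcd hd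
  have hdc : 0 < d - c := by linarith
  have hMM : M' < M := by
    have : 0 < m * (d - c) * v := by positivity
    linarith
  -- A dilation of momentum by `σ` multiplies mass by `σ³` and energy by `σ⁵`; this choice equalizes
  -- the masses.
  set σ := (M / M') ^ (1 / 3 : ℝ) with hσ
  have hσ1 : 1 < σ := Real.one_lt_rpow (by rw [one_lt_div hM'0]; exact hMM) (by norm_num)
  have hσ0 : 0 < σ := by linarith
  have hσ3 : σ ^ 3 = M / M' := by
    rw [hσ, ← Real.rpow_natCast, ← Real.rpow_mul (by positivity)]; norm_num
  have hσ5 : σ ^ 5 = M ^ (5 / 3 : ℝ) / M' ^ (5 / 3 : ℝ) := by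
    rw [hσ, ← Real.rpow_natCast, ← Real.rpow_mul (by positivity),
      ← Real.div_rpow hM0.le hM'0.le]; norm_num
  have key := scaled_energy_gap hL hc hcd hd hσ1
    (by rw [hσ3, ← hM, ← hM']; field_simp)
  have hδ : 2 / 3 * (m * (d - c) * v) / Q ≤ 1 - (σ ^ 2)⁻¹ := by
    set u := σ⁻¹ with hu
    have hu0 : 0 < u := inv_pos.2 hσ0
    have hu1 : u < 1 := inv_lt_one_of_one_lt₀ hσ1
    have hu3 : u ^ 3 = M' / M := by rw [hu, inv_pow, hσ3, inv_div]
    -- After division by `1 - u` this is `2 (1 + u + u²) ≤ 3 (1 + u)`, that is, `0 ≤ (1 - u)(1 +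
    -- 2u)`.
    have h1 : 2 / 3 * (1 - u ^ 3) ≤ 1 - u ^ 2 := by
      nlinarith [mul_nonneg (sub_nonneg.2 hu1.le) (sub_nonneg.2 hu1.le),
        mul_nonneg (mul_nonneg (sub_nonneg.2 hu1.le) (sub_nonneg.2 hu1.le)) hu0.le]
    rw [← inv_pow]
    refine le_trans ?_ h1
    rw [hu3, mul_div_assoc]
    refine mul_le_mul_of_nonneg_left ?_ (by norm_num)
    calc m * (d - c) * v / Q ≤ m * (d - c) * v / M := by gcongr
      _ ≤ (M - M') / M := by gcongr
      _ = 1 - M' / M := by field_simp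
  have hid : energyRatio s d - energyRatio s c
      = (σ ^ 5 * energyIntegral s d - energyIntegral s c) / M ^ (5 / 3 : ℝ) := by
    rw [hσ5]
    unfold energyRatio
    rw [← hM, ← hM']
    have : 0 < M ^ (5 / 3 : ℝ) := by positivity
    have : 0 < M' ^ (5 / 3 : ℝ) := by positivity
    field_simp
  rw [hid]
  calc m * (2 / 3 * (m * v) / Q) * w / Q ^ (5 / 3 : ℝ) * (d - c)
      = m * (2 / 3 * (m * (d - c) * v) / Q) * w / Q ^ (5 / 3 : ℝ) := by ring
    _ ≤ m * (1 - (σ ^ 2)⁻¹) * w / Q ^ (5 / 3 : ℝ) := by gcongr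
    _ ≤ m * (1 - (σ ^ 2)⁻¹) * w / M ^ (5 / 3 : ℝ) := by
        have : 0 ≤ 1 - (σ ^ 2)⁻¹ := le_trans (by positivity) hδ
        gcongr
    _ ≤ _ := by gcongr

lemma energyRatio_lt {s : Particle} {c d : ℝ} (hc : s.Admissible c) (hcd : c < d) :
    energyRatio s c < energyRatio s d := by
  obtain ⟨κ, hκ, h⟩ := exists_energyRatio_gap hc d
  have := h c d le_rfl hcd.le le_rfl
  have : 0 < κ * (d - c) := mul_pos hκ (by linarith)
  linarith

lemma energyRatio_injOn {s : Particle} {c d : ℝ} (hc : s.Admissible c) (hd : s.Admissible d)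
    (h : energyRatio s c = energyRatio s d) : c = d := by
  rcases lt_trichotomy c d with hlt | rfl | hlt
  · exact absurd h (energyRatio_lt hc hlt).ne
  · rfl
  · exact absurd h (energyRatio_lt hd hlt).ne'

/-! ### Continuity and range of the energy ratio -/

lemma continuousOn_occupation {s : Particle} {L : ℝ} (hL : s.Admissible L) {t : ℝ} (ht : 0 < t) :
    ContinuousOn (fun c => occupation s (t + c)) (Ici L) := by
  unfold occupation
  refine ContinuousOn.div (by fun_prop) (by fun_prop) fun c hc => ?_
  exact ((hL.mono hc).denom_pos ht).ne'

lemma continuousOn_massIntegral {s : Particle} {L : ℝ} (hL : s.Admissible L) :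
    ContinuousOn (massIntegral s) (Ici L) := by
  refine continuousOn_of_dominated (F := fun c (p : Momentum) => occupation s (‖p‖ ^ 2 + c))
    (bound := fun p => occupation s (‖p‖ ^ 2 + L)) ?_ ?_ (integrable_occupation hL) ?_
  · exact fun c _ => ((measurable_occupation s).comp (by fun_prop)).aestronglyMeasurable
  · intro c hc
    filter_upwards [ae_normSq_pos] with p hp
    rw [Real.norm_of_nonneg (occupation_pos ((hL.mono hc).denom_pos hp)).le]
    exact occupation_antitone (hL.denom_pos hp) (by linarith [show L ≤ c from hc])
  · filter_upwards [ae_normSq_pos] with p hp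
    exact continuousOn_occupation hL hp

lemma continuousOn_energyIntegral {s : Particle} {L : ℝ} (hL : s.Admissible L) :
    ContinuousOn (energyIntegral s) (Ici L) := by
  have : energyIntegral s = fun c => ∫ p : Momentum, ‖p‖ ^ 2 * occupation s (‖p‖ ^ 2 + c) :=
    funext (energyIntegral_eq s)
  rw [this]
  refine continuousOn_of_dominated
    (bound := fun p : Momentum => ‖p‖ ^ 2 * occupation s (‖p‖ ^ 2 + L)) ?_ ?_
    (integrable_sq_mul_occupation hL) ?_
  · exact fun c _ => ((by fun_prop : Measurable fun p : Momentum => ‖p‖ ^ 2).mul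
      ((measurable_occupation s).comp (by fun_prop))).aestronglyMeasurable
  · intro c hc
    filter_upwards [ae_normSq_pos] with p hp
    have h1 := occupation_pos ((hL.mono hc).denom_pos hp)
    rw [Real.norm_of_nonneg (by positivity)]
    exact mul_le_mul_of_nonneg_left
      (occupation_antitone (hL.denom_pos hp) (by linarith [show L ≤ c from hc])) hp.le
  · filter_upwards [ae_normSq_pos] with p hp
    exact continuousOn_const.mul (continuousOn_occupation hL hp)

lemma continuousOn_energyRatio {s : Particle} {L : ℝ} (hL : s.Admissible L) :
    ContinuousOn (energyRatio s) (Ici L) := by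
  refine (continuousOn_energyIntegral hL).div
    ((continuousOn_massIntegral hL).rpow_const fun c hc => Or.inl ?_) fun c hc => ?_
  · exact (massIntegral_pos (hL.mono hc)).ne'
  · have := massIntegral_pos (hL.mono hc)
    positivity

/-- Since `e^c ≥ 1`, the denominator satisfies `e^(t+c) ± 1 ≥ e^c (e^t - 1)`. -/
lemma massIntegral_le_exp {s : Particle} {c : ℝ} (hc : 0 ≤ c) :
    massIntegral s c ≤ Real.exp (-c) * massIntegral .boson 0 := by
  have h0 : Particle.boson.Admissible 0 := le_refl (0 : ℝ)
  have hc' : s.Admissible c := by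
    cases s
    · exact hc
    · trivial
  rw [massIntegral_eq, massIntegral_eq, ← integral_const_mul]
  refine integral_mono_ae (integrable_occupation hc') ((integrable_occupation h0).const_mul _) ?_
  filter_upwards [ae_normSq_pos] with p hp
  have h1 := h0.denom_pos hp
  simp only [occupation]
  rw [Real.exp_neg, ← one_div, one_div_mul_one_div]
  refine one_div_le_one_div_of_le (mul_pos (Real.exp_pos _) h1) ?_
  have h2 := Real.one_le_exp hc
  have h3 := s.neg_one_le_sign
  rw [show Particle.boson.sign = -1 from rfl, add_zero, Real.exp_add]
  nlinarith

/-- The factor `1/2` absorbs the sign: `e^(t+c) ± 1 ≤ 2 e^(t+c)`, while `e^t ≤ e^(t+1) - 1` allows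
comparison with the Bose profile at `c = 1`. -/
lemma exp_le_energyIntegral {s : Particle} {c : ℝ} (hc : 0 ≤ c) :
    Real.exp (-c) * (energyIntegral .boson 1 / 2) ≤ energyIntegral s c := by
  have h0 : Particle.boson.Admissible 1 := zero_le_one (α := ℝ)
  have hc' : s.Admissible c := by
    cases s
    · exact hc
    · trivial
  rw [energyIntegral_eq, energyIntegral_eq, ← integral_div, ← integral_const_mul]
  refine integral_mono_ae (((integrable_sq_mul_occupation h0).div_const _).const_mul _)
    (integrable_sq_mul_occupation hc') ?_
  filter_upwards [ae_normSq_pos] with p hp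
  have h1 := h0.denom_pos hp
  have h2 := hc'.denom_pos hp
  have h3 : Real.exp (-c) / 2 * occupation .boson (‖p‖ ^ 2 + 1) ≤ occupation s (‖p‖ ^ 2 + c) := by
    simp only [occupation]
    rw [Real.exp_neg, mul_one_div, div_div, ← one_div, div_div]
    refine one_div_le_one_div_of_le h2 ?_
    have e1 := Real.one_le_exp hc
    have e2 := Real.one_le_exp hp.le
    have e3 := s.sign_le_one
    have e4 := Real.add_one_le_exp 1
    rw [show Particle.boson.sign = -1 from rfl, Real.exp_add, Real.exp_add]
    have e5 : 1 ≤ Real.exp (‖p‖ ^ 2) * Real.exp c := one_le_mul_of_one_le_of_one_le e2 e1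
    have e6 : Real.exp (‖p‖ ^ 2) ≤ Real.exp (‖p‖ ^ 2) * Real.exp 1 - 1 := by nlinarith
    nlinarith
  calc _ = ‖p‖ ^ 2 * (Real.exp (-c) / 2 * occupation .boson (‖p‖ ^ 2 + 1)) := by ring
    _ ≤ _ := mul_le_mul_of_nonneg_left h3 hp.le

/-- The energy ratio is unbounded as `c → ∞`. -/
lemma exists_le_energyRatio (s : Particle) (L b : ℝ) :
    ∃ c : ℝ, L ≤ c ∧ b ≤ energyRatio s c := by
  have hM : 0 < massIntegral .boson 0 := massIntegral_pos (le_refl (0 : ℝ))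
  have hE : 0 < energyIntegral .boson 1 := energyIntegral_pos (zero_le_one (α := ℝ))
  set κ := energyIntegral .boson 1 / 2 / massIntegral .boson 0 ^ (5 / 3 : ℝ) with hκ
  have hκ0 : 0 < κ := by positivity
  -- Energy is at least, and mass at most, a multiple of `e^(-c)`, so the ratio grows at least like
  -- `e^(2c/3)`; linear growth suffices.
  have key : ∀ c : ℝ, 0 ≤ c → κ * (2 / 3 * c) ≤ energyRatio s c := by
    intro c hc
    have hc' : s.Admissible c := by
      cases s
      · exact hc
      · trivial
    have hMc := massIntegral_pos hc'
    calc κ * (2 / 3 * c) ≤ κ * Real.exp (2 / 3 * c) := by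
          have := Real.add_one_le_exp (2 / 3 * c)
          gcongr; linarith
      _ = Real.exp (-c) * (energyIntegral .boson 1 / 2) /
            (Real.exp (-c) * massIntegral .boson 0) ^ (5 / 3 : ℝ) := by
          rw [Real.mul_rpow (Real.exp_pos _).le hM.le, ← Real.exp_mul,
            show 2 / 3 * c = -c - -c * (5 / 3) by ring, Real.exp_sub, hκ]
          field_simp
      _ ≤ energyIntegral s c / (massIntegral s c) ^ (5 / 3 : ℝ) := by
          gcongr
          · exact (energyIntegral_pos hc').le
          · exact exp_le_energyIntegral hc
          · exact massIntegral_le_exp hc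
  refine ⟨max (max L 0) (b / (κ * (2 / 3))), le_trans (le_max_left _ _) (le_max_left _ _), ?_⟩
  refine le_trans ?_ (key _ (le_trans (le_max_right _ _) (le_max_left _ _)))
  calc b = κ * (2 / 3 * (b / (κ * (2 / 3)))) := by field_simp
    _ ≤ _ := by gcongr; exact le_max_right _ _

/-! ### Existence and uniqueness of equilibrium parameters -/

/-- The space of macroscopic fields (mass, momentum, energy). -/
abbrev Fields : Type := ℝ × Momentum × ℝ

lemma div_rpow_eq {N T : ℝ} (hN : 0 < N) (hT : 0 < T) :
    T / N ^ (5 / 3 : ℝ) = (N / T ^ (3 / 5 : ℝ)) ^ (-(5 / 3) : ℝ) := by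
  rw [Real.div_rpow hN.le (by positivity), ← Real.rpow_mul hT.le, Real.rpow_neg hN.le]
  norm_num
  rw [Real.rpow_neg hT.le, Real.rpow_one]
  field_simp

lemma energyRatio_eq_beta_rpow {s : Particle} {c : ℝ} (hc : s.Admissible c) :
    energyRatio s c = beta s c ^ (-(5 / 3) : ℝ) :=
  div_rpow_eq (massIntegral_pos hc) (energyIntegral_pos hc)

lemma beta_pos {s : Particle} {c : ℝ} (hc : s.Admissible c) : 0 < beta s c := by
  have := massIntegral_pos hc
  have := energyIntegral_pos hc
  unfold beta
  positivity

/-- Both sides are positive and are raised to the power `-5/3`, which is injective there. This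
passes from `β` to a quantity that is increasing in `c` and smooth in the fields. -/
lemma beta_equation_iff {s : Particle} {c N T : ℝ} (hc : s.Admissible c) (hN : 0 < N)
    (hT : 0 < T) :
    N / T ^ (3 / 5 : ℝ) = beta s c ↔ energyRatio s c = T / N ^ (5 / 3 : ℝ) := by
  have hb := beta_pos hc
  rw [div_rpow_eq hN hT, energyRatio_eq_beta_rpow hc]
  constructor
  · intro h; rw [h]
  · intro h
    exact (Real.rpow_left_injOn (by norm_num : (-(5 / 3) : ℝ) ≠ 0) hb.le
      (show (0 : ℝ) ≤ N / T ^ (3 / 5 : ℝ) by positivity) h).symm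

/-- The equilibrium parameters are unique. -/
lemma IsEquilibriumParam.unique {s : Particle} {N E a c a' c' : ℝ} {P : Momentum}
    (h : IsEquilibriumParam s N P E a c) (h' : IsEquilibriumParam s N P E a' c') :
    a = a' ∧ c = c' := by
  obtain ⟨hN, hT, hc, hb, ha⟩ := h
  obtain ⟨_, _, hc', hb', ha'⟩ := h'
  have : c = c' := energyRatio_injOn hc hc' (by
    rw [(beta_equation_iff hc hN hT).1 hb, (beta_equation_iff hc' hN hT).1 hb'])
  subst this
  exact ⟨ha.trans ha'.symm, rfl⟩

/-- Fields with bounded mass and energy and uniformly positive temperature. -/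
def fieldRegion (n₀ a_u c_u k₀ : ℝ) : Set Fields :=
  {d | n₀ ≤ d.1 ∧ d.1 ≤ a_u ∧ d.2.2 ≤ c_u ∧ k₀ ≤ d.2.2 * d.1 - ‖d.2.1‖ ^ 2}

/-- A convex compact set that contains the field region. -/
def fieldBox (n₀ a_u c_u : ℝ) : Set Fields :=
  Icc n₀ a_u ×ˢ (Metric.closedBall 0 (Real.sqrt (a_u * c_u)) ×ˢ Icc 0 c_u)

section region

variable {n₀ a_u c_u k₀ : ℝ}

lemma energy_pos_of_mem (hn : 0 < n₀) (hk : 0 < k₀) {d : Fields}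
    (hd : d ∈ fieldRegion n₀ a_u c_u k₀) : 0 < d.2.2 := by
  have h1 : 0 < d.1 := lt_of_lt_of_le hn hd.1
  have h2 : 0 < d.2.2 * d.1 := by nlinarith [hd.2.2.2, sq_nonneg ‖d.2.1‖]
  exact pos_of_mul_pos_left h2 h1.le

/-- The radius comes from `|P|² ≤ E N - k₀ ≤ a_u c_u`. -/
lemma fieldRegion_subset_fieldBox (hn : 0 < n₀) (hk : 0 < k₀) :
    fieldRegion n₀ a_u c_u k₀ ⊆ fieldBox n₀ a_u c_u := by
  intro d hd
  have hE := energy_pos_of_mem hn hk hd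
  obtain ⟨h1, h2, h3, h4⟩ := hd
  refine ⟨⟨h1, h2⟩, ?_, hE.le, h3⟩
  rw [mem_closedBall_zero_iff]
  refine Real.le_sqrt_of_sq_le ?_
  nlinarith

lemma convex_fieldBox : Convex ℝ (fieldBox n₀ a_u c_u) :=
  (convex_Icc _ _).prod ((convex_closedBall _ _).prod (convex_Icc _ _))

lemma isCompact_fieldBox : IsCompact (fieldBox n₀ a_u c_u) :=
  isCompact_Icc.prod ((isCompact_closedBall _ _).prod isCompact_Icc)

/-- The ratio `T / N^{5/3}` of temperature energy and mass as a function of the fields. -/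
noncomputable def fieldRatio (d : Fields) : ℝ :=
  (d.2.2 - ‖d.2.1‖ ^ 2 / d.1) / d.1 ^ (5 / 3 : ℝ)

/-- A `C¹` function on a convex compact set is Lipschitz. The only singularity is at `N = 0`, so the
box with `N ≥ n₀` suffices and no bound on the temperature enters. -/
lemma exists_lipschitz_fieldRatio (hn : 0 < n₀) :
    ∃ K, LipschitzOnWith K fieldRatio (fieldBox n₀ a_u c_u) := by
  refine ContDiffOn.exists_lipschitzOnWith (n := 1) ?_ one_ne_zero convex_fieldBox
    isCompact_fieldBox
  intro d hd
  have h1 : 0 < d.1 := lt_of_lt_of_le hn hd.1.1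
  refine ContDiffAt.contDiffWithinAt ?_
  unfold fieldRatio
  refine ContDiffAt.div (ContDiffAt.sub (by fun_prop) (ContDiffAt.div ?_ (by fun_prop) h1.ne'))
    (ContDiffAt.rpow_const_of_ne (by fun_prop) h1.ne') (by positivity)
  exact ContDiffAt.norm_sq ℝ (by fun_prop)

lemma exists_lipschitz_velocity (hn : 0 < n₀) :
    ∃ K, LipschitzOnWith K (fun d : Fields => d.1⁻¹ • d.2.1) (fieldBox n₀ a_u c_u) := by
  refine ContDiffOn.exists_lipschitzOnWith (n := 1) ?_ one_ne_zero convex_fieldBox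
    isCompact_fieldBox
  intro d hd
  have h1 : 0 < d.1 := lt_of_lt_of_le hn hd.1.1
  refine ContDiffAt.contDiffWithinAt ?_
  exact ContDiffAt.smul (ContDiffAt.inv (by fun_prop) h1.ne') (by fun_prop)

lemma temperature_ge (hn : 0 < n₀) (hk : 0 < k₀) {d : Fields}
    (hd : d ∈ fieldRegion n₀ a_u c_u k₀) : k₀ / a_u ≤ d.2.2 - ‖d.2.1‖ ^ 2 / d.1 := by
  obtain ⟨h1, h2, h3, h4⟩ := hd
  have hN : 0 < d.1 := lt_of_lt_of_le hn h1
  calc k₀ / a_u ≤ k₀ / d.1 := by gcongr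
    _ ≤ (d.2.2 * d.1 - ‖d.2.1‖ ^ 2) / d.1 := by gcongr
    _ = _ := by field_simp

/-- The equilibrium parameter `c` exists on the field region, in a fixed compact range of
nondegenerate values. -/
lemma exists_param_range {s : Particle} (hn : 0 < n₀) (hna : n₀ ≤ a_u) (hk : 0 < k₀)
    (hsmall : a_u ^ (8 / 5 : ℝ) / k₀ ^ (3 / 5 : ℝ) < beta s s.cCrit) :
    ∃ c₀ c₁ : ℝ, s.cCrit < c₀ ∧ c₀ ≤ c₁ ∧ ∀ d ∈ fieldRegion n₀ a_u c_u k₀,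
      ∃ c ∈ Icc c₀ c₁, energyRatio s c = fieldRatio d := by
  have ha : 0 < a_u := lt_of_lt_of_le hn hna
  have hcrit : s.Admissible s.cCrit := by
    cases s
    · exact le_refl (0 : ℝ)
    · trivial
  -- A lower bound for `T / N^(5/3)` on the region, from `T ≥ k₀ / a_u` and `N ≤ a_u`. Under the
  -- power `-5/3`, the smallness condition says that `b` exceeds the energy ratio at the critical
  -- value.
  set b := k₀ / a_u / a_u ^ (5 / 3 : ℝ) with hb
  have hlt : energyRatio s s.cCrit < b := by
    have h1 : a_u / (k₀ / a_u) ^ (3 / 5 : ℝ) = a_u ^ (8 / 5 : ℝ) / k₀ ^ (3 / 5 : ℝ) := by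
      rw [Real.div_rpow hk.le ha.le, show (8 / 5 : ℝ) = 1 + 3 / 5 by norm_num,
        Real.rpow_add ha, Real.rpow_one]
      field_simp
    rw [hb, div_rpow_eq ha (by positivity), energyRatio_eq_beta_rpow hcrit, h1]
    exact Real.rpow_lt_rpow_of_neg (by positivity) hsmall (by norm_num)
  obtain ⟨C, hC, hbC⟩ := exists_le_energyRatio s s.cCrit b
  obtain ⟨c₀, hc₀, hc₀b⟩ : b ∈ energyRatio s '' Icc s.cCrit C :=
    intermediate_value_Icc hC ((continuousOn_energyRatio hcrit).mono Icc_subset_Ici_self)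
      ⟨hlt.le, hbC⟩
  have hc₀' : s.cCrit < c₀ := by
    refine lt_of_le_of_ne hc₀.1 fun h => ?_
    rw [h, hc₀b] at hlt
    exact lt_irrefl _ hlt
  have hadm := hcrit.mono hc₀.1
  -- The upper end of the range comes from `T ≤ c_u` and `N ≥ n₀`.
  obtain ⟨c₁, hc₁, hbc₁⟩ := exists_le_energyRatio s c₀ (c_u / n₀ ^ (5 / 3 : ℝ))
  refine ⟨c₀, c₁, hc₀', hc₁, fun d hd => ?_⟩
  have hT := temperature_ge hn hk hd
  have hE := energy_pos_of_mem hn hk hd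
  obtain ⟨h1, h2, h3, h4⟩ := hd
  have hN : 0 < d.1 := lt_of_lt_of_le hn h1
  have hka : 0 < k₀ / a_u := by positivity
  have hiv := intermediate_value_Icc hc₁
    ((continuousOn_energyRatio hadm).mono Icc_subset_Ici_self)
  refine hiv ⟨?_, le_trans ?_ hbc₁⟩
  · rw [hc₀b, hb]
    unfold fieldRatio
    gcongr
    linarith
  · unfold fieldRatio
    have : 0 ≤ ‖d.2.1‖ ^ 2 / d.1 := by positivity
    gcongr
    · linarith
    · linarith

end region

/-! ### Lipschitz dependence of the local equilibrium on the fields -/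

/-- Away from the degenerate value, the denominator is comparable to the exponential. -/
lemma exists_denom_lower {s : Particle} {c₀ : ℝ} (h : s.cCrit < c₀) :
    ∃ κ : ℝ, 0 < κ ∧ ∀ X, c₀ ≤ X → κ * Real.exp X ≤ Real.exp X + s.sign := by
  cases s
  · have h : 0 < c₀ := h
    -- For bosons `1 ≤ e^(X - c₀)`, so the subtracted 1 costs at most the fraction `e^(-c₀)` of
    -- `e^X`. This is where a positive distance from condensation is needed.
    refine ⟨1 - Real.exp (-c₀), by simpa using h, fun X hX => ?_⟩
    have h1 : 1 ≤ Real.exp (-c₀) * Real.exp X := by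
      rw [← Real.exp_add]; exact Real.one_le_exp (by linarith)
    simp only [Particle.sign]
    linarith
  · exact ⟨1, one_pos, fun X _ => by simp [Particle.sign]⟩

section pointwise

variable {s : Particle} {κ : ℝ}

lemma occupation_le_exp (hκ : 0 < κ) {X Z : ℝ} (hX : κ * Real.exp X ≤ Real.exp X + s.sign)
    (hZ : Z ≤ X) : occupation s X ≤ κ⁻¹ * Real.exp (-Z) := by
  have h2 : κ * Real.exp Z ≤ Real.exp X + s.sign :=
    le_trans (by gcongr) hX
  calc occupation s X ≤ 1 / (κ * Real.exp Z) := one_div_le_one_div_of_le (by positivity) h2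
    _ = _ := by rw [Real.exp_neg]; field_simp

/-- The numerator `e^Y - e^X ≤ e^Y (Y - X)` cancels one of the two exponentials in the denominator;
the other leaves the decay `e^(-X) ≤ e^(-Z)`. -/
lemma abs_occupation_sub_le (hκ : 0 < κ) {X Y Z : ℝ}
    (hX : κ * Real.exp X ≤ Real.exp X + s.sign) (hY : κ * Real.exp Y ≤ Real.exp Y + s.sign)
    (hZX : Z ≤ X) (hZY : Z ≤ Y) :
    |occupation s X - occupation s Y| ≤ (κ ^ 2)⁻¹ * |X - Y| * Real.exp (-Z) := by
  wlog hXY : X ≤ Y generalizing X Y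
  · rw [abs_sub_comm, abs_sub_comm X]
    exact this hY hX hZY hZX (le_of_not_ge hXY)
  have hX0 : 0 < Real.exp X + s.sign := lt_of_lt_of_le (by positivity) hX
  have hY0 : 0 < Real.exp Y + s.sign := lt_of_lt_of_le (by positivity) hY
  rw [abs_of_nonneg (sub_nonneg.2 (occupation_antitone hX0 hXY)), occupation_sub hX0 hY0,
    abs_sub_comm, abs_of_nonneg (sub_nonneg.2 hXY)]
  have h1 : Real.exp Y - Real.exp X ≤ Real.exp Y * (Y - X) := by
    have h2 := Real.add_one_le_exp (X - Y)
    have h3 : Real.exp X = Real.exp Y * Real.exp (X - Y) := by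
      rw [← Real.exp_add]; congr 1; ring
    nlinarith [Real.exp_pos Y]
  have hYX : 0 ≤ Y - X := by linarith
  calc (Real.exp Y - Real.exp X) / ((Real.exp X + s.sign) * (Real.exp Y + s.sign))
      ≤ Real.exp Y * (Y - X) / ((κ * Real.exp X) * (κ * Real.exp Y)) := by
        gcongr
    _ = (κ ^ 2)⁻¹ * (Y - X) * Real.exp (-X) := by
        rw [Real.exp_neg]; field_simp
    _ ≤ _ := by gcongr

lemma normSq_sub_ge {p u : Momentum} {U : ℝ} (hu : ‖u‖ ≤ U) :
    ‖p‖ ^ 2 / 2 - U ^ 2 ≤ ‖p - u‖ ^ 2 := by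
  have h1 : ‖p‖ ≤ ‖p - u‖ + ‖u‖ := by simpa using norm_add_le (p - u) u
  nlinarith [norm_nonneg p, norm_nonneg u, norm_nonneg (p - u), sq_nonneg (‖p - u‖ - ‖u‖)]

lemma abs_normSq_sub_le {p u v : Momentum} {U : ℝ} (hu : ‖u‖ ≤ U) (hv : ‖v‖ ≤ U) :
    |‖p - u‖ ^ 2 - ‖p - v‖ ^ 2| ≤ ‖u - v‖ * ((1 + 2 * U) * (1 + ‖p‖ ^ 2)) := by
  have h1 : |‖p - u‖ - ‖p - v‖| ≤ ‖u - v‖ := by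
    have := abs_norm_sub_norm_le (p - u) (p - v)
    rwa [show p - u - (p - v) = v - u by abel, norm_sub_rev v u] at this
  have h2 := norm_sub_le p u
  have h3 := norm_sub_le p v
  have hp := norm_nonneg p
  have hu0 := norm_nonneg u
  rw [sq_sub_sq, abs_mul, mul_comm]
  refine mul_le_mul h1 ?_ (abs_nonneg _) (norm_nonneg _)
  rw [abs_of_nonneg (by positivity)]
  nlinarith [sq_nonneg (‖p‖ - 1), mul_nonneg (le_trans hu0 hu) (sq_nonneg ‖p‖)]

lemma equilibrium_eq (N : ℝ) (P : Momentum) (a c : ℝ) (p : Momentum) :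
    equilibrium s N P a c p = occupation s (a * ‖p - N⁻¹ • P‖ ^ 2 + c) := by
  simp [equilibrium, occupation]

/-- The changes of `a`, of the velocity and of `c` are separated. Each costs at most a quadratic
factor in `p`, which Gaussian decay absorbs later. -/
lemma abs_exponent_sub_le {a a' a₁ c c' U : ℝ} {u u' p : Momentum} (hu : ‖u‖ ≤ U)
    (hu' : ‖u'‖ ≤ U) (ha' : 0 ≤ a') (ha₁ : a' ≤ a₁) :
    |(a * ‖p - u‖ ^ 2 + c) - (a' * ‖p - u'‖ ^ 2 + c')| ≤
      (|a - a'| * (2 + 2 * U ^ 2) + a₁ * (‖u - u'‖ * (1 + 2 * U)) + |c - c'|)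
        * (1 + ‖p‖ ^ 2) := by
  have hU : 0 ≤ U := le_trans (norm_nonneg _) hu
  have h1 := abs_normSq_sub_le (p := p) hu hu'
  have h2 : ‖p - u‖ ^ 2 ≤ (2 + 2 * U ^ 2) * (1 + ‖p‖ ^ 2) := by
    have := norm_sub_le p u
    nlinarith [norm_nonneg p, norm_nonneg u, norm_nonneg (p - u), sq_nonneg (‖p‖ - ‖u‖),
      mul_nonneg (sq_nonneg U) (sq_nonneg ‖p‖)]
  have h3 : (a * ‖p - u‖ ^ 2 + c) - (a' * ‖p - u'‖ ^ 2 + c') =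
      (a - a') * ‖p - u‖ ^ 2 + a' * (‖p - u‖ ^ 2 - ‖p - u'‖ ^ 2) + (c - c') := by ring
  rw [h3]
  have h4 := abs_nonneg (c - c')
  calc _ ≤ |(a - a') * ‖p - u‖ ^ 2| + |a' * (‖p - u‖ ^ 2 - ‖p - u'‖ ^ 2)| + |c - c'| :=
        abs_add_three _ _ _
    _ = |a - a'| * ‖p - u‖ ^ 2 + a' * |‖p - u‖ ^ 2 - ‖p - u'‖ ^ 2| + |c - c'| := by
        rw [abs_mul, abs_mul, abs_of_nonneg (sq_nonneg ‖p - u‖), abs_of_nonneg ha']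
    _ ≤ |a - a'| * ((2 + 2 * U ^ 2) * (1 + ‖p‖ ^ 2))
          + a₁ * (‖u - u'‖ * ((1 + 2 * U) * (1 + ‖p‖ ^ 2))) + |c - c'| * (1 + ‖p‖ ^ 2) := by
        have h5 : 1 ≤ 1 + ‖p‖ ^ 2 := by linarith [sq_nonneg ‖p‖]
        have h6 : 0 ≤ a₁ := ha'.trans ha₁
        gcongr
        exact le_mul_of_one_le_right h4 h5
    _ = _ := by ring

end pointwise

lemma integrable_poly_mul_gaussian {b : ℝ} (hb : 0 < b) :
    Integrable (fun p : Momentum => (1 + ‖p‖ ^ 2) ^ 2 * Real.exp (-b * ‖p‖ ^ 2)) := by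
  -- With `ε ≤ 1`, `ε (1 + t) ≤ 1 + ε t ≤ e^(ε t)`; with `ε ≤ b/4`, the square of this uses at most
  -- half of the Gaussian rate.
  set ε := min 1 (b / 4) with hε
  have hε0 : 0 < ε := lt_min one_pos (by positivity)
  refine ((integrable_gaussian (half_pos hb)).const_mul (ε ^ 2)⁻¹).mono'
    (by fun_prop) (Eventually.of_forall fun p => ?_)
  rw [Real.norm_of_nonneg (by positivity)]
  set t := ‖p‖ ^ 2 with ht
  have ht0 : 0 ≤ t := by positivity
  have h1 : ε * (1 + t) ≤ Real.exp (ε * t) := by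
    have := Real.add_one_le_exp (ε * t)
    have : ε ≤ 1 := min_le_left _ _
    linarith
  have h2 : (ε * (1 + t)) ^ 2 ≤ Real.exp (b / 2 * t) := by
    calc (ε * (1 + t)) ^ 2 ≤ Real.exp (ε * t) ^ 2 := by gcongr
      _ = Real.exp (2 * ε * t) := by rw [← Real.exp_nat_mul]; congr 1; push_cast; ring
      _ ≤ _ := by
        have : ε ≤ b / 4 := min_le_right _ _
        gcongr
        linarith
  calc (1 + t) ^ 2 * Real.exp (-b * t)
      = (ε ^ 2)⁻¹ * ((ε * (1 + t)) ^ 2 * Real.exp (-b * t)) := by field_simp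
    _ ≤ (ε ^ 2)⁻¹ * (Real.exp (b / 2 * t) * Real.exp (-b * t)) := by gcongr
    _ = _ := by
        rw [← Real.exp_add]; congr 2; ring

/-- The mass integral is Lipschitz away from degeneracy. -/
lemma exists_lipschitz_massIntegral {s : Particle} {c₀ : ℝ} (h : s.cCrit < c₀) :
    ∃ K, LipschitzOnWith K (massIntegral s) (Ici c₀) := by
  obtain ⟨κ, hκ, hden⟩ := exists_denom_lower h
  have hadm : s.Admissible c₀ := by
    cases s
    · exact le_of_lt h
    · trivial
  set G := ∫ p : Momentum, Real.exp (-1 * ‖p‖ ^ 2)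
  have hG : 0 ≤ G := integral_nonneg fun p => (Real.exp_pos _).le
  refine ⟨((κ ^ 2)⁻¹ * Real.exp (-c₀) * G).toNNReal,
    LipschitzOnWith.of_dist_le_mul fun c hc d hd => ?_⟩
  rw [Real.coe_toNNReal _ (by positivity), Real.dist_eq, Real.dist_eq, massIntegral_eq,
    massIntegral_eq, ← integral_sub (integrable_occupation (hadm.mono hc))
      (integrable_occupation (hadm.mono hd))]
  have hbi := (integrable_gaussian one_pos).const_mul ((κ ^ 2)⁻¹ * Real.exp (-c₀) * |c - d|)
  rw [← Real.norm_eq_abs]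
  refine (norm_integral_le_of_norm_le hbi (Eventually.of_forall fun p => ?_)).trans_eq ?_
  · have hc : c₀ ≤ c := hc
    have hd : c₀ ≤ d := hd
    have hp : 0 ≤ ‖p‖ ^ 2 := by positivity
    have := abs_occupation_sub_le hκ (X := ‖p‖ ^ 2 + c) (Y := ‖p‖ ^ 2 + d) (Z := ‖p‖ ^ 2 + c₀)
      (hden _ (by linarith)) (hden _ (by linarith)) (by linarith) (by linarith)
    rw [Real.norm_eq_abs]
    refine this.trans_eq ?_
    rw [show -(‖p‖ ^ 2 + c₀) = -c₀ + -1 * ‖p‖ ^ 2 by ring, Real.exp_add,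
      show ‖p‖ ^ 2 + c - (‖p‖ ^ 2 + d) = c - d by ring]
    ring
  · rw [integral_const_mul]; ring

/-- Selection of equilibrium parameters on the field region, Lipschitz in the fields. -/
lemma exists_equilibrium_selection {s : Particle} {n₀ a_u c_u k₀ : ℝ} (hn : 0 < n₀)
    (hna : n₀ ≤ a_u) (hk : 0 < k₀)
    (hsmall : a_u ^ (8 / 5 : ℝ) / k₀ ^ (3 / 5 : ℝ) < beta s s.cCrit) :
    ∃ (α γ : Fields → ℝ) (c₀ a₀ a₁ : ℝ) (L : NNReal), s.cCrit < c₀ ∧ 0 < a₀ ∧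
      LipschitzWith L α ∧ LipschitzWith L γ ∧
      ∀ d ∈ fieldRegion n₀ a_u c_u k₀, IsEquilibriumParam s d.1 d.2.1 d.2.2 (α d) (γ d) ∧
        c₀ ≤ γ d ∧ a₀ ≤ α d ∧ α d ≤ a₁ := by
  obtain ⟨c₀, c₁, hcrit, hc01, hex⟩ := exists_param_range (c_u := c_u) hn hna hk hsmall
  have ha : 0 < a_u := lt_of_lt_of_le hn hna
  set R := fieldRegion n₀ a_u c_u k₀ with hR
  have hadm : s.Admissible c₀ := by
    cases s
    · exact le_of_lt hcrit
    · trivial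
  choose! γ hγ hγr using hex
  obtain ⟨κ, hκ, hgap⟩ := exists_energyRatio_gap hadm c₁
  obtain ⟨Kv, hKv⟩ := exists_lipschitz_fieldRatio (a_u := a_u) (c_u := c_u) hn
  have hKv' := hKv.mono (fieldRegion_subset_fieldBox (c_u := c_u) (a_u := a_u) hn hk)
  -- `γ` is the inverse of the energy ratio composed with `fieldRatio`; the lower slope bound `κ` of
  -- the former gives the inverse the Lipschitz constant `κ⁻¹`.
  have hγL : LipschitzOnWith (κ⁻¹.toNNReal * Kv) γ R := by
    refine LipschitzOnWith.of_dist_le_mul fun d hd d' hd' => ?_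
    have h1 := hKv'.dist_le_mul d hd d' hd'
    rw [← hγr d hd, ← hγr d' hd', Real.dist_eq] at h1
    have h2 : κ * |γ d - γ d'| ≤ |energyRatio s (γ d) - energyRatio s (γ d')| := by
      rcases le_total (γ d) (γ d') with h | h
      · rw [abs_sub_comm, abs_sub_comm (energyRatio s _), abs_of_nonneg (sub_nonneg.2 h)]
        exact le_trans (hgap _ _ (hγ d hd).1 h (hγ d' hd').2) (le_abs_self _)
      · rw [abs_of_nonneg (sub_nonneg.2 h)]
        exact le_trans (hgap _ _ (hγ d' hd').1 h (hγ d hd).2) (le_abs_self _)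
    rw [NNReal.coe_mul, Real.coe_toNNReal _ (by positivity), Real.dist_eq, mul_assoc,
      le_inv_mul_iff₀ hκ]
    exact h2.trans h1
  obtain ⟨KM, hKM⟩ := exists_lipschitz_massIntegral hcrit
  have hML := hKM.comp hγL (fun d hd => (hγ d hd).1)
  have hMc1 : 0 < massIntegral s c₁ := massIntegral_pos (hadm.mono hc01)
  -- The parameter `a` is a smooth function of the mass integral at `γ` and of `N`, both of which
  -- stay in compact intervals away from zero.
  obtain ⟨Kφ, hKφ⟩ : ∃ K, LipschitzOnWith K
      (fun z : ℝ × ℝ => z.1 ^ (2 / 3 : ℝ) * z.2 ^ (-(2 / 3) : ℝ))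
      (Icc (massIntegral s c₁) (massIntegral s c₀) ×ˢ Icc n₀ a_u) := by
    refine ContDiffOn.exists_lipschitzOnWith (n := 1) ?_ one_ne_zero
      ((convex_Icc _ _).prod (convex_Icc _ _)) (isCompact_Icc.prod isCompact_Icc)
    intro z hz
    have h1 : z.1 ≠ 0 := (lt_of_lt_of_le hMc1 hz.1.1).ne'
    have h2 : z.2 ≠ 0 := (lt_of_lt_of_le hn hz.2.1).ne'
    exact (ContDiffAt.mul (ContDiffAt.rpow_const_of_ne (by fun_prop) h1)
      (ContDiffAt.rpow_const_of_ne (by fun_prop) h2)).contDiffWithinAt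
  have hmaps : MapsTo (fun d : Fields => (massIntegral s (γ d), d.1)) R
      (Icc (massIntegral s c₁) (massIntegral s c₀) ×ˢ Icc n₀ a_u) := by
    intro d hd
    have h1 := hγ d hd
    exact ⟨⟨massIntegral_antitone (hadm.mono h1.1) h1.2, massIntegral_antitone hadm h1.1⟩,
      hd.1, hd.2.1⟩
  have hαL := hKφ.comp (hML.prodMk (LipschitzWith.prod_fst.lipschitzOnWith (s := R))) hmaps
  -- The selections are extended to all fields while remaining Lipschitz; the local equilibrium is
  -- then jointly measurable on the whole space of fields.
  obtain ⟨γ', hγ'L, hγ'⟩ := hγL.extend_real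
  obtain ⟨α', hα'L, hα'⟩ := hαL.extend_real
  refine ⟨α', γ', c₀, massIntegral s c₁ ^ (2 / 3 : ℝ) * a_u ^ (-(2 / 3) : ℝ),
    massIntegral s c₀ ^ (2 / 3 : ℝ) * n₀ ^ (-(2 / 3) : ℝ), _, hcrit, by positivity,
    hα'L.weaken (le_max_left _ _), hγ'L.weaken (le_max_right _ _), fun d hd => ?_⟩
  have hN : 0 < d.1 := lt_of_lt_of_le hn hd.1
  have hT : 0 < d.2.2 - ‖d.2.1‖ ^ 2 / d.1 :=
    lt_of_lt_of_le (by positivity) (temperature_ge hn hk hd)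
  have hc := hγ d hd
  have hm := hmaps hd
  rw [← hγ' hd, ← hα' hd]
  refine ⟨⟨hN, hT, hadm.mono hc.1, ?_, rfl⟩, hc.1, ?_, ?_⟩
  · exact (beta_equation_iff (hadm.mono hc.1) hN hT).2 (hγr d hd)
  · simp only [Function.comp]
    have h1 : massIntegral s c₁ ≤ massIntegral s (γ d) := hm.1.1
    have h2 : a_u ^ (-(2 / 3) : ℝ) ≤ d.1 ^ (-(2 / 3) : ℝ) :=
      Real.rpow_le_rpow_of_nonpos hN hd.2.1 (by norm_num)
    have h3 : 0 ≤ massIntegral s (γ d) := (hMc1.le.trans h1)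
    exact mul_le_mul (Real.rpow_le_rpow hMc1.le h1 (by norm_num)) h2 (by positivity)
      (by positivity)
  · simp only [Function.comp]
    have h0 : 0 < massIntegral s (γ d) := lt_of_lt_of_le hMc1 hm.1.1
    have h1 : massIntegral s (γ d) ≤ massIntegral s c₀ := hm.1.2
    have h2 : d.1 ^ (-(2 / 3) : ℝ) ≤ n₀ ^ (-(2 / 3) : ℝ) :=
      Real.rpow_le_rpow_of_nonpos hn hd.1 (by norm_num)
    have h3 : 0 ≤ massIntegral s c₀ := h0.le.trans h1
    exact mul_le_mul (Real.rpow_le_rpow h0.le h1 (by norm_num)) h2 (by positivity)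
      (by positivity)

/-- The local equilibrium as a function of the fields, given a selection of parameters. -/
noncomputable def localEquilibrium (s : Particle) (α γ : Fields → ℝ) (d : Fields) (p : Momentum) :
    ℝ :=
  equilibrium s d.1 d.2.1 (α d) (γ d) p

/-- A kernel of local equilibria that is dominated by and Lipschitz with respect to an integrable
weight on a region of fields. -/
structure IsDominatedKernel (D : Set Fields) (K : Fields → Momentum → ℝ) (h : Momentum → ℝ) :
    Prop where
  measurable : Measurable (Function.uncurry K)
  integrable : Integrable h
  weight_nonneg : ∀ p, 0 ≤ h p
  nonneg : ∀ d ∈ D, ∀ p, 0 ≤ K d p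
  le : ∀ d ∈ D, ∀ p, (1 + ‖p‖ ^ 2) * K d p ≤ h p
  lipschitz : ∀ d ∈ D, ∀ d' ∈ D, ∀ p, (1 + ‖p‖ ^ 2) * |K d p - K d' p| ≤ ‖d - d'‖ * h p

/-- The exponents have the common lower bound `a₀/2 |p|² - a₀ U² + c₀`, so all equilibria on the
region decay at least like one Gaussian. The weight has the factor `(1 + |p|²)²`: one power for the
moments and one for the difference of exponents. -/
theorem exists_dominated_equilibrium {s : Particle} {n₀ a_u c_u k₀ : ℝ} (hn : 0 < n₀)
    (hna : n₀ ≤ a_u) (hk : 0 < k₀)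
    (hsmall : a_u ^ (8 / 5 : ℝ) / k₀ ^ (3 / 5 : ℝ) < beta s s.cCrit) :
    ∃ (α γ : Fields → ℝ) (h : Momentum → ℝ),
      (∀ d ∈ fieldRegion n₀ a_u c_u k₀, IsEquilibriumParam s d.1 d.2.1 d.2.2 (α d) (γ d)) ∧
      IsDominatedKernel (fieldRegion n₀ a_u c_u k₀) (localEquilibrium s α γ) h := by
  obtain ⟨α, γ, c₀, a₀, a₁, L, hcrit, ha₀, hα, hγ, hsel⟩ :=
    exists_equilibrium_selection (c_u := c_u) hn hna hk hsmall
  obtain ⟨κ, hκ, hden⟩ := exists_denom_lower hcrit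
  obtain ⟨Ku, hKu⟩ := exists_lipschitz_velocity (a_u := a_u) (c_u := c_u) hn
  have hsub := fieldRegion_subset_fieldBox (c_u := c_u) (a_u := a_u) hn hk
  obtain ⟨U, hU⟩ : ∃ U, ∀ d ∈ fieldRegion n₀ a_u c_u k₀, ‖d.1⁻¹ • d.2.1‖ ≤ U := by
    obtain ⟨U, hU⟩ := (isCompact_fieldBox (n₀ := n₀) (a_u := a_u) (c_u := c_u)).exists_bound_of_continuousOn
      hKu.continuousOn
    exact ⟨U, fun d hd => hU d (hsub hd)⟩
  -- A Lipschitz constant for the exponents, relative to `1 + |p|²`. The absolute values make `C`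
  -- nonnegative even if the region is empty.
  set C := L * (2 + 2 * U ^ 2) + |a₁| * (Ku * (1 + 2 * |U|)) + L with hC
  have hC0 : 0 ≤ C := by positivity
  -- The summand `κ⁻¹` serves the bound on the kernel and `(κ²)⁻¹ C` its Lipschitz bound, so one
  -- weight handles both.
  set B := (κ⁻¹ + (κ ^ 2)⁻¹ * C) * Real.exp (a₀ * U ^ 2 - c₀) with hB
  have hX : ∀ d ∈ fieldRegion n₀ a_u c_u k₀, ∀ p : Momentum,
      c₀ ≤ α d * ‖p - d.1⁻¹ • d.2.1‖ ^ 2 + γ d ∧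
      a₀ / 2 * ‖p‖ ^ 2 - a₀ * U ^ 2 + c₀ ≤ α d * ‖p - d.1⁻¹ • d.2.1‖ ^ 2 + γ d := by
    intro d hd p
    obtain ⟨-, h1, h2, -⟩ := hsel d hd
    have h3 := normSq_sub_ge (p := p) (hU d hd)
    have h4 : a₀ * ‖p - d.1⁻¹ • d.2.1‖ ^ 2 ≤ α d * ‖p - d.1⁻¹ • d.2.1‖ ^ 2 := by gcongr
    constructor
    · have : 0 ≤ a₀ * ‖p - d.1⁻¹ • d.2.1‖ ^ 2 := by positivity
      linarith
    · nlinarith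
  have hZ : ∀ p : Momentum, Real.exp (-(a₀ / 2 * ‖p‖ ^ 2 - a₀ * U ^ 2 + c₀))
      = Real.exp (a₀ * U ^ 2 - c₀) * Real.exp (-(a₀ / 2) * ‖p‖ ^ 2) := by
    intro p; rw [← Real.exp_add]; congr 1; ring
  refine ⟨α, γ, fun p => B * ((1 + ‖p‖ ^ 2) ^ 2 * Real.exp (-(a₀ / 2) * ‖p‖ ^ 2)),
    fun d hd => (hsel d hd).1, ?_, ?_, ?_, ?_, ?_, ?_⟩
  · unfold Function.uncurry localEquilibrium equilibrium
    have := hα.continuous.measurable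
    have := hγ.continuous.measurable
    fun_prop
  · exact (integrable_poly_mul_gaussian (half_pos ha₀)).const_mul B
  · intro p; positivity
  · intro d hd p
    rw [localEquilibrium, equilibrium_eq]
    exact (occupation_pos (lt_of_lt_of_le (by positivity) (hden _ (hX d hd p).1))).le
  · intro d hd p
    rw [localEquilibrium, equilibrium_eq]
    have h1 := occupation_le_exp hκ (hden _ (hX d hd p).1) (hX d hd p).2
    rw [hZ] at h1
    have h2 : κ⁻¹ ≤ κ⁻¹ + (κ ^ 2)⁻¹ * C := le_add_of_nonneg_right (by positivity)
    have h3 : 1 + ‖p‖ ^ 2 ≤ (1 + ‖p‖ ^ 2) ^ 2 := by nlinarith [sq_nonneg ‖p‖]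
    calc _ ≤ (1 + ‖p‖ ^ 2) *
          (κ⁻¹ * (Real.exp (a₀ * U ^ 2 - c₀) * Real.exp (-(a₀ / 2) * ‖p‖ ^ 2))) := by gcongr
      _ ≤ (1 + ‖p‖ ^ 2) ^ 2 * ((κ⁻¹ + (κ ^ 2)⁻¹ * C) *
          (Real.exp (a₀ * U ^ 2 - c₀) * Real.exp (-(a₀ / 2) * ‖p‖ ^ 2))) := by gcongr
      _ = _ := by rw [hB]; ring
  · intro d hd d' hd' p
    simp only [localEquilibrium, equilibrium_eq]
    have h1 := abs_occupation_sub_le hκ (hden _ (hX d hd p).1) (hden _ (hX d' hd' p).1)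
      (hX d hd p).2 (hX d' hd' p).2
    rw [hZ] at h1
    obtain ⟨-, -, g1, g2⟩ := hsel d' hd'
    have h2 := abs_exponent_sub_le (p := p) (a := α d) (c := γ d) (c' := γ d') (hU d hd)
      (hU d' hd') (by linarith) g2
    have e1 := hα.dist_le_mul d d'
    have e2 := hγ.dist_le_mul d d'
    have e3 := hKu.dist_le_mul d (hsub hd) d' (hsub hd')
    rw [Real.dist_eq, dist_eq_norm] at e1 e2
    rw [dist_eq_norm, dist_eq_norm] at e3
    set Δ := ‖d - d'‖ with hΔ
    have hΔ0 : 0 ≤ Δ := norm_nonneg _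
    have h3 : |α d - α d'| * (2 + 2 * U ^ 2) +
        a₁ * (‖d.1⁻¹ • d.2.1 - d'.1⁻¹ • d'.2.1‖ * (1 + 2 * U)) + |γ d - γ d'| ≤ C * Δ := by
      have hU0 : 0 ≤ U := le_trans (norm_nonneg _) (hU d hd)
      have ha₁ : 0 ≤ a₁ := by linarith
      rw [hC, abs_of_nonneg hU0, abs_of_nonneg ha₁]
      calc _ ≤ L * Δ * (2 + 2 * U ^ 2) + a₁ * (Ku * Δ * (1 + 2 * U)) + L * Δ := by gcongr
        _ = _ := by ring
    have h4 : (κ ^ 2)⁻¹ * C ≤ κ⁻¹ + (κ ^ 2)⁻¹ * C := le_add_of_nonneg_left (by positivity)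
    calc _ ≤ (1 + ‖p‖ ^ 2) * ((κ ^ 2)⁻¹ * (C * Δ * (1 + ‖p‖ ^ 2)) *
          (Real.exp (a₀ * U ^ 2 - c₀) * Real.exp (-(a₀ / 2) * ‖p‖ ^ 2))) := by
          refine mul_le_mul_of_nonneg_left (h1.trans ?_) (by positivity)
          gcongr
          exact h2.trans (by gcongr)
      _ = Δ * ((κ ^ 2)⁻¹ * C * ((1 + ‖p‖ ^ 2) ^ 2 *
          (Real.exp (a₀ * U ^ 2 - c₀) * Real.exp (-(a₀ / 2) * ‖p‖ ^ 2)))) := by ring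
      _ ≤ Δ * ((κ⁻¹ + (κ ^ 2)⁻¹ * C) * ((1 + ‖p‖ ^ 2) ^ 2 *
          (Real.exp (a₀ * U ^ 2 - c₀) * Real.exp (-(a₀ / 2) * ‖p‖ ^ 2)))) := by gcongr
      _ = _ := by rw [hB]; ring

/-! ### The linear transport problem and attenuation estimates -/

/-- The mass to the left of `x`. -/
noncomputable def cumulativeMass (U : ℝ → Fields) (x : ℝ) : ℝ := ∫ y in (0 : ℝ)..x, (U y).1

/-- The wall at which particles of momentum `p` enter the slab. -/
noncomputable def entryWall (p : Momentum) : ℝ := if 0 < p 0 then 0 else 1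

/-- The contribution of the inflow data to the solution of the transport problem. -/
noncomputable def boundaryPart (τ : ℝ) (ψ : Momentum → ℝ) (U : ℝ → Fields) (x : ℝ)
    (p : Momentum) : ℝ :=
  Real.exp (-(1 / (τ * |p 0|)) * |cumulativeMass U x - cumulativeMass U (entryWall p)|) * ψ p

/-- The density of particles of momentum `p` arriving at `x` after their last collision at `y`. -/
noncomputable def gainDensity (K : Fields → Momentum → ℝ) (τ : ℝ) (U : ℝ → Fields) (x : ℝ)
    (p : Momentum) (y : ℝ) : ℝ :=
  -- Particles with `p 0 > 0` arrive from `y < x` and those with `p 0 < 0` from `y > x`; the sign of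
  -- the product covers both half-spaces.
  if 0 < (x - y) * p 0 then
    Real.exp (-(1 / (τ * |p 0|)) * |cumulativeMass U x - cumulativeMass U y|) * (U y).1
      * K (U y) p
  else 0

/-- The contribution of the collisions to the solution of the transport problem. -/
noncomputable def gainPart (K : Fields → Momentum → ℝ) (τ : ℝ) (U : ℝ → Fields) (x : ℝ)
    (p : Momentum) : ℝ :=
  1 / (τ * |p 0|) * ∫ y in Ioc (0 : ℝ) 1, gainDensity K τ U x p y

/-- The solution of the linear transport problem with given fields and inflow data. -/
noncomputable def transport (K : Fields → Momentum → ℝ) (τ : ℝ) (ψ : Momentum → ℝ)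
    (U : ℝ → Fields) (x : ℝ) (p : Momentum) : ℝ :=
  boundaryPart τ ψ U x p + gainPart K τ U x p

/-- A measurable profile of fields with values in `D`. -/
structure IsProfile (D : Set Fields) (U : ℝ → Fields) : Prop where
  measurable : Measurable U
  mem : ∀ y, U y ∈ D

/-- Effective strength of collisions at inverse free path `r`. -/
noncomputable def collisionWeight (n₀ r : ℝ) : ℝ := min r (4 / n₀)

/-- The bound `r` uses that the slab has length one and the integrand is at most 1; the bound `2/η`
integrates over the whole line. The first is small for large `τ`, the second stays bounded as `p₁ →
0`. -/
lemma mul_integral_exp_le {r η : ℝ} (hr : 0 ≤ r) (hη : 0 < η) (x : ℝ) :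
    r * ∫ y in Ioc (0 : ℝ) 1, Real.exp (-(η * r * |x - y|)) ≤ min r (2 / η) := by
  have hpos : ∀ y : ℝ, 0 ≤ Real.exp (-(η * r * |x - y|)) := fun y => (Real.exp_pos _).le
  refine le_min ?_ ?_
  · have : ∫ y in Ioc (0 : ℝ) 1, Real.exp (-(η * r * |x - y|)) ≤ ∫ _ in Ioc (0 : ℝ) 1, (1 : ℝ) := by
      refine integral_mono_of_nonneg (Eventually.of_forall hpos)
        (integrable_const _) (Eventually.of_forall fun y => ?_)
      have : 0 ≤ η * r * |x - y| := by positivity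
      exact Real.exp_le_one_iff.2 (by linarith)
    simp at this
    nlinarith
  · rcases hr.eq_or_lt with rfl | hr
    · simp; positivity
    have hη' : -(η * r) < 0 := by
      have : 0 < η * r := by positivity
      linarith
    have h1 : ∫ y : ℝ, Real.exp (-(η * r) * |y|) = 2 / (η * r) := by
      rw [integral_comp_abs (f := fun y => Real.exp (-(η * r) * y)), integral_exp_mul_Ioi hη']
      simp
      ring
    have h2 : ∫ y : ℝ, Real.exp (-(η * r * |x - y|)) = 2 / (η * r) := by
      rw [← h1, ← integral_sub_left_eq_self (fun y => Real.exp (-(η * r) * |y|)) volume x]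
      simp [neg_mul]
    -- A non-integrable function has integral zero by convention, contrary to the positive value
    -- just computed.
    have h3 : Integrable fun y : ℝ => Real.exp (-(η * r * |x - y|)) := by
      by_contra h
      rw [integral_undef h] at h2
      have : 0 < 2 / (η * r) := by positivity
      linarith
    have h4 := setIntegral_le_integral (s := Ioc (0 : ℝ) 1) h3 (Eventually.of_forall hpos)
    rw [h2] at h4
    calc r * _ ≤ r * (2 / (η * r)) := by gcongr
      _ = 2 / η := by field_simp

lemma abs_exp_neg_sub_le {a b m : ℝ} (ha : m ≤ a) (hb : m ≤ b) :
    |Real.exp (-a) - Real.exp (-b)| ≤ |a - b| * Real.exp (-m) := by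
  wlog hab : a ≤ b generalizing a b
  · rw [abs_sub_comm, abs_sub_comm a]; exact this hb ha (le_of_not_ge hab)
  have h1 : Real.exp (-b) ≤ Real.exp (-a) := Real.exp_le_exp.2 (by linarith)
  rw [abs_of_nonneg (by linarith), abs_sub_comm, abs_of_nonneg (by linarith)]
  have h2 := Real.add_one_le_exp (a - b)
  have h3 : Real.exp (-b) = Real.exp (-a) * Real.exp (a - b) := by
    rw [← Real.exp_add]; congr 1; ring
  have h4 : Real.exp (-a) ≤ Real.exp (-m) := Real.exp_le_exp.2 (by linarith)
  have h5 : 0 ≤ b - a := by linarith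
  nlinarith [Real.exp_pos (-a), mul_le_mul_of_nonneg_left h4 h5]

/-- Pointwise Lipschitz estimate of an attenuated source term. -/
lemma abs_attenuated_sub_le {n₀ a_u r l q q' Δ N N' k k' w : ℝ} (hn : 0 < n₀) (hr : 0 ≤ r)
    (hl : 0 ≤ l) (hq : n₀ * l ≤ q) (hq' : n₀ * l ≤ q') (hqq : |q - q'| ≤ l * Δ) (hN : 0 ≤ N)
    (hNa : N ≤ a_u) (hN' : 0 ≤ N') (hNa' : N' ≤ a_u) (hNN : |N - N'| ≤ Δ) (hk : 0 ≤ k)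
    (hkw : k ≤ w) (hkk : |k - k'| ≤ Δ * w) :
    |Real.exp (-r * q) * N * k - Real.exp (-r * q') * N' * k'| ≤
      Δ * (2 / n₀ * a_u + 1 + a_u) * w * Real.exp (-(n₀ / 2 * r * l)) := by
  have hΔ : 0 ≤ Δ := le_trans (abs_nonneg _) hNN
  have hw : 0 ≤ w := hk.trans hkw
  have ha : 0 ≤ a_u := hN.trans hNa
  -- The attenuation exponents are at least `2 z`. One factor `e^(-z)` absorbs the growth `r l` that
  -- comes from differentiating the exponential, through `z e^(-z) ≤ 1`; the other remains, hence
  -- the rate `n₀ / 2`.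
  set z := n₀ / 2 * r * l with hz
  have hz0 : 0 ≤ z := by positivity
  have hzq : 2 * z ≤ r * q := by rw [hz]; nlinarith
  have hzq' : 2 * z ≤ r * q' := by rw [hz]; nlinarith
  have e1 : |Real.exp (-r * q) - Real.exp (-r * q')| ≤ Δ * (2 / n₀) * Real.exp (-z) := by
    have h1 := abs_exp_neg_sub_le hzq hzq'
    rw [← neg_mul, ← neg_mul, ← mul_sub, abs_mul, abs_of_nonneg hr] at h1
    have h2 : z * Real.exp (-z) ≤ 1 := by
      have h3 := Real.add_one_le_exp z
      have h4 : Real.exp z * Real.exp (-z) = 1 := by rw [← Real.exp_add]; simp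
      nlinarith [Real.exp_pos (-z)]
    have h5 : Real.exp (-(2 * z)) = Real.exp (-z) * Real.exp (-z) := by
      rw [← Real.exp_add]; congr 1; ring
    calc _ ≤ r * |q - q'| * Real.exp (-(2 * z)) := h1
      _ ≤ r * (l * Δ) * Real.exp (-(2 * z)) := by gcongr
      _ = Δ * (2 / n₀) * (z * Real.exp (-z)) * Real.exp (-z) := by
          rw [h5, hz]; field_simp
      _ ≤ Δ * (2 / n₀) * 1 * Real.exp (-z) := by gcongr
      _ = _ := by ring
  have e2 : Real.exp (-r * q') ≤ Real.exp (-z) := Real.exp_le_exp.2 (by linarith)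
  have hsplit : Real.exp (-r * q) * N * k - Real.exp (-r * q') * N' * k' =
      (Real.exp (-r * q) - Real.exp (-r * q')) * (N * k) +
        Real.exp (-r * q') * ((N - N') * k) + Real.exp (-r * q') * (N' * (k - k')) := by ring
  rw [hsplit]
  refine (abs_add_three _ _ _).trans ?_
  rw [abs_mul, abs_mul, abs_mul, abs_mul, abs_mul, abs_mul N' _, abs_of_nonneg hN,
    abs_of_nonneg hN', abs_of_nonneg hk, abs_of_pos (Real.exp_pos _)]
  calc _ ≤ Δ * (2 / n₀) * Real.exp (-z) * (a_u * w) + Real.exp (-z) * (Δ * w)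
        + Real.exp (-z) * (a_u * (Δ * w)) := by gcongr
    _ = _ := by ring

/-! ### Bounds and Lipschitz estimates for the transport solution -/

section profile

variable {n₀ a_u τ : ℝ} {D : Set Fields} {U V : ℝ → Fields}

lemma IsProfile.intervalIntegrable (hU : IsProfile D U) (hn : 0 < n₀)
    (hD : ∀ d ∈ D, n₀ ≤ d.1 ∧ d.1 ≤ a_u) (x y : ℝ) :
    IntervalIntegrable (fun t => (U t).1) volume x y := by
  refine (intervalIntegrable_const (c := a_u)).mono_fun
    (measurable_fst.comp hU.measurable).aestronglyMeasurable (Eventually.of_forall fun t => ?_)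
  have := hD _ (hU.mem t)
  simp only [Real.norm_eq_abs]
  rw [abs_of_nonneg (by linarith)]
  exact this.2.trans (le_abs_self _)

lemma cumulativeMass_sub (hU : IsProfile D U) (hn : 0 < n₀)
    (hD : ∀ d ∈ D, n₀ ≤ d.1 ∧ d.1 ≤ a_u) (x y : ℝ) :
    cumulativeMass U x - cumulativeMass U y = ∫ t in y..x, (U t).1 :=
  intervalIntegral.integral_interval_sub_left (hU.intervalIntegrable hn hD _ _)
    (hU.intervalIntegrable hn hD _ _)

lemma measurable_cumulativeMass (hU : IsProfile D U) (hn : 0 < n₀)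
    (hD : ∀ d ∈ D, n₀ ≤ d.1 ∧ d.1 ≤ a_u) : Measurable (cumulativeMass U) :=
  (intervalIntegral.continuous_primitive (fun a b => hU.intervalIntegrable hn hD a b) 0).measurable

lemma abs_cumulativeMass_sub (hU : IsProfile D U) (hn : 0 < n₀)
    (hD : ∀ d ∈ D, n₀ ≤ d.1 ∧ d.1 ≤ a_u) (x y : ℝ) :
    n₀ * |x - y| ≤ |cumulativeMass U x - cumulativeMass U y| ∧
      |cumulativeMass U x - cumulativeMass U y| ≤ a_u * |x - y| := by
  wlog hxy : y ≤ x generalizing x y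
  · rw [abs_sub_comm x, abs_sub_comm (cumulativeMass U x)]
    exact this y x (le_of_not_ge hxy)
  rw [cumulativeMass_sub hU hn hD, abs_of_nonneg (sub_nonneg.2 hxy)]
  have hi := hU.intervalIntegrable hn hD y x
  have h1 := intervalIntegral.integral_mono_on hxy intervalIntegrable_const hi
    (fun t _ => (hD _ (hU.mem t)).1)
  have h2 := intervalIntegral.integral_mono_on hxy hi intervalIntegrable_const
    (fun t _ => (hD _ (hU.mem t)).2)
  simp only [intervalIntegral.integral_const, smul_eq_mul] at h1 h2
  rw [abs_of_nonneg]
  · constructor <;> linarith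
  · exact le_trans (mul_nonneg (by linarith) hn.le) h1

lemma abs_cumulativeMass_diff_le (hU : IsProfile D U) (hV : IsProfile D V) (hn : 0 < n₀)
    (hD : ∀ d ∈ D, n₀ ≤ d.1 ∧ d.1 ≤ a_u) {Δ : ℝ} (hUV : ∀ y, ‖U y - V y‖ ≤ Δ) (x y : ℝ) :
    |(|cumulativeMass U x - cumulativeMass U y| - |cumulativeMass V x - cumulativeMass V y|)|
      ≤ |x - y| * Δ := by
  refine (abs_abs_sub_abs_le_abs_sub _ _).trans ?_
  rw [cumulativeMass_sub hU hn hD, cumulativeMass_sub hV hn hD,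
    ← intervalIntegral.integral_sub (hU.intervalIntegrable hn hD _ _)
      (hV.intervalIntegrable hn hD _ _), mul_comm]
  exact intervalIntegral.norm_integral_le_of_norm_le_const fun t _ =>
    (norm_fst_le (U t - V t)).trans (hUV t)

lemma entryWall_mem (p : Momentum) : entryWall p ∈ Icc (0 : ℝ) 1 := by
  unfold entryWall; split_ifs <;> simp

lemma measurable_entryWall : Measurable entryWall :=
  Measurable.ite (measurableSet_lt (by fun_prop) (by fun_prop)) (by fun_prop) (by fun_prop)

lemma abs_sub_le_one {x y : ℝ} (hx : x ∈ Icc (0 : ℝ) 1) (hy : y ∈ Icc (0 : ℝ) 1) :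
    |x - y| ≤ 1 := by
  rw [abs_le]; constructor <;> linarith [hx.1, hx.2, hy.1, hy.2]

variable {K : Fields → Momentum → ℝ} {h ψ : Momentum → ℝ}

lemma measurable_gainDensity (hK : IsDominatedKernel D K h) (hU : IsProfile D U) (hn : 0 < n₀)
    (hD : ∀ d ∈ D, n₀ ≤ d.1 ∧ d.1 ≤ a_u) :
    Measurable fun z : (ℝ × Momentum) × ℝ => gainDensity K τ U z.1.1 z.1.2 z.2 := by
  have hA := measurable_cumulativeMass hU hn hD
  have hU' := hU.measurable
  have hKm : Measurable fun z : (ℝ × Momentum) × ℝ => K (U z.2) z.1.2 :=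
    hK.measurable.comp (by fun_prop : Measurable fun z : (ℝ × Momentum) × ℝ => (U z.2, z.1.2))
  unfold gainDensity
  refine Measurable.ite (measurableSet_lt (by fun_prop) (by fun_prop)) (Measurable.mul ?_ hKm)
    measurable_const
  fun_prop

lemma gainDensity_nonneg (hK : IsDominatedKernel D K h) (hU : IsProfile D U) (hn : 0 < n₀)
    (hD : ∀ d ∈ D, n₀ ≤ d.1 ∧ d.1 ≤ a_u) (x : ℝ) (p : Momentum) (y : ℝ) :
    0 ≤ gainDensity K τ U x p y := by
  have h1 : 0 ≤ (U y).1 := by linarith [(hD _ (hU.mem y)).1]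
  have h2 := hK.nonneg _ (hU.mem y) p
  unfold gainDensity
  split_ifs <;> positivity

lemma IsDominatedKernel.le_div (hK : IsDominatedKernel D K h) {d : Fields} (hd : d ∈ D)
    (p : Momentum) : K d p ≤ h p / (1 + ‖p‖ ^ 2) := by
  rw [le_div_iff₀ (by positivity), mul_comm]
  exact hK.le d hd p

/-- The attenuation has the rate `n₀`; half of it is given up so that this bound and the Lipschitz
bound lead to the same collision weight. -/
lemma gainDensity_le (hK : IsDominatedKernel D K h) (hU : IsProfile D U) (hn : 0 < n₀)
    (hD : ∀ d ∈ D, n₀ ≤ d.1 ∧ d.1 ≤ a_u) (hτ : 0 < τ) (x : ℝ) (p : Momentum) (y : ℝ) :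
    gainDensity K τ U x p y ≤ a_u * (h p / (1 + ‖p‖ ^ 2)) *
      Real.exp (-(n₀ / 2 * (1 / (τ * |p 0|)) * |x - y|)) := by
  have h1 := hD _ (hU.mem y)
  have h0 : 0 ≤ (U y).1 := by linarith
  have h2 := hK.nonneg _ (hU.mem y) p
  have h3 := hK.le_div (hU.mem y) p
  have hw : 0 ≤ h p / (1 + ‖p‖ ^ 2) := h2.trans h3
  have ha : 0 ≤ a_u := h0.trans h1.2
  have h4 := (abs_cumulativeMass_sub hU hn hD x y).1
  have hr : 0 ≤ 1 / (τ * |p 0|) := by positivity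
  unfold gainDensity
  split_ifs
  · calc _ ≤ Real.exp (-(n₀ / 2 * (1 / (τ * |p 0|)) * |x - y|)) * a_u *
          (h p / (1 + ‖p‖ ^ 2)) := by
          gcongr
          · have := mul_le_mul_of_nonneg_left h4 hr
            have : 0 ≤ n₀ / 2 * (1 / (τ * |p 0|)) * |x - y| := by positivity
            linarith
          · exact h1.2
      _ = _ := by ring
  · positivity

lemma integrableOn_gainDensity (hK : IsDominatedKernel D K h) (hU : IsProfile D U) (hn : 0 < n₀)
    (hD : ∀ d ∈ D, n₀ ≤ d.1 ∧ d.1 ≤ a_u) (hτ : 0 < τ) (x : ℝ) (p : Momentum) :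
    IntegrableOn (gainDensity K τ U x p) (Ioc 0 1) := by
  have ha : 0 ≤ a_u := by linarith [hD _ (hU.mem 0)]
  have hw := hK.weight_nonneg p
  refine (integrable_const (a_u * (h p / (1 + ‖p‖ ^ 2)))).mono' ?_ (Eventually.of_forall fun y => ?_)
  · exact ((measurable_gainDensity hK hU hn hD).comp
      (measurable_prodMk_left (x := (x, p)))).aestronglyMeasurable
  · rw [Real.norm_of_nonneg (gainDensity_nonneg hK hU hn hD x p y)]
    refine (gainDensity_le hK hU hn hD hτ x p y).trans (mul_le_of_le_one_right (by positivity) ?_)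
    have : 0 ≤ n₀ / 2 * (1 / (τ * |p 0|)) * |x - y| := by positivity
    exact Real.exp_le_one_iff.2 (by linarith)

lemma mul_integral_exp_le_collisionWeight (hn : 0 < n₀) (hτ : 0 < τ) (x : ℝ) (p : Momentum) :
    1 / (τ * |p 0|) * ∫ y in Ioc (0 : ℝ) 1, Real.exp (-(n₀ / 2 * (1 / (τ * |p 0|)) * |x - y|))
      ≤ collisionWeight n₀ (1 / (τ * |p 0|)) := by
  have := mul_integral_exp_le (r := 1 / (τ * |p 0|)) (by positivity) (half_pos hn) x
  rwa [show 2 / (n₀ / 2) = 4 / n₀ by field_simp; norm_num] at this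

lemma gainPart_nonneg (hK : IsDominatedKernel D K h) (hU : IsProfile D U) (hn : 0 < n₀)
    (hD : ∀ d ∈ D, n₀ ≤ d.1 ∧ d.1 ≤ a_u) (hτ : 0 < τ) (x : ℝ) (p : Momentum) :
    0 ≤ gainPart K τ U x p :=
  mul_nonneg (by positivity)
    (integral_nonneg fun y => gainDensity_nonneg hK hU hn hD x p y)

lemma integrableOn_exp_abs (b x : ℝ) :
    IntegrableOn (fun y : ℝ => Real.exp (-(b * |x - y|))) (Ioc 0 1) :=
  (by fun_prop : Continuous fun y : ℝ => Real.exp (-(b * |x - y|))).integrableOn_Ioc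

/-- Integration of the attenuation over the slab turns the singular prefactor `1/(τ|p₁|)` into the
bounded collision weight, so no integrability of `h / |p₁|` is required. -/
lemma gainPart_le (hK : IsDominatedKernel D K h) (hU : IsProfile D U) (hn : 0 < n₀)
    (hD : ∀ d ∈ D, n₀ ≤ d.1 ∧ d.1 ≤ a_u) (hτ : 0 < τ) (x : ℝ) (p : Momentum) :
    gainPart K τ U x p * (1 + ‖p‖ ^ 2) ≤
      a_u * (collisionWeight n₀ (1 / (τ * |p 0|)) * h p) := by
  have ha : 0 ≤ a_u := by linarith [hD _ (hU.mem 0)]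
  have hw := hK.weight_nonneg p
  have h1 : ∫ y in Ioc (0 : ℝ) 1, gainDensity K τ U x p y ≤ a_u * (h p / (1 + ‖p‖ ^ 2)) *
      ∫ y in Ioc (0 : ℝ) 1, Real.exp (-(n₀ / 2 * (1 / (τ * |p 0|)) * |x - y|)) := by
    rw [← integral_const_mul]
    refine integral_mono (integrableOn_gainDensity hK hU hn hD hτ x p)
      ((integrableOn_exp_abs (n₀ / 2 * (1 / (τ * |p 0|))) x).const_mul _) fun y => ?_
    exact gainDensity_le hK hU hn hD hτ x p y
  have h2 := mul_integral_exp_le_collisionWeight hn hτ x p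
  unfold gainPart
  calc _ ≤ 1 / (τ * |p 0|) * (a_u * (h p / (1 + ‖p‖ ^ 2)) *
        ∫ y in Ioc (0 : ℝ) 1, Real.exp (-(n₀ / 2 * (1 / (τ * |p 0|)) * |x - y|)))
          * (1 + ‖p‖ ^ 2) := by gcongr
    _ = a_u * ((1 / (τ * |p 0|) *
        ∫ y in Ioc (0 : ℝ) 1, Real.exp (-(n₀ / 2 * (1 / (τ * |p 0|)) * |x - y|))) * h p) := by
        have : (1 + ‖p‖ ^ 2) ≠ 0 := by positivity
        field_simp
    _ ≤ _ := by gcongr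

lemma abs_gainDensity_sub_le (hK : IsDominatedKernel D K h) (hU : IsProfile D U)
    (hV : IsProfile D V) (hn : 0 < n₀) (hD : ∀ d ∈ D, n₀ ≤ d.1 ∧ d.1 ≤ a_u) (hτ : 0 < τ) {Δ : ℝ}
    (hUV : ∀ y, ‖U y - V y‖ ≤ Δ) (x : ℝ) (p : Momentum) (y : ℝ) :
    |gainDensity K τ U x p y - gainDensity K τ V x p y| ≤
      Δ * (2 / n₀ * a_u + 1 + a_u) * (h p / (1 + ‖p‖ ^ 2)) *
        Real.exp (-(n₀ / 2 * (1 / (τ * |p 0|)) * |x - y|)) := by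
  have hu := hD _ (hU.mem y)
  have hv := hD _ (hV.mem y)
  have ha : 0 ≤ a_u := by linarith
  have hΔ : 0 ≤ Δ := (norm_nonneg _).trans (hUV y)
  have hw := hK.weight_nonneg p
  unfold gainDensity
  split_ifs
  · refine abs_attenuated_sub_le hn (by positivity) (abs_nonneg _)
      (abs_cumulativeMass_sub hU hn hD x y).1 (abs_cumulativeMass_sub hV hn hD x y).1
      (abs_cumulativeMass_diff_le hU hV hn hD hUV x y) (by linarith) hu.2 (by linarith) hv.2
      ((norm_fst_le (U y - V y)).trans (hUV y)) (hK.nonneg _ (hU.mem y) p)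
      (hK.le_div (hU.mem y) p) ?_
    rw [← mul_div_assoc, le_div_iff₀ (by positivity), mul_comm]
    refine (hK.lipschitz _ (hU.mem y) _ (hV.mem y) p).trans ?_
    gcongr
    exact hUV y
  · simp only [sub_self, abs_zero]
    positivity

lemma abs_gainPart_sub_le (hK : IsDominatedKernel D K h) (hU : IsProfile D U)
    (hV : IsProfile D V) (hn : 0 < n₀) (hD : ∀ d ∈ D, n₀ ≤ d.1 ∧ d.1 ≤ a_u) (hτ : 0 < τ) {Δ : ℝ}
    (hUV : ∀ y, ‖U y - V y‖ ≤ Δ) (x : ℝ) (p : Momentum) :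
    |gainPart K τ U x p - gainPart K τ V x p| * (1 + ‖p‖ ^ 2) ≤
      Δ * ((2 / n₀ * a_u + 1 + a_u) * (collisionWeight n₀ (1 / (τ * |p 0|)) * h p)) := by
  have ha : 0 ≤ a_u := by linarith [hD _ (hU.mem 0)]
  have hw := hK.weight_nonneg p
  have hΔ : 0 ≤ Δ := (norm_nonneg _).trans (hUV 0)
  have h1 : |(∫ y in Ioc (0 : ℝ) 1, gainDensity K τ U x p y) -
      ∫ y in Ioc (0 : ℝ) 1, gainDensity K τ V x p y| ≤
      Δ * (2 / n₀ * a_u + 1 + a_u) * (h p / (1 + ‖p‖ ^ 2)) *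
        ∫ y in Ioc (0 : ℝ) 1, Real.exp (-(n₀ / 2 * (1 / (τ * |p 0|)) * |x - y|)) := by
    rw [← integral_const_mul, ← integral_sub (integrableOn_gainDensity hK hU hn hD hτ x p)
      (integrableOn_gainDensity hK hV hn hD hτ x p)]
    have hb := (integrableOn_exp_abs (n₀ / 2 * (1 / (τ * |p 0|))) x).const_mul
      (Δ * (2 / n₀ * a_u + 1 + a_u) * (h p / (1 + ‖p‖ ^ 2)))
    rw [← Real.norm_eq_abs]
    exact norm_integral_le_of_norm_le hb (Eventually.of_forall fun y => abs_gainDensity_sub_le hK hU hV hn hD hτ hUV x p y)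
  have h2 := mul_integral_exp_le_collisionWeight hn hτ x p
  unfold gainPart
  rw [← mul_sub, abs_mul, abs_of_nonneg (by positivity : 0 ≤ 1 / (τ * |p 0|))]
  calc _ ≤ 1 / (τ * |p 0|) * (Δ * (2 / n₀ * a_u + 1 + a_u) * (h p / (1 + ‖p‖ ^ 2)) *
        ∫ y in Ioc (0 : ℝ) 1, Real.exp (-(n₀ / 2 * (1 / (τ * |p 0|)) * |x - y|)))
          * (1 + ‖p‖ ^ 2) := by gcongr
    _ = Δ * ((2 / n₀ * a_u + 1 + a_u) * ((1 / (τ * |p 0|) *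
        ∫ y in Ioc (0 : ℝ) 1, Real.exp (-(n₀ / 2 * (1 / (τ * |p 0|)) * |x - y|))) * h p)) := by
        have : (1 + ‖p‖ ^ 2) ≠ 0 := by positivity
        field_simp
    _ ≤ _ := by gcongr

/-- Here the attenuation is not used to gain decay: the derivative of the exponential costs
`1/(τ|p₁|)`, which is paid for by the integrability of the data divided by `|p₁|`. -/
lemma abs_boundaryPart_sub_le (hψ : ∀ p, 0 ≤ ψ p) (hU : IsProfile D U)
    (hV : IsProfile D V) (hn : 0 < n₀) (hD : ∀ d ∈ D, n₀ ≤ d.1 ∧ d.1 ≤ a_u) (hτ : 0 < τ) {Δ : ℝ}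
    (hUV : ∀ y, ‖U y - V y‖ ≤ Δ) {x : ℝ} (hx : x ∈ Icc (0 : ℝ) 1) (p : Momentum) :
    |boundaryPart τ ψ U x p - boundaryPart τ ψ V x p| ≤ Δ * (1 / (τ * |p 0|) * ψ p) := by
  have hΔ : 0 ≤ Δ := (norm_nonneg _).trans (hUV 0)
  have hr : 0 ≤ 1 / (τ * |p 0|) := by positivity
  have h1 := abs_cumulativeMass_diff_le hU hV hn hD hUV x (entryWall p)
  have h2 := abs_sub_le_one hx (entryWall_mem p)
  unfold boundaryPart
  set q := |cumulativeMass U x - cumulativeMass U (entryWall p)|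
  set q' := |cumulativeMass V x - cumulativeMass V (entryWall p)|
  have h3 := abs_exp_neg_sub_le (a := 1 / (τ * |p 0|) * q) (b := 1 / (τ * |p 0|) * q') (m := 0)
    (by positivity) (by positivity)
  rw [← sub_mul, abs_mul, abs_of_nonneg (hψ p), neg_mul, neg_mul]
  rw [← mul_sub, abs_mul, abs_of_nonneg hr, neg_zero, Real.exp_zero, mul_one] at h3
  calc _ ≤ 1 / (τ * |p 0|) * |q - q'| * ψ p := mul_le_mul_of_nonneg_right h3 (hψ p)
    _ ≤ 1 / (τ * |p 0|) * (1 * Δ) * ψ p := by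
        gcongr
        · exact hψ p
        · exact h1.trans (by gcongr)
    _ = _ := by ring

lemma abs_transport_sub_le (hK : IsDominatedKernel D K h) (hψ : ∀ p, 0 ≤ ψ p)
    (hU : IsProfile D U) (hV : IsProfile D V) (hn : 0 < n₀)
    (hD : ∀ d ∈ D, n₀ ≤ d.1 ∧ d.1 ≤ a_u) (hτ : 0 < τ) {Δ : ℝ} (hUV : ∀ y, ‖U y - V y‖ ≤ Δ) {x : ℝ}
    (hx : x ∈ Icc (0 : ℝ) 1) (p : Momentum) :
    |transport K τ ψ U x p - transport K τ ψ V x p| * (1 + ‖p‖ ^ 2) ≤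
      Δ * (1 / τ * (1 / |p 0| * ψ p * (1 + ‖p‖ ^ 2)) +
        (2 / n₀ * a_u + 1 + a_u) * (collisionWeight n₀ (1 / (τ * |p 0|)) * h p)) := by
  have h1 := abs_gainPart_sub_le hK hU hV hn hD hτ hUV x p
  have h0 : 0 ≤ 1 + ‖p‖ ^ 2 := by positivity
  have h2 := mul_le_mul_of_nonneg_right (abs_boundaryPart_sub_le hψ hU hV hn hD hτ hUV hx p) h0
  unfold transport
  rw [add_sub_add_comm, mul_add Δ]
  refine (mul_le_mul_of_nonneg_right (abs_add_le _ _) h0).trans ?_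
  rw [add_mul]
  refine add_le_add (h2.trans_eq ?_) h1
  rw [← one_div_mul_one_div]
  ring

lemma boundaryPart_le (hψ : ∀ p, 0 ≤ ψ p) (hτ : 0 < τ) (x : ℝ) (p : Momentum) :
    boundaryPart τ ψ U x p ≤ ψ p := by
  have h1 : 0 ≤ 1 / (τ * |p 0|) * |cumulativeMass U x - cumulativeMass U (entryWall p)| := by
    positivity
  exact mul_le_of_le_one_left (hψ p) (Real.exp_le_one_iff.2 (by linarith))

/-- The mass between `x` and the entry wall is at most `a_u`; this is the origin of the exponential
in `a_l`, `c_l` and `k`. -/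
lemma le_boundaryPart (hψ : ∀ p, 0 ≤ ψ p) (hU : IsProfile D U) (hn : 0 < n₀)
    (hD : ∀ d ∈ D, n₀ ≤ d.1 ∧ d.1 ≤ a_u) (hτ : 0 < τ) {x : ℝ} (hx : x ∈ Icc (0 : ℝ) 1)
    (p : Momentum) : Real.exp (-(a_u / (τ * |p 0|))) * ψ p ≤ boundaryPart τ ψ U x p := by
  have ha : 0 ≤ a_u := by linarith [hD _ (hU.mem 0)]
  have h1 := (abs_cumulativeMass_sub hU hn hD x (entryWall p)).2
  have h2 := abs_sub_le_one hx (entryWall_mem p)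
  have h3 : |cumulativeMass U x - cumulativeMass U (entryWall p)| ≤ a_u :=
    h1.trans (mul_le_of_le_one_right ha h2)
  refine mul_le_mul_of_nonneg_right (Real.exp_le_exp.2 ?_) (hψ p)
  rw [neg_mul, neg_le_neg_iff]
  exact (mul_le_mul_of_nonneg_left h3 (by positivity)).trans_eq (one_div_mul_eq_div _ _)

lemma transport_nonneg (hK : IsDominatedKernel D K h) (hψ : ∀ p, 0 ≤ ψ p) (hU : IsProfile D U)
    (hn : 0 < n₀) (hD : ∀ d ∈ D, n₀ ≤ d.1 ∧ d.1 ≤ a_u) (hτ : 0 < τ) (x : ℝ) (p : Momentum) :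
    0 ≤ transport K τ ψ U x p :=
  add_nonneg (mul_nonneg (Real.exp_pos _).le (hψ p)) (gainPart_nonneg hK hU hn hD hτ x p)

lemma transport_weighted_le (hK : IsDominatedKernel D K h) (hψ : ∀ p, 0 ≤ ψ p)
    (hU : IsProfile D U) (hn : 0 < n₀) (hD : ∀ d ∈ D, n₀ ≤ d.1 ∧ d.1 ≤ a_u) (hτ : 0 < τ) (x : ℝ)
    (p : Momentum) :
    transport K τ ψ U x p * (1 + ‖p‖ ^ 2) ≤
      ψ p * (1 + ‖p‖ ^ 2) + a_u * (collisionWeight n₀ (1 / (τ * |p 0|)) * h p) := by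
  unfold transport
  rw [add_mul]
  refine add_le_add (mul_le_mul_of_nonneg_right (boundaryPart_le hψ hτ x p) (by positivity)) ?_
  exact gainPart_le hK hU hn hD hτ x p

lemma measurable_gainPart (hK : IsDominatedKernel D K h) (hU : IsProfile D U) (hn : 0 < n₀)
    (hD : ∀ d ∈ D, n₀ ≤ d.1 ∧ d.1 ≤ a_u) :
    Measurable fun z : ℝ × Momentum => gainPart K τ U z.1 z.2 := by
  have h1 : StronglyMeasurable fun z : ℝ × Momentum =>
      ∫ y in Ioc (0 : ℝ) 1, gainDensity K τ U z.1 z.2 y :=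
    (measurable_gainDensity hK hU hn hD).stronglyMeasurable.integral_prod_right'
  unfold gainPart
  exact Measurable.mul (by fun_prop) h1.measurable

lemma measurable_attenuation (hU : IsProfile D U) (hn : 0 < n₀)
    (hD : ∀ d ∈ D, n₀ ≤ d.1 ∧ d.1 ≤ a_u) :
    Measurable fun z : ℝ × Momentum => Real.exp (-(1 / (τ * |z.2 0|)) *
      |cumulativeMass U z.1 - cumulativeMass U (entryWall z.2)|) := by
  have hA := measurable_cumulativeMass hU hn hD
  have hE := measurable_entryWall
  fun_prop

lemma aestronglyMeasurable_transport_section (hK : IsDominatedKernel D K h)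
    (hψm : AEStronglyMeasurable ψ) (hU : IsProfile D U) (hn : 0 < n₀)
    (hD : ∀ d ∈ D, n₀ ≤ d.1 ∧ d.1 ≤ a_u) (x : ℝ) :
    AEStronglyMeasurable (transport K τ ψ U x) := by
  refine AEStronglyMeasurable.add (AEStronglyMeasurable.mul ?_ hψm) ?_
  · exact ((measurable_attenuation hU hn hD).comp
      (measurable_prodMk_left (x := x))).aestronglyMeasurable
  · exact ((measurable_gainPart hK hU hn hD).comp
      (measurable_prodMk_left (x := x))).aestronglyMeasurable

lemma aestronglyMeasurable_transport (hK : IsDominatedKernel D K h)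
    (hψm : AEStronglyMeasurable ψ) (hU : IsProfile D U) (hn : 0 < n₀)
    (hD : ∀ d ∈ D, n₀ ≤ d.1 ∧ d.1 ≤ a_u) (μ : Measure ℝ) [SFinite μ] :
    AEStronglyMeasurable (fun z : ℝ × Momentum => transport K τ ψ U z.1 z.2)
      (μ.prod volume) := by
  refine AEStronglyMeasurable.add (AEStronglyMeasurable.mul ?_ hψm.comp_snd) ?_
  · exact (measurable_attenuation hU hn hD).aestronglyMeasurable
  · exact (measurable_gainPart hK hU hn hD).aestronglyMeasurable

lemma collisionWeight_nonneg (hn : 0 < n₀) {r : ℝ} (hr : 0 ≤ r) : 0 ≤ collisionWeight n₀ r :=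
  le_min hr (by positivity)

lemma measurable_collisionWeight : Measurable (collisionWeight n₀) :=
  measurable_id.min measurable_const

lemma integrable_collisionWeight_mul (hK : IsDominatedKernel D K h) (hn : 0 < n₀) (hτ : 0 < τ) :
    Integrable fun p : Momentum => collisionWeight n₀ (1 / (τ * |p 0|)) * h p := by
  refine (hK.integrable.const_mul (4 / n₀)).mono'
    (AEStronglyMeasurable.mul ?_ hK.integrable.aestronglyMeasurable)
    (Eventually.of_forall fun p => ?_)
  · exact (measurable_collisionWeight.comp (by fun_prop)).aestronglyMeasurable
  · have h1 := collisionWeight_nonneg hn (show 0 ≤ 1 / (τ * |p 0|) by positivity)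
    have h2 := hK.weight_nonneg p
    rw [Real.norm_of_nonneg (by positivity)]
    gcongr
    exact min_le_right _ _

/-- Collisions become negligible for large relaxation times. -/
lemma tendsto_collision_integral (hK : IsDominatedKernel D K h) (hn : 0 < n₀) :
    Tendsto (fun τ : ℝ => ∫ p : Momentum, collisionWeight n₀ (1 / (τ * |p 0|)) * h p) atTop
      (nhds 0) := by
  have h0 : ∫ p : Momentum, (0 : ℝ) = 0 := by simp
  rw [← h0]
  refine tendsto_integral_filter_of_dominated_convergence (fun p => 4 / n₀ * h p) ?_ ?_
    (hK.integrable.const_mul _) (Eventually.of_forall fun p => ?_)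
  · filter_upwards [eventually_gt_atTop 0] with τ hτ
    exact (integrable_collisionWeight_mul hK hn hτ).aestronglyMeasurable
  · filter_upwards [eventually_gt_atTop 0] with τ hτ
    refine Eventually.of_forall fun p => ?_
    have h1 := collisionWeight_nonneg hn (show 0 ≤ 1 / (τ * |p 0|) by positivity)
    have h2 := hK.weight_nonneg p
    rw [Real.norm_of_nonneg (by positivity)]
    gcongr
    exact min_le_right _ _
  -- Convergence holds at every `p`: if `p 0 = 0`, division by zero makes the collision weight
  -- vanish.
  · have h1 : Tendsto (fun τ : ℝ => 1 / |p 0| * τ⁻¹) atTop (nhds 0) := by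
      simpa using tendsto_inv_atTop_zero.const_mul (1 / |p 0|)
    have h2 : Tendsto (fun τ : ℝ => 1 / |p 0| * τ⁻¹ * h p) atTop (nhds 0) := by
      simpa using h1.mul_const (h p)
    refine squeeze_zero' ?_ ?_ h2
    · filter_upwards [eventually_gt_atTop 0] with τ hτ
      exact mul_nonneg (collisionWeight_nonneg hn (by positivity)) (hK.weight_nonneg p)
    · filter_upwards [eventually_gt_atTop 0] with τ hτ
      refine mul_le_mul_of_nonneg_right ((min_le_left _ _).trans_eq ?_) (hK.weight_nonneg p)
      rw [one_div, mul_inv, one_div, mul_comm]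

lemma integrable_transport_section (hK : IsDominatedKernel D K h) (hψ : ∀ p, 0 ≤ ψ p)
    (hψm : AEStronglyMeasurable ψ) (hψi : Integrable fun p => ψ p * (1 + ‖p‖ ^ 2))
    (hU : IsProfile D U) (hn : 0 < n₀) (hD : ∀ d ∈ D, n₀ ≤ d.1 ∧ d.1 ≤ a_u) (hτ : 0 < τ) (x : ℝ) :
    Integrable fun p => transport K τ ψ U x p * (1 + ‖p‖ ^ 2) := by
  refine (hψi.add ((integrable_collisionWeight_mul hK hn hτ).const_mul a_u)).mono'
    ((aestronglyMeasurable_transport_section hK hψm hU hn hD x).mul (by fun_prop))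
    (Eventually.of_forall fun p => ?_)
  have := transport_nonneg hK hψ hU hn hD hτ x p
  rw [Real.norm_of_nonneg (by positivity)]
  exact transport_weighted_le hK hψ hU hn hD hτ x p

lemma integrable_transport (hK : IsDominatedKernel D K h) (hψ : ∀ p, 0 ≤ ψ p)
    (hψm : AEStronglyMeasurable ψ) (hψi : Integrable fun p => ψ p * (1 + ‖p‖ ^ 2))
    (hU : IsProfile D U) (hn : 0 < n₀) (hD : ∀ d ∈ D, n₀ ≤ d.1 ∧ d.1 ≤ a_u) (hτ : 0 < τ)
    (μ : Measure ℝ) [IsFiniteMeasure μ] :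
    Integrable (fun z : ℝ × Momentum => transport K τ ψ U z.1 z.2 * (1 + ‖z.2‖ ^ 2))
      (μ.prod volume) := by
  refine ((hψi.add ((integrable_collisionWeight_mul hK hn hτ).const_mul a_u)).comp_snd μ).mono'
    ((aestronglyMeasurable_transport hK hψm hU hn hD μ).mul (by fun_prop))
    (Eventually.of_forall fun z => ?_)
  have := transport_nonneg hK hψ hU hn hD hτ z.1 z.2
  rw [Real.norm_of_nonneg (by positivity)]
  exact transport_weighted_le hK hψ hU hn hD hτ z.1 z.2

lemma cumulativeMass_congr (hUV : ∀ᵐ y ∂volume.restrict (Icc (0 : ℝ) 1), U y = V y) {x : ℝ}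
    (hx : x ∈ Icc (0 : ℝ) 1) : cumulativeMass U x = cumulativeMass V x := by
  refine intervalIntegral.integral_congr_ae ?_
  rw [ae_restrict_iff' measurableSet_Icc] at hUV
  filter_upwards [hUV] with y hy hmem
  rw [uIoc_of_le hx.1] at hmem
  rw [hy ⟨hmem.1.le, hmem.2.trans hx.2⟩]

/-- Fields enter only through integrals over the slab, so null sets and values outside the slab do
not matter. Uniqueness among almost everywhere solutions rests on this. -/
lemma transport_congr (hUV : ∀ᵐ y ∂volume.restrict (Icc (0 : ℝ) 1), U y = V y) {x : ℝ}
    (hx : x ∈ Icc (0 : ℝ) 1) (p : Momentum) :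
    transport K τ ψ U x p = transport K τ ψ V x p := by
  have h1 : boundaryPart τ ψ U x p = boundaryPart τ ψ V x p := by
    unfold boundaryPart
    rw [cumulativeMass_congr hUV hx, cumulativeMass_congr hUV (entryWall_mem p)]
  have h2 : gainPart K τ U x p = gainPart K τ V x p := by
    unfold gainPart
    congr 1
    refine setIntegral_congr_ae measurableSet_Ioc ?_
    have hUV' := (ae_restrict_iff' measurableSet_Icc).1 hUV
    filter_upwards [hUV'] with y hy hmem
    have hy' : y ∈ Icc (0 : ℝ) 1 := ⟨hmem.1.le, hmem.2⟩
    unfold gainDensity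
    rw [cumulativeMass_congr hUV hx, cumulativeMass_congr hUV hy', hy hy']
  unfold transport
  rw [h1, h2]

end profile

/-! ### Moments and the lower bound on the internal energy -/

/-- The macroscopic fields of a momentum distribution. -/
noncomputable def fieldsOf (g : Momentum → ℝ) : Fields := (mass g, momentum g, energy g)

section moments

variable {g g' φ : Momentum → ℝ}

lemma integrable_smul_of_weighted {F : Type*} [NormedAddCommGroup F] [NormedSpace ℝ F]
    (hg : Integrable fun p => g p * (1 + ‖p‖ ^ 2)) {w : Momentum → F} (hw : AEStronglyMeasurable w)
    (hb : ∀ p, ‖w p‖ ≤ 1 + ‖p‖ ^ 2) : Integrable fun p => g p • w p := by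
  have hgm : AEStronglyMeasurable g := by
    have h1 : AEStronglyMeasurable (fun p : Momentum => (1 + ‖p‖ ^ 2)⁻¹) :=
      (by fun_prop : Measurable fun p : Momentum => (1 + ‖p‖ ^ 2)⁻¹).aestronglyMeasurable
    refine (hg.aestronglyMeasurable.mul h1).congr (Eventually.of_forall fun p => ?_)
    have : 1 + ‖p‖ ^ 2 ≠ 0 := by positivity
    simp only [Pi.mul_apply]
    field_simp
  refine hg.mono (hgm.smul hw) (Eventually.of_forall fun p => ?_)
  rw [norm_smul, norm_mul, Real.norm_of_nonneg (by positivity : 0 ≤ 1 + ‖p‖ ^ 2)]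
  exact mul_le_mul_of_nonneg_left (hb p) (norm_nonneg _)

lemma norm_le_weight (p : Momentum) : ‖p‖ ≤ 1 + ‖p‖ ^ 2 := by
  nlinarith [sq_nonneg (‖p‖ - 1), norm_nonneg p]

lemma abs_apply_le_weight (p : Momentum) (i : Fin 3) : |p i| ≤ 1 + ‖p‖ ^ 2 :=
  (PiLp.norm_apply_le p i).trans (norm_le_weight p)

lemma integrable_of_weighted (hg : Integrable fun p => g p * (1 + ‖p‖ ^ 2)) : Integrable g := by
  have := integrable_smul_of_weighted hg (w := fun _ => (1 : ℝ)) (by fun_prop) fun p => by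
    simp
  simpa using this

lemma integrable_sq_of_weighted (hg : Integrable fun p => g p * (1 + ‖p‖ ^ 2)) :
    Integrable fun p => g p * ‖p‖ ^ 2 :=
  integrable_smul_of_weighted hg (w := fun p => ‖p‖ ^ 2) (by fun_prop) fun p => by
    simp

lemma integrable_momentum_of_weighted (hg : Integrable fun p => g p * (1 + ‖p‖ ^ 2)) :
    Integrable fun p => g p • p :=
  integrable_smul_of_weighted hg (w := fun p => p) (by fun_prop) norm_le_weight

lemma integrable_coord_of_weighted (hg : Integrable fun p => g p * (1 + ‖p‖ ^ 2)) (i : Fin 3) :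
    Integrable fun p => g p * p i :=
  integrable_smul_of_weighted hg (w := fun p => p i) (by fun_prop) fun p => abs_apply_le_weight p i

lemma integrable_pos_of_weighted (hg : Integrable fun p => g p * (1 + ‖p‖ ^ 2)) :
    Integrable fun p => g p * max (p 0) 0 :=
  integrable_smul_of_weighted hg (w := fun p => max (p 0) 0) (by fun_prop) fun p => by
    have := abs_apply_le_weight p 0
    rw [Real.norm_of_nonneg (le_max_right _ _)]
    exact max_le ((le_abs_self _).trans this) (by positivity)

lemma integrable_neg_of_weighted (hg : Integrable fun p => g p * (1 + ‖p‖ ^ 2)) :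
    Integrable fun p => g p * max (-p 0) 0 :=
  integrable_smul_of_weighted hg (w := fun p => max (-p 0) 0) (by fun_prop) fun p => by
    have := abs_apply_le_weight p 0
    rw [Real.norm_of_nonneg (le_max_right _ _)]
    exact max_le ((neg_le_abs _).trans this) (by positivity)

lemma momentum_apply (hg : Integrable fun p => g p * (1 + ‖p‖ ^ 2)) (i : Fin 3) :
    momentum g i = ∫ p, g p * p i := by
  have := (EuclideanSpace.proj i : Momentum →L[ℝ] ℝ).integral_comp_comm
    (integrable_momentum_of_weighted hg)
  simpa [momentum] using this.symm

/-- The single weight `1 + |p|²` dominates `1`, `|p|` and `|p|²`, and fields carry the maximum norm.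
-/
lemma norm_fieldsOf_sub_le (hg : Integrable fun p => g p * (1 + ‖p‖ ^ 2))
    (hg' : Integrable fun p => g' p * (1 + ‖p‖ ^ 2)) {w : Momentum → ℝ} (hw : Integrable w)
    (h : ∀ p, |g p - g' p| * (1 + ‖p‖ ^ 2) ≤ w p) :
    ‖fieldsOf g - fieldsOf g'‖ ≤ ∫ p, w p := by
  have key : ∀ p : Momentum, ∀ b : ℝ, b ≤ 1 + ‖p‖ ^ 2 → |g p - g' p| * b ≤ w p :=
    fun p b hb => (mul_le_mul_of_nonneg_left hb (abs_nonneg _)).trans (h p)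
  refine norm_prod_le_iff.2 ⟨?_, norm_prod_le_iff.2 ⟨?_, ?_⟩⟩
  · change ‖mass g - mass g'‖ ≤ _
    unfold mass
    rw [← integral_sub (integrable_of_weighted hg) (integrable_of_weighted hg')]
    refine norm_integral_le_of_norm_le hw (Eventually.of_forall fun p => ?_)
    simpa using key p 1 (by nlinarith [sq_nonneg ‖p‖])
  · change ‖momentum g - momentum g'‖ ≤ _
    unfold momentum
    rw [← integral_sub (integrable_momentum_of_weighted hg) (integrable_momentum_of_weighted hg')]
    refine norm_integral_le_of_norm_le hw (Eventually.of_forall fun p => ?_)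
    rw [← sub_smul, norm_smul]
    exact key p _ (norm_le_weight p)
  · change ‖energy g - energy g'‖ ≤ _
    unfold energy
    rw [← integral_sub (integrable_sq_of_weighted hg) (integrable_sq_of_weighted hg')]
    refine norm_integral_le_of_norm_le hw (Eventually.of_forall fun p => ?_)
    rw [← sub_mul, norm_mul, norm_pow, norm_norm]
    exact key p _ (by linarith)

/-- Cauchy–Schwarz inequality for the first component of the momentum. -/
lemma sq_add_le_energy_mul_mass (h0 : ∀ p, 0 ≤ g p)
    (hg : Integrable fun p => g p * (1 + ‖p‖ ^ 2)) :
    ((∫ p, g p * max (p 0) 0) + ∫ p, g p * max (-p 0) 0) ^ 2 ≤ energy g * mass g := by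
  set A := ∫ p, g p * max (p 0) 0 with hA
  set B := ∫ p, g p * max (-p 0) 0 with hB
  have hi := integrable_of_weighted hg
  have hi2 := integrable_sq_of_weighted hg
  have hiA := integrable_pos_of_weighted hg
  have hiB := integrable_neg_of_weighted hg
  -- This quadratic in `t` is the integral of `g ((t - |p₁|)² + |p|² - p₁²)`, and its discriminant
  -- is therefore nonpositive.
  have key : ∀ t : ℝ, 0 ≤ mass g * (t * t) + (-2 * (A + B)) * t + energy g := by
    intro t
    have e : mass g * (t * t) + (-2 * (A + B)) * t + energy g =
        ∫ p, ((t * t) * g p + (-2 * t) * (g p * max (p 0) 0 + g p * max (-p 0) 0)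
          + g p * ‖p‖ ^ 2) := by
      have f1 : Integrable fun p => (-2 * t) * (g p * max (p 0) 0 + g p * max (-p 0) 0) :=
        (hiA.add hiB).const_mul _
      have f2 : Integrable fun p =>
          (t * t) * g p + (-2 * t) * (g p * max (p 0) 0 + g p * max (-p 0) 0) :=
        (hi.const_mul _).add f1
      rw [integral_add f2 hi2, integral_add (hi.const_mul _) f1, integral_const_mul,
        integral_const_mul, integral_add hiA hiB]
      simp only [mass, energy]
      ring
    rw [e]
    refine integral_nonneg fun p => ?_
    have h1 : max (p 0) 0 + max (-p 0) 0 = |p 0| := by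
      rcases le_total 0 (p 0) with h | h
      · rw [max_eq_left h, max_eq_right (by linarith), abs_of_nonneg h, add_zero]
      · rw [max_eq_right h, max_eq_left (by linarith), abs_of_nonpos h, zero_add]
    have h2 : |p 0| ≤ ‖p‖ := PiLp.norm_apply_le p 0
    have h3 : |p 0| ^ 2 ≤ ‖p‖ ^ 2 := by gcongr
    have h4 : (t * t) * g p + (-2 * t) * (g p * max (p 0) 0 + g p * max (-p 0) 0)
          + g p * ‖p‖ ^ 2 = g p * ((t - |p 0|) ^ 2 + (‖p‖ ^ 2 - |p 0| ^ 2)) := by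
      rw [← mul_add, h1]; ring
    rw [h4]
    exact mul_nonneg (h0 p) (add_nonneg (sq_nonneg _) (by linarith))
  have := discrim_le_zero key
  unfold discrim at this
  nlinarith

lemma momentum_zero_eq (hg : Integrable fun p => g p * (1 + ‖p‖ ^ 2)) :
    momentum g 0 = (∫ p, g p * max (p 0) 0) - ∫ p, g p * max (-p 0) 0 := by
  rw [momentum_apply hg, ← integral_sub (integrable_pos_of_weighted hg)
    (integrable_neg_of_weighted hg)]
  refine integral_congr_ae (Eventually.of_forall fun p => ?_)
  simp only
  rw [← mul_sub]
  congr 1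
  rcases le_total 0 (p 0) with h | h
  · rw [max_eq_left h, max_eq_right (by linarith), sub_zero]
  · rw [max_eq_right h, max_eq_left (by linarith)]; ring

/-- Lower bound on the internal energy by the particle fluxes, if the transverse momenta are
small. -/
lemma energy_mul_mass_sub_ge (hφ0 : ∀ p, 0 ≤ φ p) (hφg : ∀ p, φ p ≤ g p)
    (hφ : Integrable fun p => φ p * (1 + ‖p‖ ^ 2)) (hg : Integrable fun p => g p * (1 + ‖p‖ ^ 2))
    {ε : ℝ} (h1 : |momentum g 1| ≤ ε) (h2 : |momentum g 2| ≤ ε) :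
    4 * ((∫ p, φ p * max (p 0) 0) * ∫ p, φ p * max (-p 0) 0) - 2 * ε ^ 2 ≤
      energy g * mass g - ‖momentum g‖ ^ 2 := by
  -- With `A` and `B` the fluxes of `g` to the right and to the left, `E N - P₁² ≥ (A + B)² - (A -
  -- B)² = 4 A B`, and the fluxes of `φ` are smaller. The transverse components cost at most `2 ε²`.
  have hCS := sq_add_le_energy_mul_mass (fun p => (hφ0 p).trans (hφg p)) hg
  have hP := momentum_zero_eq hg
  have hA : ∫ p, φ p * max (p 0) 0 ≤ ∫ p, g p * max (p 0) 0 :=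
    integral_mono (integrable_pos_of_weighted hφ) (integrable_pos_of_weighted hg)
      fun p => mul_le_mul_of_nonneg_right (hφg p) (le_max_right _ _)
  have hB : ∫ p, φ p * max (-p 0) 0 ≤ ∫ p, g p * max (-p 0) 0 :=
    integral_mono (integrable_neg_of_weighted hφ) (integrable_neg_of_weighted hg)
      fun p => mul_le_mul_of_nonneg_right (hφg p) (le_max_right _ _)
  have hA0 : 0 ≤ ∫ p, φ p * max (p 0) 0 :=
    integral_nonneg fun p => mul_nonneg (hφ0 p) (le_max_right _ _)
  have hB0 : 0 ≤ ∫ p, φ p * max (-p 0) 0 :=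
    integral_nonneg fun p => mul_nonneg (hφ0 p) (le_max_right _ _)
  have hAB := mul_le_mul hA hB hB0 (hA0.trans hA)
  have e1 : momentum g 1 ^ 2 ≤ ε ^ 2 := sq_le_sq' (abs_le.1 h1).1 (abs_le.1 h1).2
  have e2 : momentum g 2 ^ 2 ≤ ε ^ 2 := sq_le_sq' (abs_le.1 h2).1 (abs_le.1 h2).2
  rw [EuclideanSpace.norm_sq_eq, Fin.sum_univ_three]
  simp only [Real.norm_eq_abs, sq_abs]
  rw [hP]
  nlinarith

end moments

/-! ### Splitting off the transverse momenta -/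

section coordinates

/-- Momentum space as a product of the direction of the slab and the transverse directions. -/
noncomputable def momentumEquiv : Momentum ≃ᵐ ℝ × (ℝ × ℝ) :=
  (MeasurableEquiv.toLp 2 (Fin 3 → ℝ)).symm.trans
    ((MeasurableEquiv.piFinSuccAbove (fun _ => ℝ) 0).trans
      (MeasurableEquiv.prodCongr (MeasurableEquiv.refl ℝ) MeasurableEquiv.finTwoArrow))

lemma measurePreserving_momentumEquiv : MeasurePreserving momentumEquiv volume volume := by
  refine MeasurePreserving.trans (EuclideanSpace.volume_preserving_symm_measurableEquiv_toLp _)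
    (MeasurePreserving.trans (volume_preserving_piFinSuccAbove (fun _ : Fin 3 => ℝ) 0) ?_)
  exact (MeasurePreserving.id volume).prod (volume_preserving_finTwoArrow ℝ)

lemma momentumEquiv_symm_apply (z : ℝ × (ℝ × ℝ)) :
    momentumEquiv.symm z = !₂[z.1, z.2.1, z.2.2] := by
  rw [MeasurableEquiv.symm_apply_eq]
  rfl

lemma integral_momentum_eq {F : Momentum → ℝ} (hF : Integrable F) :
    ∫ p, F p = ∫ u : ℝ, ∫ q : ℝ × ℝ, F !₂[u, q.1, q.2] := by
  have hm := measurePreserving_momentumEquiv.symm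
  rw [← hm.integral_comp']
  have hi : Integrable (fun z => F (momentumEquiv.symm z)) (volume.prod volume) :=
    hm.integrable_comp_of_integrable hF
  rw [show (volume : Measure (ℝ × (ℝ × ℝ))) = volume.prod volume from rfl, integral_prod _ hi]
  simp only [momentumEquiv_symm_apply]

end coordinates

/-! ### The inflow data and the constants of the bounds -/

section inflow

variable {fL fR : Momentum → ℝ}

lemma inflow_nonneg (hL : ∀ p : Momentum, 0 < p 0 → 0 ≤ fL p)
    (hR : ∀ p : Momentum, p 0 < 0 → 0 ≤ fR p) (p : Momentum) : 0 ≤ inflow fL fR p := by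
  unfold inflow
  split_ifs with h1 h2
  · exact hL p h1
  · exact hR p h2
  · exact le_rfl

/-- The attenuated inflow data have no transverse momentum. -/
lemma integral_transverse_eq_zero
    (h_int : Integrable (fun p => inflow fL fR p * (1 + ‖p‖ ^ 2)))
    (hL : ∀ᵐ u : ℝ, 0 < u →
      (∫ q : ℝ × ℝ, fL !₂[u, q.1, q.2] * q.1) = 0 ∧ (∫ q : ℝ × ℝ, fL !₂[u, q.1, q.2] * q.2) = 0)
    (hR : ∀ᵐ u : ℝ, u < 0 →
      (∫ q : ℝ × ℝ, fR !₂[u, q.1, q.2] * q.1) = 0 ∧ (∫ q : ℝ × ℝ, fR !₂[u, q.1, q.2] * q.2) = 0)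
    {w : ℝ → ℝ} (hw : Measurable w) (hw1 : ∀ u, |w u| ≤ 1) :
    (∫ p : Momentum, w (p 0) * inflow fL fR p * p 1) = 0 ∧
      (∫ p : Momentum, w (p 0) * inflow fL fR p * p 2) = 0 := by
  have hint : ∀ i : Fin 3, Integrable fun p : Momentum => w (p 0) * inflow fL fR p * p i := by
    intro i
    have hwm : AEStronglyMeasurable (fun p : Momentum => w (p 0)) :=
      (hw.comp (by fun_prop : Measurable fun p : Momentum => p 0)).aestronglyMeasurable
    have := (integrable_coord_of_weighted h_int i).bdd_mul (c := 1) hwm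
      (Eventually.of_forall fun p => hw1 (p 0))
    simpa only [mul_assoc] using this
  constructor
  -- By Fubini, `w` is constant in the inner integral, which vanishes for almost every `p₁`; at `p₁
  -- = 0` the inflow is zero by definition.
  · rw [integral_momentum_eq (hint 1)]
    refine integral_eq_zero_of_ae ?_
    filter_upwards [hL, hR] with u h1 h2
    simp only [Pi.zero_apply, Matrix.cons_val_zero, Matrix.cons_val_one, inflow, mul_assoc]
    rw [integral_const_mul]
    rcases lt_trichotomy u 0 with h | h | h
    · simp [h, not_lt.2 h.le, (h2 h).1]
    · simp [h]
    · simp [h, (h1 h).1]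
  · rw [integral_momentum_eq (hint 2)]
    refine integral_eq_zero_of_ae ?_
    filter_upwards [hL, hR] with u h1 h2
    simp only [Pi.zero_apply, Matrix.cons_val_zero, Matrix.cons_val, inflow, mul_assoc]
    rw [integral_const_mul]
    rcases lt_trichotomy u 0 with h | h | h
    · simp [h, not_lt.2 h.le, (h2 h).2]
    · simp [h]
    · simp [h, (h1 h).2]

/-- The attenuated inflow, a lower bound of every solution. -/
noncomputable def attenuatedInflow (fL fR : Momentum → ℝ) (τ : ℝ) (p : Momentum) : ℝ :=
  Real.exp (-(aUpper fL fR / (τ * |p 0|))) * inflow fL fR p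

/-- The positive and negative parts of `p₁` encode both the half-space and the factor `|p₁|`, so
that the flux inequalities apply. -/
lemma kConst_eq (τ : ℝ) : kConst fL fR τ =
    (∫ p, attenuatedInflow fL fR τ p * max (p 0) 0) *
      ∫ p, attenuatedInflow fL fR τ p * max (-p 0) 0 := by
  unfold kConst
  have m1 : MeasurableSet {p : Momentum | 0 < p 0} := measurableSet_lt (by fun_prop) (by fun_prop)
  have m2 : MeasurableSet {p : Momentum | p 0 < 0} := measurableSet_lt (by fun_prop) (by fun_prop)
  congr 1
  · rw [← integral_indicator m1]
    congr 1 with p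
    by_cases h : 0 < p 0
    · rw [indicator_of_mem (show p ∈ {p : Momentum | 0 < p 0} from h)]
      simp [attenuatedInflow, inflow, h, max_eq_left h.le, abs_of_pos h]
    · rw [indicator_of_notMem (show p ∉ {p : Momentum | 0 < p 0} from h),
        max_eq_right (not_lt.1 h), mul_zero]
  · rw [← integral_indicator m2]
    congr 1 with p
    by_cases h : p 0 < 0
    · rw [indicator_of_mem (show p ∈ {p : Momentum | p 0 < 0} from h)]
      simp [attenuatedInflow, inflow, h, not_lt.2 h.le, max_eq_left (neg_pos.2 h).le,
        abs_of_neg h]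
    · rw [indicator_of_notMem (show p ∉ {p : Momentum | p 0 < 0} from h),
        max_eq_right (by linarith [not_lt.1 h]), mul_zero]

lemma aUpper_nonneg (hψ : ∀ p, 0 ≤ inflow fL fR p) : 0 ≤ aUpper fL fR :=
  mul_nonneg zero_le_two (integral_nonneg hψ)

lemma attenuatedInflow_nonneg (hψ : ∀ p, 0 ≤ inflow fL fR p) (τ : ℝ) (p : Momentum) :
    0 ≤ attenuatedInflow fL fR τ p :=
  mul_nonneg (Real.exp_pos _).le (hψ p)

lemma attenuatedInflow_le (hψ : ∀ p, 0 ≤ inflow fL fR p) {τ : ℝ} (hτ : 0 < τ) (p : Momentum) :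
    attenuatedInflow fL fR τ p ≤ inflow fL fR p := by
  have := aUpper_nonneg hψ
  have h : 0 ≤ aUpper fL fR / (τ * |p 0|) := by positivity
  exact mul_le_of_le_one_left (hψ p) (Real.exp_le_one_iff.2 (by linarith))

lemma attenuatedInflow_mono (hψ : ∀ p, 0 ≤ inflow fL fR p) {τ τ' : ℝ} (hτ : 0 < τ) (h : τ ≤ τ')
    (p : Momentum) : attenuatedInflow fL fR τ p ≤ attenuatedInflow fL fR τ' p := by
  have := aUpper_nonneg hψ
  refine mul_le_mul_of_nonneg_right (Real.exp_le_exp.2 (neg_le_neg ?_)) (hψ p)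
  rcases (abs_nonneg (p 0)).eq_or_lt with h0 | h0
  · simp [← h0]
  · gcongr

lemma integrable_attenuatedInflow (hψ : ∀ p, 0 ≤ inflow fL fR p)
    (h_int : Integrable (fun p => inflow fL fR p * (1 + ‖p‖ ^ 2))) {τ : ℝ} (hτ : 0 < τ) :
    Integrable fun p => attenuatedInflow fL fR τ p * (1 + ‖p‖ ^ 2) := by
  have hm := (integrable_of_weighted h_int).aestronglyMeasurable
  refine h_int.mono' ?_ (Eventually.of_forall fun p => ?_)
  · refine AEStronglyMeasurable.mul (AEStronglyMeasurable.mul ?_ hm) (by fun_prop)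
    exact (by fun_prop : Measurable fun p : Momentum =>
      Real.exp (-(aUpper fL fR / (τ * |p 0|)))).aestronglyMeasurable
  · have := attenuatedInflow_nonneg hψ τ p
    rw [Real.norm_of_nonneg (by positivity)]
    exact mul_le_mul_of_nonneg_right (attenuatedInflow_le hψ hτ p) (by positivity)

lemma aLower_eq (τ : ℝ) : aLower fL fR τ = mass (attenuatedInflow fL fR τ) := rfl

lemma cLower_eq (τ : ℝ) : cLower fL fR τ = energy (attenuatedInflow fL fR τ) := rfl

lemma aLower_mono (hψ : ∀ p, 0 ≤ inflow fL fR p)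
    (h_int : Integrable (fun p => inflow fL fR p * (1 + ‖p‖ ^ 2))) {τ τ' : ℝ} (hτ : 0 < τ)
    (h : τ ≤ τ') : aLower fL fR τ ≤ aLower fL fR τ' :=
  integral_mono (integrable_of_weighted (integrable_attenuatedInflow hψ h_int hτ))
    (integrable_of_weighted (integrable_attenuatedInflow hψ h_int (hτ.trans_le h)))
    (attenuatedInflow_mono hψ hτ h)

lemma kConst_mono (hψ : ∀ p, 0 ≤ inflow fL fR p)
    (h_int : Integrable (fun p => inflow fL fR p * (1 + ‖p‖ ^ 2))) {τ τ' : ℝ} (hτ : 0 < τ)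
    (h : τ ≤ τ') : kConst fL fR τ ≤ kConst fL fR τ' := by
  have h1 := integrable_attenuatedInflow hψ h_int hτ
  have h2 := integrable_attenuatedInflow hψ h_int (hτ.trans_le h)
  rw [kConst_eq, kConst_eq]
  refine mul_le_mul ?_ ?_ ?_ ?_
  · exact integral_mono (integrable_pos_of_weighted h1) (integrable_pos_of_weighted h2) fun p =>
      mul_le_mul_of_nonneg_right (attenuatedInflow_mono hψ hτ h p) (le_max_right _ _)
  · exact integral_mono (integrable_neg_of_weighted h1) (integrable_neg_of_weighted h2) fun p =>
      mul_le_mul_of_nonneg_right (attenuatedInflow_mono hψ hτ h p) (le_max_right _ _)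
  · exact integral_nonneg fun p =>
      mul_nonneg (attenuatedInflow_nonneg hψ τ p) (le_max_right _ _)
  · exact integral_nonneg fun p =>
      mul_nonneg (attenuatedInflow_nonneg hψ τ' p) (le_max_right _ _)

/-- `4 A B ≤ (A + B)²` combined with Cauchy–Schwarz. It makes `a_l` and `c_l` positive when `k` is,
and shows that the set of admissible fields is nonempty. -/
lemma four_mul_kConst_le (hψ : ∀ p, 0 ≤ inflow fL fR p)
    (h_int : Integrable (fun p => inflow fL fR p * (1 + ‖p‖ ^ 2))) {τ : ℝ} (hτ : 0 < τ) :
    4 * kConst fL fR τ ≤ cLower fL fR τ * aLower fL fR τ := by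
  have h := sq_add_le_energy_mul_mass (attenuatedInflow_nonneg hψ τ)
    (integrable_attenuatedInflow hψ h_int hτ)
  rw [kConst_eq, cLower_eq, aLower_eq]
  refine le_trans ?_ h
  nlinarith [sq_nonneg ((∫ p, attenuatedInflow fL fR τ p * max (p 0) 0) -
      ∫ p, attenuatedInflow fL fR τ p * max (-p 0) 0)]

lemma aLower_nonneg (hψ : ∀ p, 0 ≤ inflow fL fR p) (τ : ℝ) : 0 ≤ aLower fL fR τ :=
  integral_nonneg (attenuatedInflow_nonneg hψ τ)

lemma cLower_nonneg (hψ : ∀ p, 0 ≤ inflow fL fR p) (τ : ℝ) : 0 ≤ cLower fL fR τ :=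
  integral_nonneg fun p => mul_nonneg (attenuatedInflow_nonneg hψ τ p) (sq_nonneg _)

lemma two_mul_aLower_le (hψ : ∀ p, 0 ≤ inflow fL fR p)
    (h_int : Integrable (fun p => inflow fL fR p * (1 + ‖p‖ ^ 2))) {τ : ℝ} (hτ : 0 < τ) :
    2 * aLower fL fR τ ≤ aUpper fL fR :=
  mul_le_mul_of_nonneg_left (integral_mono
    (integrable_of_weighted (integrable_attenuatedInflow hψ h_int hτ))
    (integrable_of_weighted h_int) (attenuatedInflow_le hψ hτ)) zero_le_two

lemma two_mul_cLower_le (hψ : ∀ p, 0 ≤ inflow fL fR p)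
    (h_int : Integrable (fun p => inflow fL fR p * (1 + ‖p‖ ^ 2))) {τ : ℝ} (hτ : 0 < τ) :
    2 * cLower fL fR τ ≤ cUpper fL fR :=
  mul_le_mul_of_nonneg_left (integral_mono
    (integrable_sq_of_weighted (integrable_attenuatedInflow hψ h_int hτ))
    (integrable_sq_of_weighted h_int) fun p =>
      mul_le_mul_of_nonneg_right (attenuatedInflow_le hψ hτ p) (sq_nonneg _)) zero_le_two

/-- The set of fields that satisfy the macroscopic bounds. -/
def boundRegion (fL fR : Momentum → ℝ) (τ : ℝ) : Set Fields :=
  {d | (aLower fL fR τ ≤ d.1 ∧ d.1 ≤ aUpper fL fR) ∧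
    (cLower fL fR τ ≤ d.2.2 ∧ d.2.2 ≤ cUpper fL fR) ∧
    kConst fL fR τ ≤ d.2.2 * d.1 - ‖d.2.1‖ ^ 2}

lemma isClosed_boundRegion (τ : ℝ) : IsClosed (boundRegion fL fR τ) := by
  have c1 : Continuous fun d : Fields => d.1 := by fun_prop
  have c2 : Continuous fun d : Fields => d.2.2 := by fun_prop
  have c3 : Continuous fun d : Fields => d.2.2 * d.1 - ‖d.2.1‖ ^ 2 := by fun_prop
  exact ((isClosed_le continuous_const c1).inter (isClosed_le c1 continuous_const)).inter
    (((isClosed_le continuous_const c2).inter (isClosed_le c2 continuous_const)).inter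
      (isClosed_le continuous_const c3))

end inflow

/-! ### Contraction principle for measurable profiles -/

section fixedPoint

variable {D : Set Fields} {F : (ℝ → Fields) → ℝ → Fields}

/-- A map of profiles that halves uniform distances has a fixed point. -/
theorem exists_fixed_profile (hne : D.Nonempty) (hcl : IsClosed D) {B : ℝ}
    (hB : ∀ d ∈ D, ∀ d' ∈ D, ‖d - d'‖ ≤ B) (hmaps : ∀ U, IsProfile D U → IsProfile D (F U))
    (hcontr : ∀ U V, IsProfile D U → IsProfile D V → ∀ Δ, (∀ y, ‖U y - V y‖ ≤ Δ) →
      ∀ y, ‖F U y - F V y‖ ≤ Δ / 2) :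
    ∃ U, IsProfile D U ∧ F U = U := by
  obtain ⟨d₀, hd₀⟩ := hne
  -- Picard iteration from a constant profile. Distances are uniform in `y`, and the pointwise limit
  -- stays measurable and in the closed set `D`, so no function space of profiles is needed.
  set u : ℕ → ℝ → Fields := fun n => F^[n] (fun _ => d₀) with hu
  have hsucc : ∀ n, u (n + 1) = F (u n) := fun n => Function.iterate_succ_apply' F n _
  have hprof : ∀ n, IsProfile D (u n) := by
    intro n
    induction n with
    | zero => exact ⟨measurable_const, fun _ => hd₀⟩
    | succ n ih => rw [hsucc]; exact hmaps _ ih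
  have hdist : ∀ n y, ‖u n y - u (n + 1) y‖ ≤ B * (1 / 2) ^ n := by
    intro n
    induction n with
    | zero => intro y; simpa using hB _ ((hprof 0).mem y) _ ((hprof 1).mem y)
    | succ n ih =>
      intro y
      have := hcontr _ _ (hprof n) (hprof (n + 1)) _ ih y
      rw [hsucc n, hsucc (n + 1), hsucc n] at *
      exact this.trans_eq (by ring)
  have hlim : ∀ y, ∃ l, Tendsto (fun n => u n y) atTop (nhds l) := fun y =>
    cauchySeq_tendsto_of_complete (cauchySeq_of_le_geometric (1 / 2) B (by norm_num)
      fun n => by rw [dist_eq_norm]; exact hdist n y)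
  choose V hV using hlim
  have hVp : IsProfile D V :=
    ⟨measurable_of_tendsto_metrizable (fun n => (hprof n).measurable) (tendsto_pi_nhds.2 hV),
      fun y => hcl.mem_of_tendsto (hV y) (Eventually.of_forall fun n => (hprof n).mem y)⟩
  have hrate : ∀ n y, ‖u n y - V y‖ ≤ 2 * B * (1 / 2) ^ n := by
    intro n y
    have := dist_le_of_le_geometric_of_tendsto (1 / 2) B (by norm_num)
      (fun n => by rw [dist_eq_norm]; exact hdist n y) (hV y) n
    rw [dist_eq_norm] at this
    exact this.trans_eq (by ring)
  refine ⟨V, hVp, funext fun y => ?_⟩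
  have h1 : Tendsto (fun n => u (n + 1) y) atTop (nhds (V y)) :=
    (hV y).comp (tendsto_add_atTop_nat 1)
  have h2 : Tendsto (fun n => u (n + 1) y) atTop (nhds (F V y)) := by
    rw [tendsto_iff_norm_sub_tendsto_zero]
    have h3 : Tendsto (fun n : ℕ => 2 * B * (1 / 2 : ℝ) ^ n / 2) atTop (nhds 0) := by
      have := (tendsto_pow_atTop_nhds_zero_of_lt_one (r := (1 / 2 : ℝ)) (by norm_num)
        (by norm_num)).const_mul (2 * B)
      simpa using this.div_const 2
    refine squeeze_zero (fun n => norm_nonneg _) (fun n => ?_) h3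
    rw [hsucc]
    exact hcontr _ _ (hprof n) hVp _ (hrate n) y
  exact tendsto_nhds_unique h2 h1

/-- Each application of `F` halves the distance of two fixed points, starting from the diameter
bound `B`. -/
theorem fixed_profile_unique {B : ℝ} (hB : ∀ d ∈ D, ∀ d' ∈ D, ‖d - d'‖ ≤ B)
    (hcontr : ∀ U V, IsProfile D U → IsProfile D V → ∀ Δ, (∀ y, ‖U y - V y‖ ≤ Δ) →
      ∀ y, ‖F U y - F V y‖ ≤ Δ / 2)
    {U V : ℝ → Fields} (hU : IsProfile D U) (hV : IsProfile D V) (hFU : F U = U) (hFV : F V = V) :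
    U = V := by
  have key : ∀ n : ℕ, ∀ y, ‖U y - V y‖ ≤ B * (1 / 2) ^ n := by
    intro n
    induction n with
    | zero => intro y; simpa using hB _ (hU.mem y) _ (hV.mem y)
    | succ n ih =>
      intro y
      have := hcontr U V hU hV _ ih y
      rw [hFU, hFV] at this
      exact this.trans_eq (by ring)
  funext y
  have h3 : Tendsto (fun n : ℕ => B * (1 / 2 : ℝ) ^ n) atTop (nhds 0) := by
    simpa using (tendsto_pow_atTop_nhds_zero_of_lt_one (r := (1 / 2 : ℝ)) (by norm_num)
      (by norm_num)).const_mul B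
  have h4 : ‖U y - V y‖ ≤ 0 := ge_of_tendsto' h3 fun n => key n y
  exact sub_eq_zero.1 (norm_le_zero_iff.1 h4)

end fixedPoint

/-! ### The field map and its Lipschitz bound -/

/-- The fields of the solution of the transport problem, extended constantly beyond the slab. -/
noncomputable def fieldMap (K : Fields → Momentum → ℝ) (τ : ℝ) (ψ : Momentum → ℝ)
    (U : ℝ → Fields) (x : ℝ) : Fields :=
  fieldsOf (transport K τ ψ U (projIcc (0 : ℝ) 1 zero_le_one x))

lemma fieldMap_of_mem {K : Fields → Momentum → ℝ} {τ : ℝ} {ψ : Momentum → ℝ} {U : ℝ → Fields}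
    {x : ℝ} (hx : x ∈ Icc (0 : ℝ) 1) : fieldMap K τ ψ U x = fieldsOf (transport K τ ψ U x) := by
  rw [fieldMap, projIcc_of_mem _ hx]

lemma fieldsOf_congr {g g' : Momentum → ℝ} (h : ∀ᵐ p, g p = g' p) : fieldsOf g = fieldsOf g' := by
  have h1 : mass g = mass g' := integral_congr_ae h
  have h2 : momentum g = momentum g' :=
    integral_congr_ae (h.mono fun p hp => by simp only [hp])
  have h3 : energy g = energy g' :=
    integral_congr_ae (h.mono fun p hp => by simp only [hp])
  rw [fieldsOf, fieldsOf, h1, h2, h3]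

lemma aestronglyMeasurable_fieldsOf {g : ℝ × Momentum → ℝ} {μ : Measure ℝ} [SFinite μ]
    (hg : AEStronglyMeasurable g (μ.prod volume)) :
    AEStronglyMeasurable (fun x => fieldsOf fun p => g (x, p)) μ := by
  have h2 : AEStronglyMeasurable (fun z : ℝ × Momentum => g z • z.2) (μ.prod volume) :=
    hg.smul (by fun_prop)
  have h3 : AEStronglyMeasurable (fun z : ℝ × Momentum => g z * ‖z.2‖ ^ 2) (μ.prod volume) :=
    hg.mul (by fun_prop)
  exact hg.integral_prod_right'.prodMk (h2.integral_prod_right'.prodMk h3.integral_prod_right')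

lemma stronglyMeasurable_fieldsOf {g : ℝ × Momentum → ℝ} (hg : StronglyMeasurable g) :
    StronglyMeasurable (fun x => fieldsOf fun p => g (x, p)) := by
  have h2 : StronglyMeasurable (fun z : ℝ × Momentum => g z • z.2) :=
    hg.smul (by fun_prop)
  have h3 : StronglyMeasurable (fun z : ℝ × Momentum => g z * ‖z.2‖ ^ 2) :=
    hg.mul (by fun_prop)
  exact hg.integral_prod_right'.prodMk (h2.integral_prod_right'.prodMk h3.integral_prod_right')

section maps

variable {n₀ a_u τ : ℝ} {D : Set Fields} {U V : ℝ → Fields} {K : Fields → Momentum → ℝ}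
  {h ψ : Momentum → ℝ}

/-- Replacing the data by a measurable representative leaves every moment unchanged. The field map
is thus genuinely measurable, as the everywhere defined profiles demand. -/
lemma measurable_fieldMap (hK : IsDominatedKernel D K h) (hψm : AEStronglyMeasurable ψ)
    (hU : IsProfile D U) (hn : 0 < n₀) (hD : ∀ d ∈ D, n₀ ≤ d.1 ∧ d.1 ≤ a_u) :
    Measurable (fieldMap K τ ψ U) := by
  have h1 : StronglyMeasurable fun z : ℝ × Momentum => transport K τ (hψm.mk ψ) U z.1 z.2 :=
    (((measurable_attenuation hU hn hD).mul
      (hψm.stronglyMeasurable_mk.measurable.comp measurable_snd)).add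
      (measurable_gainPart hK hU hn hD)).stronglyMeasurable
  have h2 : fieldMap K τ ψ U = (fun x => fieldsOf fun p => transport K τ (hψm.mk ψ) U x p) ∘
      fun x => (projIcc (0 : ℝ) 1 zero_le_one x : ℝ) := by
    funext x
    refine fieldsOf_congr ?_
    filter_upwards [hψm.ae_eq_mk] with p hp
    simp only [transport, boundaryPart, hp]
  rw [h2]
  exact (stronglyMeasurable_fieldsOf h1).measurable.comp
    (continuous_subtype_val.comp continuous_projIcc).measurable

lemma fieldMap_congr (hUV : ∀ᵐ y ∂volume.restrict (Icc (0 : ℝ) 1), U y = V y) :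
    fieldMap K τ ψ U = fieldMap K τ ψ V := by
  funext x
  exact fieldsOf_congr (Eventually.of_forall fun p => transport_congr hUV (Subtype.coe_prop _) p)

lemma norm_fieldMap_sub_le (hK : IsDominatedKernel D K h) (hψ : ∀ p, 0 ≤ ψ p)
    (hψi : Integrable fun p => ψ p * (1 + ‖p‖ ^ 2))
    (hψi' : Integrable fun p : Momentum => 1 / |p 0| * ψ p * (1 + ‖p‖ ^ 2))
    (hU : IsProfile D U) (hV : IsProfile D V) (hn : 0 < n₀)
    (hD : ∀ d ∈ D, n₀ ≤ d.1 ∧ d.1 ≤ a_u) (hτ : 0 < τ) {Δ : ℝ} (hUV : ∀ y, ‖U y - V y‖ ≤ Δ)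
    (x : ℝ) :
    ‖fieldMap K τ ψ U x - fieldMap K τ ψ V x‖ ≤
      Δ * (1 / τ * (∫ p : Momentum, 1 / |p 0| * ψ p * (1 + ‖p‖ ^ 2)) +
        (2 / n₀ * a_u + 1 + a_u) *
          ∫ p : Momentum, collisionWeight n₀ (1 / (τ * |p 0|)) * h p) := by
  have hψm := (integrable_of_weighted hψi).aestronglyMeasurable
  have i1 := hψi'.const_mul (1 / τ)
  have i2 := (integrable_collisionWeight_mul hK hn hτ).const_mul (2 / n₀ * a_u + 1 + a_u)
  refine (norm_fieldsOf_sub_le (integrable_transport_section hK hψ hψm hψi hU hn hD hτ _)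
    (integrable_transport_section hK hψ hψm hψi hV hn hD hτ _) ((i1.add i2).const_mul Δ)
    (abs_transport_sub_le hK hψ hU hV hn hD hτ hUV (Subtype.coe_prop _))).trans_eq ?_
  simp only [Pi.add_apply]
  rw [integral_const_mul, integral_add i1 i2, integral_const_mul, integral_const_mul]

end maps

/-! ### Invariance of the macroscopic bounds -/

section selfMap

variable {n₀ τ : ℝ} {D : Set Fields} {U : ℝ → Fields} {K : Fields → Momentum → ℝ}
  {h fL fR : Momentum → ℝ}

/-- For small collision integrals the transport problem preserves the macroscopic bounds. -/
lemma fieldsOf_transport_mem (hK : IsDominatedKernel D K h) (hψ : ∀ p, 0 ≤ inflow fL fR p)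
    (h_int : Integrable (fun p => inflow fL fR p * (1 + ‖p‖ ^ 2)))
    (hL_transverse : ∀ᵐ u : ℝ, 0 < u →
      (∫ q : ℝ × ℝ, fL !₂[u, q.1, q.2] * q.1) = 0 ∧ (∫ q : ℝ × ℝ, fL !₂[u, q.1, q.2] * q.2) = 0)
    (hR_transverse : ∀ᵐ u : ℝ, u < 0 →
      (∫ q : ℝ × ℝ, fR !₂[u, q.1, q.2] * q.1) = 0 ∧ (∫ q : ℝ × ℝ, fR !₂[u, q.1, q.2] * q.2) = 0)
    (hU : IsProfile D U) (hn : 0 < n₀) (hD : ∀ d ∈ D, n₀ ≤ d.1 ∧ d.1 ≤ aUpper fL fR) (hτ : 0 < τ)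
    {ε : ℝ} (hε : aUpper fL fR *
      (∫ p : Momentum, collisionWeight n₀ (1 / (τ * |p 0|)) * h p) ≤ ε)
    (hεa : ε ≤ aUpper fL fR / 2) (hεc : ε ≤ cUpper fL fR / 2)
    (hεk : 2 * ε ^ 2 ≤ 3 * kConst fL fR τ) {x : ℝ} (hx : x ∈ Icc (0 : ℝ) 1) :
    fieldsOf (transport K τ (inflow fL fR) U x) ∈ boundRegion fL fR τ := by
  set ψ := inflow fL fR with hψd
  have hψm := (integrable_of_weighted h_int).aestronglyMeasurable
  have hTi := integrable_transport_section hK hψ hψm h_int hU hn hD hτ x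
  have hφi := integrable_attenuatedInflow hψ h_int hτ
  have hφT : ∀ p, attenuatedInflow fL fR τ p ≤ transport K τ ψ U x p := fun p =>
    (le_boundaryPart hψ hU hn hD hτ hx p).trans
      (le_add_of_nonneg_right (gainPart_nonneg hK hU hn hD hτ x p))
  have hwi := (integrable_collisionWeight_mul hK hn hτ).const_mul (aUpper fL fR)
  have hgain := gainPart_le hK hU hn hD hτ x
  have hgain0 := gainPart_nonneg hK hU hn hD hτ x
  have hgm : AEStronglyMeasurable (gainPart K τ U x) :=
    ((measurable_gainPart hK hU hn hD).comp
      (measurable_prodMk_left (x := x))).aestronglyMeasurable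
  have hgi : Integrable fun p => gainPart K τ U x p * (1 + ‖p‖ ^ 2) := by
    refine hwi.mono' (hgm.mul (by fun_prop)) (Eventually.of_forall fun p => ?_)
    have := hgain0 p
    rw [Real.norm_of_nonneg (by positivity)]
    exact hgain p
  have hgε : ∫ p, gainPart K τ U x p * (1 + ‖p‖ ^ 2) ≤ ε := by
    refine (integral_mono hgi hwi hgain).trans ?_
    rwa [integral_const_mul]
  have hTle : ∀ p, transport K τ ψ U x p ≤ ψ p + gainPart K τ U x p := fun p =>
    by linarith [boundaryPart_le (U := U) hψ hτ x p, show transport K τ ψ U x p =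
      boundaryPart τ ψ U x p + gainPart K τ U x p from rfl]
  -- The data contribute at most half of `a_u`, since `a_u` is twice their mass, and the gain
  -- contributes at most `ε ≤ a_u / 2`. The energy is treated alike.
  have hmass : mass (transport K τ ψ U x) ≤ aUpper fL fR := by
    have e1 : ∫ p, gainPart K τ U x p ≤ ε :=
      (integral_mono (integrable_of_weighted hgi) hgi fun p => le_mul_of_one_le_right (hgain0 p)
        (by nlinarith [sq_nonneg ‖p‖])).trans hgε
    have e2 : mass (transport K τ ψ U x) ≤ ∫ p, (ψ p + gainPart K τ U x p) :=
      integral_mono (integrable_of_weighted hTi)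
        ((integrable_of_weighted h_int).add (integrable_of_weighted hgi)) hTle
    rw [integral_add (integrable_of_weighted h_int) (integrable_of_weighted hgi)] at e2
    have e3 : aUpper fL fR = 2 * ∫ p, ψ p := rfl
    linarith
  have henergy : energy (transport K τ ψ U x) ≤ cUpper fL fR := by
    have e1 : ∫ p, gainPart K τ U x p * ‖p‖ ^ 2 ≤ ε :=
      (integral_mono (integrable_sq_of_weighted hgi) hgi fun p =>
        mul_le_mul_of_nonneg_left (by linarith) (hgain0 p)).trans hgε
    have e2 : energy (transport K τ ψ U x) ≤
        ∫ p, (ψ p * ‖p‖ ^ 2 + gainPart K τ U x p * ‖p‖ ^ 2) := by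
      refine integral_mono (integrable_sq_of_weighted hTi)
        ((integrable_sq_of_weighted h_int).add (integrable_sq_of_weighted hgi)) fun p => ?_
      simp only
      rw [← add_mul]
      exact mul_le_mul_of_nonneg_right (hTle p) (sq_nonneg _)
    rw [integral_add (integrable_sq_of_weighted h_int) (integrable_sq_of_weighted hgi)] at e2
    have e3 : cUpper fL fR = 2 * ∫ p, ψ p * ‖p‖ ^ 2 := rfl
    linarith
  have hbi : Integrable fun p => boundaryPart τ ψ U x p * (1 + ‖p‖ ^ 2) := by
    have := hTi.sub hgi
    refine this.congr (Eventually.of_forall fun p => ?_)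
    simp only [Pi.sub_apply, transport]
    ring
  -- The attenuation depends on `p` only through `p₁`, so the inflow part carries no transverse
  -- momentum; what remains is due to the gain and is at most `ε`.
  have htrans : (∫ p, boundaryPart τ ψ U x p * p 1) = 0 ∧
      (∫ p, boundaryPart τ ψ U x p * p 2) = 0 := by
    have hA := measurable_cumulativeMass hU hn hD
    have hEm : Measurable fun u : ℝ => (if 0 < u then (0 : ℝ) else 1) :=
      Measurable.ite (measurableSet_lt (by fun_prop) (by fun_prop)) (by fun_prop) (by fun_prop)
    exact integral_transverse_eq_zero h_int hL_transverse hR_transverse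
      (w := fun u => Real.exp (-(1 / (τ * |u|)) *
        |cumulativeMass U x - cumulativeMass U (if 0 < u then 0 else 1)|)) (by fun_prop)
      fun u => by
        rw [abs_of_pos (Real.exp_pos _), Real.exp_le_one_iff]
        have : 0 ≤ 1 / (τ * |u|) *
          |cumulativeMass U x - cumulativeMass U (if 0 < u then 0 else 1)| := by positivity
        linarith
  have hPi : ∀ i : Fin 3, (∫ p, boundaryPart τ ψ U x p * p i) = 0 →
      |momentum (transport K τ ψ U x) i| ≤ ε := by
    intro i hi
    have e1 : momentum (transport K τ ψ U x) i = ∫ p, gainPart K τ U x p * p i := by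
      rw [momentum_apply hTi, ← zero_add (∫ p, gainPart K τ U x p * p i), ← hi,
        ← integral_add (integrable_coord_of_weighted hbi i) (integrable_coord_of_weighted hgi i)]
      simp only [transport, add_mul]
    rw [e1, ← Real.norm_eq_abs]
    refine (norm_integral_le_of_norm_le hgi (Eventually.of_forall fun p => ?_)).trans hgε
    rw [norm_mul, Real.norm_of_nonneg (hgain0 p)]
    exact mul_le_mul_of_nonneg_left (abs_apply_le_weight p i) (hgain0 p)
  -- This gives `4 k - 2 ε²`, which is at least `k` because `2 ε² ≤ 3 k`.
  have hkin := energy_mul_mass_sub_ge (attenuatedInflow_nonneg hψ τ) hφT hφi hTi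
    (hPi 1 htrans.1) (hPi 2 htrans.2)
  rw [← kConst_eq] at hkin
  refine ⟨⟨?_, hmass⟩, ⟨?_, henergy⟩, ?_⟩
  · exact integral_mono (integrable_of_weighted hφi) (integrable_of_weighted hTi) hφT
  · exact integral_mono (integrable_sq_of_weighted hφi) (integrable_sq_of_weighted hTi) fun p =>
      mul_le_mul_of_nonneg_right (hφT p) (sq_nonneg _)
  · change kConst fL fR τ ≤ energy (transport K τ ψ U x) * mass (transport K τ ψ U x)
      - ‖momentum (transport K τ ψ U x)‖ ^ 2
    linarith

end selfMap

/-! ### Mild solutions as fixed points -/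

section mild

variable {n₀ a_u τ : ℝ} {D : Set Fields} {U : ℝ → Fields} {s : Particle} {α γ : Fields → ℝ}
  {fL fR : Momentum → ℝ}

lemma cumulativeMass_mono (hU : IsProfile D U) (hn : 0 < n₀)
    (hD : ∀ d ∈ D, n₀ ≤ d.1 ∧ d.1 ≤ a_u) {x y : ℝ} (hxy : x ≤ y) :
    cumulativeMass U x ≤ cumulativeMass U y := by
  rw [← sub_nonneg, cumulativeMass_sub hU hn hD]
  exact intervalIntegral.integral_nonneg hxy fun t _ => by linarith [(hD _ (hU.mem t)).1]

lemma integral_congr_fst {m : ℝ → ℝ}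
    (hm : ∀ᵐ y ∂volume.restrict (Icc (0 : ℝ) 1), m y = (U y).1) {x y : ℝ}
    (hx : x ∈ Icc (0 : ℝ) 1) (hy : y ∈ Icc (0 : ℝ) 1) :
    ∫ t in x..y, m t = ∫ t in x..y, (U t).1 := by
  refine intervalIntegral.integral_congr_ae ?_
  rw [ae_restrict_iff' measurableSet_Icc] at hm
  filter_upwards [hm] with t ht hmem
  refine ht ?_
  have := uIoc_subset_uIcc hmem
  exact uIcc_subset_Icc hx hy this

/-- The mild formulation in terms of the transport problem. -/
lemma mildRHS_eq_transport (hU : IsProfile D U) (hn : 0 < n₀)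
    (hD : ∀ d ∈ D, n₀ ≤ d.1 ∧ d.1 ≤ a_u) {f : ℝ → Momentum → ℝ} {a c : ℝ → ℝ}
    (hf : ∀ᵐ y ∂volume.restrict (Icc (0 : ℝ) 1),
      mass (f y) = (U y).1 ∧ momentum (f y) = (U y).2.1 ∧ a y = α (U y) ∧ c y = γ (U y))
    {x : ℝ} (hx : x ∈ Icc (0 : ℝ) 1) {p : Momentum} (hp : p 0 ≠ 0) :
    mildRHS s τ fL fR f a c x p =
      transport (localEquilibrium s α γ) τ (inflow fL fR) U x p := by
  have h0 : (0 : ℝ) ∈ Icc (0 : ℝ) 1 := by simp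
  have h1 : (1 : ℝ) ∈ Icc (0 : ℝ) 1 := by simp
  have hm : ∀ᵐ y ∂volume.restrict (Icc (0 : ℝ) 1), mass (f y) = (U y).1 := hf.mono fun y h => h.1
  have hI : ∀ y ∈ Icc (0 : ℝ) 1, ∀ z ∈ Icc (0 : ℝ) 1,
      ∫ t in y..z, mass (f t) = cumulativeMass U z - cumulativeMass U y := fun y hy z hz => by
    rw [integral_congr_fst hm hy hz, cumulativeMass_sub hU hn hD]
  have hf' := (ae_restrict_iff' measurableSet_Icc).1 hf
  -- For `p₁ > 0` the interval of integration contains its endpoint `y = x`, where the gain density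
  -- is set to zero; this point is null.
  have hne : ∀ᵐ y : ℝ, y ≠ x := by rw [ae_iff]; simp
  unfold mildRHS transport boundaryPart gainPart
  rcases lt_or_gt_of_ne hp with hneg | hpos
  · rw [if_neg (not_lt.2 hneg.le), hI x hx 1 h1]
    congr 2
    · rw [entryWall, if_neg (not_lt.2 hneg.le), abs_sub_comm,
        abs_of_nonneg (sub_nonneg.2 (cumulativeMass_mono hU hn hD hx.2))]
    · simp [inflow, hneg, not_lt.2 hneg.le]
    · rw [intervalIntegral.integral_of_le hx.2]
      rw [setIntegral_eq_of_subset_of_forall_sdiff_eq_zero measurableSet_Ioc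
        (Ioc_subset_Ioc_left hx.1) (fun y hy => ?_)]
      · refine setIntegral_congr_ae measurableSet_Ioc ?_
        filter_upwards [hf'] with y hy hmem
        have hyI : y ∈ Icc (0 : ℝ) 1 := ⟨hx.1.trans hmem.1.le, hmem.2⟩
        obtain ⟨e1, e2, e3, e4⟩ := hy hyI
        rw [gainDensity, if_pos (mul_pos_of_neg_of_neg (by linarith [hmem.1]) hneg), hI x hx y hyI,
          e1, e2, e3, e4, abs_sub_comm (cumulativeMass U x),
          abs_of_nonneg (sub_nonneg.2 (cumulativeMass_mono hU hn hD hmem.1.le)), localEquilibrium]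
      · have hyx : y ≤ x := by
          by_contra hlt
          exact hy.2 ⟨not_le.1 hlt, hy.1.2⟩
        rw [gainDensity, if_neg (not_lt.2 (mul_nonpos_of_nonneg_of_nonpos (by linarith) hneg.le))]
  · rw [if_pos hpos, hI 0 h0 x hx]
    congr 2
    · rw [entryWall, if_pos hpos,
        abs_of_nonneg (sub_nonneg.2 (cumulativeMass_mono hU hn hD hx.1))]
    · simp [inflow, hpos]
    · rw [intervalIntegral.integral_of_le hx.1]
      rw [setIntegral_eq_of_subset_of_forall_sdiff_eq_zero measurableSet_Ioc
        (Ioc_subset_Ioc_right hx.2) (fun y hy => ?_)]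
      · refine setIntegral_congr_ae measurableSet_Ioc ?_
        filter_upwards [hf', hne] with y hy hyx hmem
        have hyI : y ∈ Icc (0 : ℝ) 1 := ⟨hmem.1.le, hmem.2.trans hx.2⟩
        obtain ⟨e1, e2, e3, e4⟩ := hy hyI
        have hlt : y < x := lt_of_le_of_ne hmem.2 hyx
        rw [gainDensity, if_pos (mul_pos (by linarith) hpos), hI y hyI x hx, e1, e2, e3, e4,
          abs_of_nonneg (sub_nonneg.2 (cumulativeMass_mono hU hn hD hmem.2)), localEquilibrium]
      · have hyx : x ≤ y := by
          by_contra hlt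
          exact hy.2 ⟨hy.1.1, (not_le.1 hlt).le⟩
        rw [gainDensity, if_neg (not_lt.2 (mul_nonpos_of_nonpos_of_nonneg (by linarith) hpos.le))]

lemma ae_coord_ne_zero : ∀ᵐ p : Momentum, p 0 ≠ 0 := by
  have h : ∀ᵐ u : ℝ, u ≠ 0 := by rw [ae_iff]; simp
  exact (Measure.quasiMeasurePreserving_fst.comp
    measurePreserving_momentumEquiv.quasiMeasurePreserving).ae h

lemma aestronglyMeasurable_of_memL12 {g : ℝ → Momentum → ℝ} (hg : MemL12 g) :
    AEStronglyMeasurable (fun z : ℝ × Momentum => g z.1 z.2) slab := by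
  have h1 : AEStronglyMeasurable (fun z : ℝ × Momentum => (1 + ‖z.2‖ ^ 2)⁻¹) slab :=
    (by fun_prop : Measurable fun z : ℝ × Momentum => (1 + ‖z.2‖ ^ 2)⁻¹).aestronglyMeasurable
  refine (hg.aestronglyMeasurable.mul h1).congr (Eventually.of_forall fun z => ?_)
  have : 1 + ‖z.2‖ ^ 2 ≠ 0 := by positivity
  simp only [Pi.mul_apply]
  field_simp

/-- Almost everywhere solutions come from almost everywhere fixed points of the field map. -/
lemma IsMildSolution.exists_profile {R : Set Fields} {g : ℝ → Momentum → ℝ} (hDR : D ⊆ R)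
    (hDm : MeasurableSet D) (hne : D.Nonempty)
    (hn : 0 < n₀) (hR : ∀ d ∈ R, n₀ ≤ d.1 ∧ d.1 ≤ a_u)
    (hsel : ∀ d ∈ R, IsEquilibriumParam s d.1 d.2.1 d.2.2 (α d) (γ d))
    (hg : IsMildSolution s τ fL fR g)
    (hgD : ∀ᵐ x ∂volume.restrict (Icc (0 : ℝ) 1), fieldsOf (g x) ∈ D) :
    ∃ V, IsProfile D V ∧
      (∀ᵐ x ∂volume.restrict (Icc (0 : ℝ) 1),
        fieldMap (localEquilibrium s α γ) τ (inflow fL fR) V x = V x) ∧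
      ∀ᵐ z ∂slab, g z.1 z.2 =
        transport (localEquilibrium s α γ) τ (inflow fL fR) V z.1 z.2 := by
  classical
  obtain ⟨hmem, a, c, hpar, hmild⟩ := hg
  obtain ⟨d₀, hd₀⟩ := hne
  have hm : AEStronglyMeasurable (fun x => fieldsOf (g x)) (volume.restrict (Icc (0 : ℝ) 1)) :=
    aestronglyMeasurable_fieldsOf (aestronglyMeasurable_of_memL12 hmem)
  set W := hm.mk _ with hW
  have hWm : Measurable W := hm.stronglyMeasurable_mk.measurable
  -- Profiles must be measurable with values in `D` everywhere, so a measurable representative of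
  -- the fields is overwritten by `d₀` where it leaves `D`.
  set V : ℝ → Fields := fun x => if W x ∈ D then W x else d₀ with hV
  have hVp : IsProfile D V := by
    refine ⟨Measurable.ite (hWm hDm) hWm measurable_const, fun y => ?_⟩
    simp only [hV]
    split_ifs with hy
    · exact hy
    · exact hd₀
  have hVg : ∀ᵐ x ∂volume.restrict (Icc (0 : ℝ) 1), V x = fieldsOf (g x) := by
    filter_upwards [hm.ae_eq_mk, hgD] with x hx hxD
    have : W x = fieldsOf (g x) := hx.symm
    simp only [hV, this, hxD, if_true]
  -- A solution comes with its own parameters `a` and `c`; uniqueness of equilibrium parameters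
  -- identifies them with the selection `α`, `γ`.
  have hf : ∀ᵐ y ∂volume.restrict (Icc (0 : ℝ) 1),
      mass (g y) = (V y).1 ∧ momentum (g y) = (V y).2.1 ∧ a y = α (V y) ∧ c y = γ (V y) := by
    filter_upwards [hVg, hpar] with y hy hp
    have h1 := hsel _ (hDR (hVp.mem y))
    rw [hy] at h1 ⊢
    obtain ⟨e1, e2⟩ := hp.unique h1
    exact ⟨rfl, rfl, e1, e2⟩
  have hR' : ∀ d ∈ D, n₀ ≤ d.1 ∧ d.1 ≤ a_u := fun d hd => hR d (hDR hd)
  have hIcc : ∀ᵐ x ∂volume.restrict (Icc (0 : ℝ) 1), x ∈ Icc (0 : ℝ) 1 :=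
    ae_restrict_mem measurableSet_Icc
  have hgT : ∀ᵐ z ∂slab, g z.1 z.2 =
      transport (localEquilibrium s α γ) τ (inflow fL fR) V z.1 z.2 := by
    have q1 : ∀ᵐ z ∂slab, z.1 ∈ Icc (0 : ℝ) 1 := Measure.quasiMeasurePreserving_fst.ae hIcc
    have q2 : ∀ᵐ z ∂slab, z.2 0 ≠ 0 := Measure.quasiMeasurePreserving_snd.ae ae_coord_ne_zero
    filter_upwards [hmild, q1, q2] with z hz hz1 hz2
    rw [hz]
    exact mildRHS_eq_transport hVp hn hR' hf hz1 hz2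
  refine ⟨V, hVp, ?_, hgT⟩
  filter_upwards [Measure.ae_ae_of_ae_prod hgT, hIcc, hVg] with x hx hxI hxV
  rw [fieldMap_of_mem hxI, hxV]
  exact (fieldsOf_congr hx).symm

end mild

/-! ### Existence and uniqueness for large relaxation times -/

/-- Well-posedness of the slab problem at a relaxation time for which collisions are weak. -/
theorem exists_unique_mild_solution {s : Particle} {fL fR : Momentum → ℝ} {τ τ₁ ε : ℝ}
    {α γ : Fields → ℝ} {h : Momentum → ℝ} (hψ : ∀ p, 0 ≤ inflow fL fR p)
    (h_int : Integrable (fun p => inflow fL fR p * (1 + ‖p‖ ^ 2)))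
    (h_int' : Integrable (fun p : Momentum => 1 / |p 0| * inflow fL fR p * (1 + ‖p‖ ^ 2)))
    (hL_transverse : ∀ᵐ u : ℝ, 0 < u →
      (∫ q : ℝ × ℝ, fL !₂[u, q.1, q.2] * q.1) = 0 ∧ (∫ q : ℝ × ℝ, fL !₂[u, q.1, q.2] * q.2) = 0)
    (hR_transverse : ∀ᵐ u : ℝ, u < 0 →
      (∫ q : ℝ × ℝ, fR !₂[u, q.1, q.2] * q.1) = 0 ∧ (∫ q : ℝ × ℝ, fR !₂[u, q.1, q.2] * q.2) = 0)
    (hτ₁ : 0 < τ₁) (hττ : τ₁ ≤ τ) (hn : 0 < aLower fL fR τ₁) (hk : 0 < kConst fL fR τ₁)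
    (hsel : ∀ d ∈ fieldRegion (aLower fL fR τ₁) (aUpper fL fR) (cUpper fL fR) (kConst fL fR τ₁),
      IsEquilibriumParam s d.1 d.2.1 d.2.2 (α d) (γ d))
    (hK : IsDominatedKernel
      (fieldRegion (aLower fL fR τ₁) (aUpper fL fR) (cUpper fL fR) (kConst fL fR τ₁))
      (localEquilibrium s α γ) h)
    (hε : aUpper fL fR *
      (∫ p : Momentum, collisionWeight (aLower fL fR τ₁) (1 / (τ * |p 0|)) * h p) ≤ ε)
    (hεa : ε ≤ aUpper fL fR / 2) (hεc : ε ≤ cUpper fL fR / 2)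
    (hεk : 2 * ε ^ 2 ≤ 3 * kConst fL fR τ₁)
    (hcontr : 1 / τ * (∫ p : Momentum, 1 / |p 0| * inflow fL fR p * (1 + ‖p‖ ^ 2)) +
      (2 / aLower fL fR τ₁ * aUpper fL fR + 1 + aUpper fL fR) *
        (∫ p : Momentum, collisionWeight (aLower fL fR τ₁) (1 / (τ * |p 0|)) * h p) ≤ 1 / 2) :
    ∃ f : ℝ → Momentum → ℝ,
      (∀ x ∈ Icc (0 : ℝ) 1, ∀ p, 0 ≤ f x p) ∧
      IsMildSolutionEverywhere s τ fL fR f ∧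
      (∀ x ∈ Icc (0 : ℝ) 1, MacroBounds fL fR τ (f x)) ∧
      ∀ g : ℝ → Momentum → ℝ, IsMildSolution s τ fL fR g →
        (∀ᵐ x ∂volume.restrict (Icc (0 : ℝ) 1), MacroBounds fL fR τ (g x)) →
        ∀ᵐ z ∂slab, g z.1 z.2 = f z.1 z.2 := by
  set R := fieldRegion (aLower fL fR τ₁) (aUpper fL fR) (cUpper fL fR) (kConst fL fR τ₁) with hRdef
  set D := boundRegion fL fR τ with hDdef
  set K := localEquilibrium s α γ with hKdef
  set ψ := inflow fL fR with hψdef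
  have hτ : 0 < τ := hτ₁.trans_le hττ
  have hψm := (integrable_of_weighted h_int).aestronglyMeasurable
  have hkτ := kConst_mono hψ h_int hτ₁ hττ
  -- The lower bounds `a_l` and `k` grow with `τ`, so the kernel and weight built once at `τ₁` serve
  -- all larger `τ`.
  have hDR : D ⊆ R := fun d hd =>
    ⟨(aLower_mono hψ h_int hτ₁ hττ).trans hd.1.1, hd.1.2, hd.2.1.2, hkτ.trans hd.2.2⟩
  have hRn : ∀ d ∈ R, aLower fL fR τ₁ ≤ d.1 ∧ d.1 ≤ aUpper fL fR := fun d hd => ⟨hd.1, hd.2.1⟩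
  have hRp : ∀ {U}, IsProfile D U → IsProfile R U := fun hU =>
    ⟨hU.measurable, fun y => hDR (hU.mem y)⟩
  have hDne : D.Nonempty := by
    have e1 := four_mul_kConst_le hψ h_int hτ
    have e2 := two_mul_aLower_le hψ h_int hτ
    have e3 := two_mul_cLower_le hψ h_int hτ
    have e4 := aLower_nonneg hψ τ
    have e5 := cLower_nonneg hψ τ
    -- Largest mass and energy with zero momentum: `a_u c_u ≥ 4 a_l c_l ≥ 16 k`.
    refine ⟨(aUpper fL fR, 0, cUpper fL fR), ⟨by simp only; linarith, le_rfl⟩,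
      ⟨by simp only; linarith, le_rfl⟩, ?_⟩
    simp only [norm_zero]
    nlinarith
  obtain ⟨B, hB⟩ : ∃ B, ∀ d ∈ D, ∀ d' ∈ D, ‖d - d'‖ ≤ B := by
    have hbd := (isCompact_fieldBox (n₀ := aLower fL fR τ₁) (a_u := aUpper fL fR)
      (c_u := cUpper fL fR)).isBounded
    obtain ⟨B, hB⟩ := Metric.isBounded_iff.1 hbd
    have hsub : D ⊆ _ := hDR.trans (fieldRegion_subset_fieldBox hn hk)
    exact ⟨B, fun d hd d' hd' => by rw [← dist_eq_norm]; exact hB (hsub hd) (hsub hd')⟩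
  have hmem : ∀ U, IsProfile D U → ∀ x ∈ Icc (0 : ℝ) 1, fieldsOf (transport K τ ψ U x) ∈ D :=
    fun U hU x hx => fieldsOf_transport_mem hK hψ h_int hL_transverse hR_transverse (hRp hU) hn
      hRn hτ hε hεa hεc (hεk.trans (by linarith)) hx
  have hmaps : ∀ U, IsProfile D U → IsProfile D (fieldMap K τ ψ U) := fun U hU =>
    ⟨measurable_fieldMap hK hψm (hRp hU) hn hRn, fun y => hmem U hU _ (Subtype.coe_prop _)⟩
  have hhalf : ∀ U V, IsProfile D U → IsProfile D V → ∀ Δ, (∀ y, ‖U y - V y‖ ≤ Δ) →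
      ∀ y, ‖fieldMap K τ ψ U y - fieldMap K τ ψ V y‖ ≤ Δ / 2 := by
    intro U V hU hV Δ hUV y
    have hΔ : 0 ≤ Δ := (norm_nonneg _).trans (hUV 0)
    refine (norm_fieldMap_sub_le hK hψ h_int h_int' (hRp hU) (hRp hV) hn hRn hτ hUV y).trans ?_
    rw [show Δ / 2 = Δ * (1 / 2) by ring]
    exact mul_le_mul_of_nonneg_left hcontr hΔ
  obtain ⟨U, hU, hfix⟩ := exists_fixed_profile hDne (isClosed_boundRegion τ) hB hmaps hhalf
  have hUx : ∀ x ∈ Icc (0 : ℝ) 1, fieldsOf (transport K τ ψ U x) = U x := fun x hx => by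
    rw [← fieldMap_of_mem hx, hfix]
  refine ⟨transport K τ ψ U, fun x _ p => transport_nonneg hK hψ (hRp hU) hn hRn hτ x p,
    ⟨integrable_transport hK hψ hψm h_int (hRp hU) hn hRn hτ _,
      fun x _ => integrable_transport_section hK hψ hψm h_int (hRp hU) hn hRn hτ x,
      fun x => α (U x), fun x => γ (U x), fun x hx => ⟨?_, fun p hp => ?_⟩⟩,
    fun x hx => hmem U hU x hx, fun g hg hgD => ?_⟩
  · have h1 := hsel _ (hDR (hU.mem x))
    beta_reduce
    rw [← hUx x hx] at h1 ⊢
    exact h1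
  · refine (mildRHS_eq_transport (hRp hU) hn hRn ?_ hx hp).symm
    refine (ae_restrict_iff' measurableSet_Icc).2 (Eventually.of_forall fun y hy => ?_)
    have h1 := hUx y hy
    exact ⟨congrArg Prod.fst h1, congrArg (fun d : Fields => d.2.1) h1, rfl, rfl⟩
  · obtain ⟨V, hV, hVfix, hgV⟩ := hg.exists_profile hDR (isClosed_boundRegion τ).measurableSet
      hDne hn hRn hsel hgD
    -- `V` is a fixed point only almost everywhere, but the field map ignores null sets; applying it
    -- once more yields a fixed point everywhere, which must be `U`.
    have hWfix : fieldMap K τ ψ (fieldMap K τ ψ V) = fieldMap K τ ψ V := fieldMap_congr hVfix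
    have hWU : fieldMap K τ ψ V = U :=
      fixed_profile_unique hB hhalf (hmaps V hV) hU hWfix hfix
    rw [hWU] at hVfix
    have q1 : ∀ᵐ z ∂slab, z.1 ∈ Icc (0 : ℝ) 1 :=
      Measure.quasiMeasurePreserving_fst.ae (ae_restrict_mem measurableSet_Icc)
    filter_upwards [hgV, q1] with z hz hz1
    rw [hz, transport_congr hVfix hz1]

end QuantumBGK

theorem theorem2p2 (s : QuantumBGK.Particle) (fL fR : QuantumBGK.Momentum → ℝ)
    (hL_nonneg : ∀ p : QuantumBGK.Momentum, 0 < p 0 → 0 ≤ fL p)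
    (hR_nonneg : ∀ p : QuantumBGK.Momentum, p 0 < 0 → 0 ≤ fR p)
    (h_int : Integrable (fun p => QuantumBGK.inflow fL fR p * (1 + ‖p‖ ^ 2)))
    (h_int' : Integrable (fun p : QuantumBGK.Momentum =>
      1 / |p 0| * QuantumBGK.inflow fL fR p * (1 + ‖p‖ ^ 2)))
    (hL_transverse : ∀ᵐ u : ℝ, 0 < u →
      (∫ q : ℝ × ℝ, fL !₂[u, q.1, q.2] * q.1) = 0 ∧ (∫ q : ℝ × ℝ, fL !₂[u, q.1, q.2] * q.2) = 0)
    (hR_transverse : ∀ᵐ u : ℝ, u < 0 →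
      (∫ q : ℝ × ℝ, fR !₂[u, q.1, q.2] * q.1) = 0 ∧ (∫ q : ℝ × ℝ, fR !₂[u, q.1, q.2] * q.2) = 0)
    (h_small : ∃ τ₁ : ℝ, 0 < τ₁ ∧ 0 < QuantumBGK.kConst fL fR τ₁ ∧
      QuantumBGK.aUpper fL fR ^ (8 / 5 : ℝ) / QuantumBGK.kConst fL fR τ₁ ^ (3 / 5 : ℝ)
        < QuantumBGK.beta s s.cCrit) :
    ∃ τ₀ : ℝ, 0 < τ₀ ∧ ∀ τ : ℝ, τ₀ ≤ τ →
      ∃ f : ℝ → QuantumBGK.Momentum → ℝ,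
        (∀ x ∈ Icc (0 : ℝ) 1, ∀ p, 0 ≤ f x p) ∧
        QuantumBGK.IsMildSolutionEverywhere s τ fL fR f ∧
        (∀ x ∈ Icc (0 : ℝ) 1, QuantumBGK.MacroBounds fL fR τ (f x)) ∧
        ∀ g : ℝ → QuantumBGK.Momentum → ℝ,
          (∀ᵐ z ∂QuantumBGK.slab, 0 ≤ g z.1 z.2) →
          QuantumBGK.IsMildSolution s τ fL fR g →
          (∀ᵐ x ∂volume.restrict (Icc (0 : ℝ) 1), QuantumBGK.MacroBounds fL fR τ (g x)) →
          ∀ᵐ z ∂QuantumBGK.slab, g z.1 z.2 = f z.1 z.2 := by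
  open QuantumBGK in
  obtain ⟨τ₁, hτ₁, hk, hsmall⟩ := h_small
  have hψ := inflow_nonneg hL_nonneg hR_nonneg
  have hlow := four_mul_kConst_le hψ h_int hτ₁
  have hcl := cLower_nonneg hψ τ₁
  have hal := aLower_nonneg hψ τ₁
  have hn : 0 < aLower fL fR τ₁ := by
    refine lt_of_le_of_ne hal fun h => ?_
    rw [← h, mul_zero] at hlow
    linarith
  have hc : 0 < cLower fL fR τ₁ := by
    refine lt_of_le_of_ne hcl fun h => ?_
    rw [← h, zero_mul] at hlow
    linarith
  have hau := two_mul_aLower_le hψ h_int hτ₁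
  have hcu := two_mul_cLower_le hψ h_int hτ₁
  obtain ⟨α, γ, h, hsel, hK⟩ := exists_dominated_equilibrium (c_u := cUpper fL fR) hn
    (by linarith) hk hsmall
  -- The size allowed to the gain: the first two entries keep mass and energy below their upper
  -- bounds, and the square root gives `2 ε² ≤ 2 k(τ₁)`.
  set ε : ℝ := min (min (aUpper fL fR / 2) (cUpper fL fR / 2)) (Real.sqrt (kConst fL fR τ₁))
    with hε
  have hε0 : 0 < ε :=
    lt_min (lt_min (by linarith) (by linarith)) (Real.sqrt_pos.2 hk)
  have hεk : 2 * ε ^ 2 ≤ 3 * kConst fL fR τ₁ := by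
    have h1 : ε ^ 2 ≤ Real.sqrt (kConst fL fR τ₁) ^ 2 := by
      gcongr
      exact min_le_right _ _
    rw [Real.sq_sqrt hk.le] at h1
    linarith
  have ht := tendsto_collision_integral hK hn
  have t1 := ht.const_mul (aUpper fL fR)
  have t2 := ht.const_mul (2 / aLower fL fR τ₁ * aUpper fL fR + 1 + aUpper fL fR)
  have t3 : Tendsto (fun τ : ℝ => 1 / τ *
      ∫ p : Momentum, 1 / |p 0| * inflow fL fR p * (1 + ‖p‖ ^ 2)) atTop (nhds 0) := by
    simpa using (tendsto_inv_atTop_zero (𝕜 := ℝ)).mul_const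
      (∫ p : Momentum, 1 / |p 0| * inflow fL fR p * (1 + ‖p‖ ^ 2))
  have t4 := t3.add t2
  rw [mul_zero] at t1
  rw [mul_zero, add_zero] at t4
  have hev := (t1.eventually_le_const hε0).and ((t4.eventually_le_const
    (show (0 : ℝ) < 1 / 2 by norm_num)).and (eventually_ge_atTop τ₁))
  obtain ⟨τ₀, hτ₀⟩ := eventually_atTop.1 hev
  -- The maximum with `τ₁` makes the threshold positive; the threshold from the limits has no sign
  -- of its own.
  refine ⟨max τ₀ τ₁, lt_max_of_lt_right hτ₁, fun τ hτ => ?_⟩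
  obtain ⟨c1, c2, c3⟩ := hτ₀ τ ((le_max_left _ _).trans hτ)
  obtain ⟨f, hf0, hf, hfb, huniq⟩ := exists_unique_mild_solution hψ h_int h_int' hL_transverse
    hR_transverse hτ₁ c3 hn hk hsel hK c1 ((min_le_left _ _).trans (min_le_left _ _))
    ((min_le_left _ _).trans (min_le_right _ _)) hεk c2
  exact ⟨f, hf0, hf, hfb, fun g _ hg hgb => huniq g hg hgb⟩
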